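/- **Setting.** Let $\mathcal H$ be the set of hyperplanes $H(\alpha,u)=\{x\in\mathbb R^\ell:\langle x,u\rangle=\alpha\}$, $\alpha\in\mathbb R$, $u$ in the upper half unit sphere of $\mathbb R^\ell$ (one of the vectors $u,-u$ being kept on its equator), with the $\sigma$-algebra induced from the Borel $\sigma$-algebra of the parameters. Write $H^-,H^+$ for the closed half-spaces $\{\langle x,u\rangle\le\alpha\}$, $\{\langle x,u\rangle\ge\alpha\}$ and $[B]=\{H\in\mathcal H:H\cap B\ne\emptyset\}$. Let $\Lambda$ be a non-zero translation invariant measure on $\mathcal H$ with $\Lambda([B])<\infty$ for every bounded Borel set $B$, such that there is no line to which all hyperplanes of the support of $\Lambda$ are parallel. A cell, or window, is a polytope with nonempty interior. Fix a window $W$. A tessellation of $W$ is a finite set of cells with pairwise disjoint interiors and union $W$. The set $\mathbb T\wedge W$ of all tessellations of $W$ carries the $\sigma$-algebra generated by the events $\{T:\partial T\cap A=\emptyset\}$, $A\subseteq W$ compact, where $\partial T=\bigcup_{C\in T}\partial C$. Put $\Lambda_{[B]}=\Lambda(\cdot\cap[B])$, $\widehat\Lambda_{[W]}=\Lambda([W])^{-1}\Lambda_{[W]}$,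 and, for $T\in\mathbb T\wedge W$, $$\zeta(T)=\sum_{C\in T}\Lambda([C]),\qquad \Gamma_T=\sum_{C\in T}\Lambda_{[C]},\qquad \widehat\Gamma_T=\zeta(T)^{-1}\Gamma_T .$$ Let $\mathcal E^*$ be the set of finite words over $\{-,+\}$, with empty word $o$, ordered by length and, for equal length, lexicographically with $-<+$. **STIT tessellation process in $W$ associated with $\Lambda_{[W]}$.** Let $(Z(e))_{e\in\mathcal E^*}$, with $Z(e)\sim\mathrm{Exponential}(1)$, and $(G'_n)_{n\ge1}$, with $G'_n\sim\widehat\Lambda_{[W]}$, be two independent families of independent random variables. Put $C(o)=W$ and, for $e\in\mathcal E^*$, $H(e)=G'_{\kappa(e)}$ with $\kappa(e)=\inf\{n: G'_n\in[C(e)],\ n>\kappa(e')\text{ for all }e'<e\}$, and $C(e\,\pm)=C(e)\cap H(e)^{\pm}$. The cell $C(e)$ has lifetime $t_l(e)=\Lambda([C(e)])^{-1}Z(e)$; it is born at time $t_b(e)$, where $t_b(o)=0$ and $t_b(e\,\pm)=t_b(e)+t_l(e)$. Then $(Y\wedge W)_t=\{C(e):t_b(e)\le t<t_b(e)+t_l(e)\}$,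 $t\ge0$. **New construction.** Let $(U_n)_{n\ge1}$, $(V_n)_{n\ge1}$, $(G_n)_{n\ge1}$ be three independent sequences of i.i.d. random variables with $U_n\sim\mathrm{Uniform}[0,1)$, $V_n\sim\mathrm{Exponential}(1)$, $G_n\sim\widehat\Lambda_{[W]}$. For $n\ge0$ and $T\in\mathbb T\wedge W$ let $\Xi_{n,T}$ be a map that transports $\widehat\Lambda_{[W]}$ to $\widehat\Gamma_T$, that is, $\widehat\Lambda_{[W]}\circ\Xi_{n,T}^{-1}=\widehat\Gamma_T$ (for instance an isomorphism of Lebesgue probability spaces), such that $(T,H)\mapsto\Xi_{n,T}(H)$ is measurable with respect to the completion of the product $\sigma$-algebra under $\mu\otimes\widehat\Lambda_{[W]}$, for every probability measure $\mu$ on $\mathbb T\wedge W$. Put $\mathcal Y_0=\{C(o)\}$, $C(o)=W$, $E_0=\{o\}$. Given $\mathcal Y_n=\{C(e):e\in E_n\}$ with $E_n\subset\mathcal E^*$ finite, put $H_{n+1}=\Xi_{n,\mathcal Y_n}(G_{n+1})$, divide $[0,1)$ into consecutive intervals of equal length, indexed in increasing order by the words $e\in E_n$ with $H_{n+1}\in[C(e)]$,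 let $e^*$ be the word whose interval contains $U_{n+1}$, and divide $C(e^*)$ by $H_{n+1}$: $C(e^*\,\pm)=C(e^*)\cap H_{n+1}^{\pm}$, $E_{n+1}=(E_n\setminus\{e^*\})\cup\{e^*-,e^*+\}$ and $\mathcal Y_{n+1}=\{C(e):e\in E_{n+1}\}$. Let $\mathcal S_0=0$, $\mathcal S_{n+1}=\mathcal S_n+\zeta(\mathcal Y_n)^{-1}V_{n+1}$, and $(\widehat Y\wedge W)_t=\mathcal Y_n$ for $t\in[\mathcal S_n,\mathcal S_{n+1})$. **Theorem.** Almost surely every $\mathcal Y_n$ is a tessellation of $W$ and $\mathcal S_n\to\infty$, so that $(\widehat Y\wedge W)_t$ is defined for all $t\ge0$; almost surely $(Y\wedge W)_t$ is a tessellation of $W$ for all $t\ge0$; and $\widehat Y\wedge W$ is the STIT tessellation process in $W$ associated with $\Lambda_{[W]}$: the processes $((\widehat Y\wedge W)_t)_{t\ge0}$ and $((Y\wedge W)_t)_{t\ge0}$ have the same law on $(\mathbb T\wedge W)^{[0,\infty)}$ with the product $\sigma$-algebra. -/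

import Mathlib

open MeasureTheory ProbabilityTheory Set Filter
open scoped ENNReal NNReal Topology

noncomputable section

namespace STIT

/-! ### Cells, windows and tessellations of a window -/

/-- The Euclidean space of dimension `ℓ`. -/
abbrev Space (ℓ : ℕ) := EuclideanSpace ℝ (Fin ℓ)

/-- A cell is a polytope (the convex hull of a finite set) with nonempty interior. -/
def IsCell {ℓ : ℕ} (C : Set (Space ℓ)) : Prop :=
  (∃ F : Finset (Space ℓ), C = convexHull ℝ (F : Set (Space ℓ))) ∧ (interior C).Nonempty

/-- A window is a polytope with nonempty interior. -/
structure Window (ℓ : ℕ) where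
  carrier : Set (Space ℓ)
  isCell : IsCell carrier

/-- A tessellation of `W`: a finite class of cells with pairwise disjoint interiors covering `W`. -/
structure IsTessellation {ℓ : ℕ} (W : Set (Space ℓ)) (T : Set (Set (Space ℓ))) : Prop where
  finite : T.Finite
  isCell : ∀ C ∈ T, IsCell C
  disjoint : T.PairwiseDisjoint interior
  cover : ⋃₀ T = W

/-- The space of all tessellations of the window `W`. -/
def Tess {ℓ : ℕ} (W : Window ℓ) := {T : Set (Set (Space ℓ)) // IsTessellation W.carrier T}

/-- `∂T`, the union of the boundaries of the cells. -/
def boundary {ℓ : ℕ} (T : Set (Set (Space ℓ))) : Set (Space ℓ) := ⋃ C ∈ T, frontier C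

/-- The σ-algebra generated by the events `∂T ∩ A = ∅`, for `A ⊆ W` compact. -/
instance {ℓ : ℕ} (W : Window ℓ) : MeasurableSpace (Tess W) :=
  MeasurableSpace.generateFrom
    {s | ∃ A : Set (Space ℓ), IsCompact A ∧ A ⊆ W.carrier ∧
      s = {T : Tess W | boundary T.1 ∩ A = ∅}}

/-- The trivial tessellation, whose only cell is the window. -/
def Tess.trivial {ℓ : ℕ} (W : Window ℓ) : Tess W :=
  ⟨{W.carrier},
    { finite := finite_singleton _
      isCell := by
        intro C hC
        rw [mem_singleton_iff.1 hC]
        exact W.isCell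
      disjoint := pairwiseDisjoint_singleton _ _
      cover := sUnion_singleton _ }⟩

open Classical in
/-- A class of sets, read as a tessellation of `W`; a class that is not a tessellation
(an event of probability zero in all uses below) is replaced by the trivial one. -/
def Tess.ofCells {ℓ : ℕ} (W : Window ℓ) (T : Set (Set (Space ℓ))) : Tess W :=
  if h : IsTessellation W.carrier T then ⟨T, h⟩ else Tess.trivial W

/-! ### Hyperplanes -/

/-- Unit vectors whose last nonzero coordinate is positive: the upper half unit sphere, with
exactly one vector of each pair `u, -u` on its equator. -/
def halfSphere (ℓ : ℕ) : Set (Space ℓ) :=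
  {u | ‖u‖ = 1 ∧ ∃ i, 0 < u i ∧ ∀ j, i < j → u j = 0}

/-- Hyperplanes, given by their parameters `(α, u)`, signed distance and unit normal; the
measurable structure is the Borel structure of the parameter space. -/
abbrev Hyp (ℓ : ℕ) := ℝ × halfSphere ℓ

/-- `H(α, u) = {x | ⟨x, u⟩ = α}` as a set of points. -/
def Hyp.plane {ℓ : ℕ} (h : Hyp ℓ) : Set (Space ℓ) := {x | inner ℝ x (h.2 : Space ℓ) = h.1}

/-- The closed half-spaces `H⁻` (sign `false`) and `H⁺` (sign `true`). -/
def Hyp.half {ℓ : ℕ} (h : Hyp ℓ) : Bool → Set (Space ℓ)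
  | false => {x | inner ℝ x (h.2 : Space ℓ) ≤ h.1}
  | true => {x | h.1 ≤ inner ℝ x (h.2 : Space ℓ)}

/-- Every hyperplane `{x | ⟨x, u⟩ = α}`, `u` a unit vector, has parameters. -/
theorem Hyp.exists_plane_eq {ℓ : ℕ} (α : ℝ) (u : Space ℓ) (hu : ‖u‖ = 1) :
    ∃ h : Hyp ℓ, h.plane = {x | inner ℝ x u = α} := by
  classical
  have hne : (Finset.univ.filter fun i => u i ≠ 0).Nonempty := by
    by_contra hcon
    have h0 : u = 0 := by
      ext i
      by_contra hi
      exact hcon ⟨i, by simpa using hi⟩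
    simp [h0] at hu
  set i := (Finset.univ.filter fun i => u i ≠ 0).max' hne with hi
  have hi0 : u i ≠ 0 := (Finset.mem_filter.1 (Finset.max'_mem _ hne)).2
  have hj : ∀ j, i < j → u j = 0 := by
    intro j hij
    by_contra hcon
    exact absurd (Finset.le_max' _ j (by simpa using hcon)) (not_le.2 hij)
  rcases lt_or_gt_of_ne hi0 with h | h
  · refine ⟨(-α, ⟨-u, by simpa using hu, i, by simpa using h, fun j hij => by simp [hj j hij]⟩), ?_⟩
    ext x
    simp [Hyp.plane]
  · exact ⟨(α, ⟨u, hu, i, h, hj⟩), rfl⟩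

/-- The parameters of a hyperplane are unique. -/
theorem Hyp.plane_injective {ℓ : ℕ} : Function.Injective (Hyp.plane (ℓ := ℓ)) := by
  rintro ⟨a, ⟨u, hu, i, hi, hi'⟩⟩ ⟨b, ⟨v, hv, j, hj, hj'⟩⟩ h
  have key : ∀ x : Space ℓ, inner ℝ x u = a ↔ inner ℝ x v = b := by
    intro x
    have := congrArg (fun s => x ∈ s) h
    simpa [Hyp.plane] using this
  have huu : inner ℝ u u = 1 := by rw [real_inner_self_eq_norm_sq, hu]; norm_num
  have hvv : inner ℝ v v = 1 := by rw [real_inner_self_eq_norm_sq, hv]; norm_num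
  set c := inner ℝ u v with hc
  have h1 : a * c = b := by
    have := (key (a • u)).1 (by rw [real_inner_smul_left, huu, mul_one])
    rwa [real_inner_smul_left] at this
  have h2 : v = c • u := by
    have hx := (key (a • u + (v - c • u))).1 (by
      rw [inner_add_left, inner_sub_left, real_inner_smul_left, real_inner_smul_left, huu,
        real_inner_comm]
      ring)
    have h3 : inner ℝ (v - c • u) v = 0 := by
      rw [inner_add_left, real_inner_smul_left] at hx
      linarith
    have h4 : inner ℝ (v - c • u) u = 0 := by
      rw [inner_sub_left, real_inner_smul_left, huu, real_inner_comm]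
      ring
    have h5 : inner ℝ (v - c • u) (v - c • u) = 0 := by
      rw [inner_sub_right, h3, real_inner_smul_right, h4]
      ring
    exact sub_eq_zero.1 (inner_self_eq_zero.1 h5)
  have hcsq : c * c = 1 := by
    have h6 := hvv
    rw [h2, real_inner_smul_left, real_inner_smul_right, huu] at h6
    linarith
  have hvk : ∀ k, v k = c * u k := fun k => by rw [h2]; simp
  rcases mul_self_eq_one_iff.1 hcsq with h7 | h7
  · have huv : u = v := by rw [h2, h7, one_smul]
    subst huv
    have hab : a = b := by rw [← h1, h7, mul_one]
    subst hab
    rfl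
  · exfalso
    rw [h7] at hvk
    rcases lt_trichotomy i j with hij | hij | hij
    · have := hvk j
      rw [hi' j hij] at this
      linarith
    · subst hij
      have := hvk i
      linarith
    · have := hvk i
      rw [hj' i hij] at this
      linarith

/-- `[B]`, the set of all hyperplanes that hit `B`. -/
def hit {ℓ : ℕ} (B : Set (Space ℓ)) : Set (Hyp ℓ) := {h | (h.plane ∩ B).Nonempty}

/-- The translate `H + v`. -/
def Hyp.translate {ℓ : ℕ} (v : Space ℓ) (h : Hyp ℓ) : Hyp ℓ :=
  (h.1 + inner ℝ v (h.2 : Space ℓ), h.2)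

/-- The standing assumptions on the hyperplane measure: it is nonzero, translation invariant,
locally finite, and there is no line (of direction `v`) to which all hyperplanes of its support
are parallel. -/
structure IsHyperplaneMeasure {ℓ : ℕ} (Λ : Measure (Hyp ℓ)) : Prop where
  ne_zero : Λ ≠ 0
  translation_invariant : ∀ v : Space ℓ, Λ.map (Hyp.translate v) = Λ
  locally_finite : ∀ B : Set (Space ℓ), MeasurableSet B → Bornology.IsBounded B → Λ (hit B) < ∞
  not_parallel : ∀ v : Space ℓ, v ≠ 0 → ∃ h ∈ Λ.support, inner ℝ v (h.2 : Space ℓ) ≠ 0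

/-- The probability measure obtained by normalizing the restriction of `Λ` to `[B]`. -/
def normalized {ℓ : ℕ} (Λ : Measure (Hyp ℓ)) (B : Set (Space ℓ)) : Measure (Hyp ℓ) :=
  (Λ (hit B))⁻¹ • Λ.restrict (hit B)

/-- `ζ(T) = ∑_{C ∈ T} Λ([C])`. -/
def zeta {ℓ : ℕ} (Λ : Measure (Hyp ℓ)) {W : Window ℓ} (T : Tess W) : ℝ≥0∞ :=
  ∑' C : T.1, Λ (hit (C : Set (Space ℓ)))

/-- `Γ_T = ∑_{C ∈ T} Λ_{[C]}`. -/
def gam {ℓ : ℕ} (Λ : Measure (Hyp ℓ)) {W : Window ℓ} (T : Tess W) : Measure (Hyp ℓ) :=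
  Measure.sum fun C : T.1 => Λ.restrict (hit (C : Set (Space ℓ)))

/-- The normalized measure `ζ(T)⁻¹ Γ_T`. -/
def gamHat {ℓ : ℕ} (Λ : Measure (Hyp ℓ)) {W : Window ℓ} (T : Tess W) : Measure (Hyp ℓ) :=
  (zeta Λ T)⁻¹ • gam Λ T

/-! ### Binary words -/

/-- Words over `{-, +}`, where `-` is `false` and `+` is `true`; the empty word is the root and the
successors of `e` are `e ++ [false]` and `e ++ [true]`. -/
abbrev Word := List Bool

/-- The strict order on words: by length first, and lexicographic among words of equal length. -/
def wlt (e e' : Word) : Prop := List.Shortlex (· < ·) e e'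

theorem wlt_wf : WellFounded wlt := List.Shortlex.wf wellFounded_lt

/-- The cell `C(e)` obtained from `W` by successively cutting along the path `e`, when `H p` is the
hyperplane that divides the cell of the word `p`. -/
def pathCell {ℓ : ℕ} (W : Set (Space ℓ)) (H : Word → Hyp ℓ) (e : Word) : Set (Space ℓ) :=
  {x | x ∈ W ∧ ∀ i (hi : i < e.length), x ∈ (H (e.take i)).half e[i]}

theorem pathCell_nil {ℓ : ℕ} (W : Set (Space ℓ)) (H : Word → Hyp ℓ) : pathCell W H [] = W := by
  simp [pathCell]

theorem pathCell_snoc {ℓ : ℕ} (W : Set (Space ℓ)) (H : Word → Hyp ℓ) (e : Word) (b : Bool) :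
    pathCell W H (e ++ [b]) = pathCell W H e ∩ (H e).half b := by
  ext x
  constructor
  · rintro ⟨hW, h⟩
    refine ⟨⟨hW, fun i hi => ?_⟩, ?_⟩
    · have := h i (by simp; omega)
      rwa [List.take_append_of_le_length hi.le, List.getElem_append_left hi] at this
    · have := h e.length (by simp)
      simpa using this
  · rintro ⟨⟨hW, h⟩, hb⟩
    refine ⟨hW, fun i hi => ?_⟩
    rcases Nat.lt_or_ge i e.length with hlt | hge
    · rw [List.take_append_of_le_length hlt.le, List.getElem_append_left hlt]
      exact h i hlt
    · have hie : i = e.length := by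
        simp at hi
        omega
      subst hie
      simpa using hb

/-! ### The STIT tessellation in a window (construction by rejection along the tree)

Sequences are indexed from `0`: `g n` stands for the hyperplane with number `n + 1`. -/

open Classical in
/-- `κ(e)`, the number of the first hyperplane of the sequence `g` that comes later than all the
numbers `κ(e')`, `e' < e`, and hits `C(e)`. The recursion is spelled out in `kappa_eq`. -/
def kappa {ℓ : ℕ} (W : Set (Space ℓ)) (g : ℕ → Hyp ℓ) : Word → ℕ :=
  wlt_wf.fix fun e rec =>
    sInf {n | (∀ e' (h : wlt e' e), rec e' h < n) ∧
      g n ∈ hit (pathCell W (fun p => if h : wlt p e then g (rec p h) else g 0) e)}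

/-- `H(e) = G_{κ(e)}`. -/
def stitHyp {ℓ : ℕ} (W : Set (Space ℓ)) (g : ℕ → Hyp ℓ) (e : Word) : Hyp ℓ := g (kappa W g e)

/-- `C(e)`. -/
def stitCell {ℓ : ℕ} (W : Set (Space ℓ)) (g : ℕ → Hyp ℓ) (e : Word) : Set (Space ℓ) :=
  pathCell W (stitHyp W g) e

open Classical in
theorem kappa_eq {ℓ : ℕ} (W : Set (Space ℓ)) (g : ℕ → Hyp ℓ) (e : Word) :
    kappa W g e = sInf {n | (∀ e', wlt e' e → kappa W g e' < n) ∧ g n ∈ hit (stitCell W g e)} := by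
  unfold kappa
  rw [WellFounded.fix_eq]
  have hcell : pathCell W (fun p => if wlt p e then g (kappa W g p) else g 0) e
      = stitCell W g e := by
    ext x
    have hlt : ∀ i, i < e.length → wlt (e.take i) e := fun i hi =>
      List.Shortlex.of_length_lt (by simp; omega)
    constructor
    · rintro ⟨hW, h⟩
      refine ⟨hW, fun i hi => ?_⟩
      have := h i hi
      simpa [hlt i hi, stitHyp] using this
    · rintro ⟨hW, h⟩
      refine ⟨hW, fun i hi => ?_⟩
      have := h i hi
      simpa [hlt i hi, stitHyp] using this
  rw [← hcell]
  rfl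

/-- The lifetime `t_l(e) = Λ([C(e)])⁻¹ Z(e)`. -/
def lifeTime {ℓ : ℕ} (Λ : Measure (Hyp ℓ)) (W : Set (Space ℓ)) (z : Word → ℝ) (g : ℕ → Hyp ℓ)
    (e : Word) : ℝ :=
  (Λ (hit (stitCell W g e))).toReal⁻¹ * z e

/-- The birth time `t_b(e)`: the sum of the lifetimes of all proper ancestors of `e`. -/
def birthTime {ℓ : ℕ} (Λ : Measure (Hyp ℓ)) (W : Set (Space ℓ)) (z : Word → ℝ) (g : ℕ → Hyp ℓ)
    (e : Word) : ℝ :=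
  ∑ i ∈ Finset.range e.length, lifeTime Λ W z g (e.take i)

theorem birthTime_snoc {ℓ : ℕ} (Λ : Measure (Hyp ℓ)) (W : Set (Space ℓ)) (z : Word → ℝ)
    (g : ℕ → Hyp ℓ) (e : Word) (b : Bool) :
    birthTime Λ W z g (e ++ [b]) = birthTime Λ W z g e + lifeTime Λ W z g e := by
  simp only [birthTime, List.length_append, List.length_singleton, Finset.sum_range_succ]
  congr 1
  · refine Finset.sum_congr rfl fun i hi => ?_
    rw [List.take_append_of_le_length (Finset.mem_range.1 hi).le]
  · simp

/-- The class of cells that are alive at time `t`. -/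
def stitCells {ℓ : ℕ} (Λ : Measure (Hyp ℓ)) (W : Set (Space ℓ)) (z : Word → ℝ) (g : ℕ → Hyp ℓ)
    (t : ℝ≥0) : Set (Set (Space ℓ)) :=
  stitCell W g '' {e | birthTime Λ W z g e ≤ t ∧ (t : ℝ) < birthTime Λ W z g e + lifeTime Λ W z g e}

/-- The path of the STIT tessellation in the window `W`. -/
def stitPath {ℓ : ℕ} (Λ : Measure (Hyp ℓ)) (W : Window ℓ) (z : Word → ℝ) (g : ℕ → Hyp ℓ)
    (t : ℝ≥0) : Tess W :=
  Tess.ofCells W (stitCells Λ W.carrier z g t)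

/-! ### The construction in which the hyperplane is drawn before the cell is chosen -/

/-- A finite set `E` of words together with the cells `C(e)`, `e ∈ E`. -/
structure Labelled (ℓ : ℕ) where
  leaves : Finset Word
  cell : Word → Set (Space ℓ)

namespace Labelled

variable {ℓ : ℕ}

/-- The class of cells `{C(e) : e ∈ E}`. -/
def cells (S : Labelled ℓ) : Set (Set (Space ℓ)) := S.cell '' (S.leaves : Set Word)

/-- The root only, with cell `W`. -/
def init (W : Set (Space ℓ)) : Labelled ℓ := ⟨{[]}, fun _ => W⟩

open Classical in
/-- The words in `E` whose cell is hit by `h`. -/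
def hits (S : Labelled ℓ) (h : Hyp ℓ) : Finset Word := S.leaves.filter fun e => h ∈ hit (S.cell e)

open Classical in
/-- The number of words smaller than `e` whose cell is hit by `h`. -/
def rank (S : Labelled ℓ) (h : Hyp ℓ) (e : Word) : ℕ := ((S.hits h).filter fun e' => wlt e' e).card

/-- The interval of `e` in the partition of `[0,1)` into consecutive intervals of equal length,
indexed in increasing order by the words whose cell is hit by `h`, contains `u`. -/
def Selects (S : Labelled ℓ) (h : Hyp ℓ) (u : ℝ) (e : Word) : Prop :=
  e ∈ S.hits h ∧
    u ∈ Ico ((S.rank h e : ℝ) / (S.hits h).card) (((S.rank h e : ℝ) + 1) / (S.hits h).card)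

/-- Division of the cell `C(e)` by the hyperplane `h`. -/
def split (S : Labelled ℓ) (h : Hyp ℓ) (e : Word) : Labelled ℓ where
  leaves := S.leaves.erase e ∪ {e ++ [false], e ++ [true]}
  cell := fun e' =>
    if e' = e ++ [false] then S.cell e ∩ h.half false
    else if e' = e ++ [true] then S.cell e ∩ h.half true
    else S.cell e'

open Classical in
/-- Division by `h` of the cell selected by means of `u`. -/
def step (S : Labelled ℓ) (h : Hyp ℓ) (u : ℝ) : Labelled ℓ :=
  if H : ∃ e, S.Selects h u e then S.split h H.choose else S

end Labelled

/-- `Ξ n T` transports the normalized measure of `[W]` to the normalized measure `Γ̂_T`, and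
`(T, h) ↦ Ξ n T h` is jointly measurable, up to completion, so that it can be evaluated at a
random tessellation and an independent random hyperplane. -/
structure IsTransport {ℓ : ℕ} (Λ : Measure (Hyp ℓ)) (W : Window ℓ)
    (Ξ : ℕ → Tess W → Hyp ℓ → Hyp ℓ) : Prop where
  map_eq : ∀ n T, (normalized Λ W.carrier).map (Ξ n T) = gamHat Λ T
  measurable : ∀ n (μ : Measure (Tess W)), IsProbabilityMeasure μ →
    AEMeasurable (fun p : Tess W × Hyp ℓ => Ξ n p.1 p.2) (μ.prod (normalized Λ W.carrier))

/-- The labelled tessellation after `n` steps: at each step the hyperplane `Ξ_n(g n)`, where `Ξ_n`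
is determined by the current tessellation, is used together with `u n`.
(`u n` and `g n` stand for the variables with number `n + 1`.) -/
def labelledSeq {ℓ : ℕ} (W : Window ℓ) (Ξ : ℕ → Tess W → Hyp ℓ → Hyp ℓ) (u : ℕ → ℝ)
    (g : ℕ → Hyp ℓ) : ℕ → Labelled ℓ
  | 0 => Labelled.init W.carrier
  | n + 1 =>
    (labelledSeq W Ξ u g n).step
      (Ξ n (Tess.ofCells W (labelledSeq W Ξ u g n).cells) (g n)) (u n)

/-- The tessellation `𝒴_n`. -/
def tessSeq {ℓ : ℕ} (W : Window ℓ) (Ξ : ℕ → Tess W → Hyp ℓ → Hyp ℓ) (u : ℕ → ℝ)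
    (g : ℕ → Hyp ℓ) (n : ℕ) : Tess W :=
  Tess.ofCells W (labelledSeq W Ξ u g n).cells

/-- The jump time `𝒮_n`, the sum over `j < n` of the holding times `ζ(𝒴_j)⁻¹ v_j` of `𝒴_j`. -/
def jumpTime {ℓ : ℕ} (Λ : Measure (Hyp ℓ)) (W : Window ℓ) (Ξ : ℕ → Tess W → Hyp ℓ → Hyp ℓ)
    (u v : ℕ → ℝ) (g : ℕ → Hyp ℓ) (n : ℕ) : ℝ :=
  ∑ j ∈ Finset.range n, (zeta Λ (tessSeq W Ξ u g j)).toReal⁻¹ * v j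

/-- The path `t ↦ 𝒴_{N(t)}` with `N(t) = sup {n | 𝒮_n ≤ t}`. -/
def newPath {ℓ : ℕ} (Λ : Measure (Hyp ℓ)) (W : Window ℓ) (Ξ : ℕ → Tess W → Hyp ℓ → Hyp ℓ)
    (u v : ℕ → ℝ) (g : ℕ → Hyp ℓ) (t : ℝ≥0) : Tess W :=
  tessSeq W Ξ u g (sSup {n : ℕ | jumpTime Λ W Ξ u v g n ≤ t})

end STIT

end

/-!
Both processes are jump processes in which one cell at a time is divided, and both turn out to be
the Markov jump process in which every cell `C` is divided at the rate `Λ([C])`, independently of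
the other cells, by a hyperplane with law `Λ` restricted to `[C]` and normalized. A history is
encoded by the sequence of its jumps (`Datum`: holding time, word of the divided cell, dividing
hyperplane). The history determines the leaves of the binary tree of divisions, the tessellation
after `n` jumps (`tessOf`) and the path (`pathOf`), and these are measurable functions of it, so
that it suffices to show that both sequences of jumps have the same law. For this, both are written
as chains: a history is extended by a datum drawn from a source of randomness, which renews itself
independently of this datum. The law of the data of a chain depends on their conditional laws only
(`map_prod_step`, `map_chainData_eq`). The common conditional law is `jumpLaw`: the holding time is
exponential with rate `ζ(T) = ∑ Λ([C])`, the cell is chosen with probability `Λ([C]) / ζ(T)`, and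
the hyperplane follows the normalized restriction of `Λ` to `[C]`.

*The construction in which the hyperplane is drawn first.* The density of `Γ_T` with respect to `Λ`
is the number of cells hit by the hyperplane; drawing the hyperplane from the normalization of `Γ_T`
and then one of the cells hit, each with the same probability, cancels this number, and what remains
is `jumpLaw` (`map_selectWord`). The transport maps are measurable up to completion only. Since the
law of the `n`-th tessellation is already known from the other process, they can be replaced by
measurable maps without changing the construction almost surely (`exists_newData`).

*The STIT tessellation.* Its lifetimes are competing exponential clocks. By absence of memory, the
first clock to ring produces `jumpLaw`, and the remaining times of the other clocks, together with
the lifetimes of the two new cells, are again independent exponential variables (`map_clock`). The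
sequence of jumps of the STIT tessellation is, realization by realization, the one produced by these
clocks (`chainData_eq_stitData`), provided that the hyperplanes of the cells are drawn by rejection
from independent sequences, one for each word. The STIT tessellation draws them by rejection from
one sequence, in the order of the words, but what is left of an i.i.d. sequence after a rejection
step is an independent copy of the sequence (`map_firstIn_afterIn`), so that the two families of
hyperplanes have the same law (`exists_map_stitHyp_eq`).

*Almost sure statements.* By translation invariance, `Λ([C]) > 0` for every cell `C`, and almost
every hyperplane that hits a cell hits its interior (`measure_hit_diff_hit_interior`): the
hyperplanes that only touch the cell have uncountably many pairwise disjoint sets of translates,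
which have the same measure and hit one bounded set. Hence division turns a cell into two cells, and
every leaf set carries a tessellation. Ties among the clocks have probability zero. After `n` jumps
there are at most `n + 1` cells, each with rate at most `Λ([W])`; the jump times are thus bounded
from below by a multiple of `∑ V_j / (j + 1)` with independent exponential `V_j`, which diverges
almost surely (`ae_tendsto_harmonic_expMeasure`).
-/

noncomputable section

namespace STIT

variable {ℓ : ℕ}

/-! ### Cutting polytopes by hyperplanes -/

/-- The points of a polytope below a level `a` of a linear functional form a polytope: its vertices
are among the vertices of the polytope below the level and the points where the segments between a
vertex below and a vertex above cross the level. -/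
theorem exists_finset_convexHull_inter_le (F : Finset (Space ℓ)) (f : Space ℓ →ₗ[ℝ] ℝ) (a : ℝ) :
    ∃ F' : Finset (Space ℓ),
      convexHull ℝ (F : Set (Space ℓ)) ∩ {x | f x ≤ a} = convexHull ℝ (F' : Set (Space ℓ)) := by
  classical
  set A := F.filter fun p => f p ≤ a with hA
  set B := F.filter fun p => a < f p with hB
  -- the point where the segment from `p` to `q` crosses the level
  let c : Space ℓ → Space ℓ → Space ℓ := fun p q =>
    ((f q - f p)⁻¹ * (f q - a)) • p + ((f q - f p)⁻¹ * (a - f p)) • q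
  set F' := A ∪ (A ×ˢ B).image fun pq => c pq.1 pq.2 with hF'
  have hAF : (A : Set (Space ℓ)) ⊆ F := Finset.coe_subset.2 (Finset.filter_subset _ _)
  have hBF : (B : Set (Space ℓ)) ⊆ F := Finset.coe_subset.2 (Finset.filter_subset _ _)
  have hpos : ∀ p ∈ A, ∀ q ∈ B, 0 < f q - f p := by
    intro p hp q hq
    have := (Finset.mem_filter.1 hp).2
    have := (Finset.mem_filter.1 hq).2
    linarith
  refine ⟨F', Subset.antisymm ?_ ?_⟩
  · rintro x ⟨hx, hxa⟩
    have hsub : (F : Set (Space ℓ)) = (A : Set (Space ℓ)) ∪ (B : Set (Space ℓ)) := by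
      ext p
      simp only [hA, hB, Finset.coe_filter, mem_union, mem_ofPred_eq, Finset.mem_coe]
      rcases le_or_gt (f p) a with h | h <;> simp [h, not_lt.2, not_le.2]
    have hAF' : convexHull ℝ (A : Set (Space ℓ)) ⊆ convexHull ℝ (F' : Set (Space ℓ)) :=
      convexHull_mono (by simp [hF'])
    have hBa : ∀ b ∈ convexHull ℝ (B : Set (Space ℓ)), a < f b := by
      intro b hb
      have : convexHull ℝ (B : Set (Space ℓ)) ⊆ {x | a < f x} :=
        convexHull_min (by intro p hp; exact (Finset.mem_filter.1 hp).2)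
          (convex_halfSpace_gt f.isLinear a)
      exact this hb
    have hAa : ∀ b ∈ convexHull ℝ (A : Set (Space ℓ)), f b ≤ a := by
      intro b hb
      have : convexHull ℝ (A : Set (Space ℓ)) ⊆ {x | f x ≤ a} :=
        convexHull_min (by intro p hp; exact (Finset.mem_filter.1 hp).2)
          (convex_halfSpace_le f.isLinear a)
      exact this hb
    rcases A.eq_empty_or_nonempty with hA0 | hA0
    · rw [hsub, hA0] at hx
      simp only [Finset.coe_empty, empty_union] at hx
      exact absurd hxa (not_le.2 (hBa x hx))
    rcases B.eq_empty_or_nonempty with hB0 | hB0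
    · rw [hsub, hB0] at hx
      simp only [Finset.coe_empty, union_empty] at hx
      exact hAF' hx
    rw [hsub, convexHull_union (by simpa using hA0) (by simpa using hB0), mem_convexJoin] at hx
    obtain ⟨p, hp, q, hq, hx⟩ := hx
    have hpa := hAa p hp
    have hqa := hBa q hq
    have hd : 0 < f q - f p := by linarith
    -- the crossing point of the segment from `p` to `q` is a mixture of crossing points
    have hcr : c p q ∈ convexHull ℝ (F' : Set (Space ℓ)) := by
      rw [Finset.mem_convexHull'] at hp hq
      obtain ⟨w, hw0, hw1, hwp⟩ := hp
      obtain ⟨v, hv0, hv1, hvq⟩ := hq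
      have hfp : ∑ i ∈ A, w i * f i = f p := by rw [← hwp]; simp
      have hfq : ∑ i ∈ B, v i * f i = f q := by rw [← hvq]; simp
      have hcomb : c p q = ∑ pq ∈ A ×ˢ B,
          (w pq.1 * v pq.2 * (f pq.2 - f pq.1) * (f q - f p)⁻¹) • c pq.1 pq.2 := by
        have h1 : ∀ pq ∈ A ×ˢ B,
            (w pq.1 * v pq.2 * (f pq.2 - f pq.1) * (f q - f p)⁻¹) • c pq.1 pq.2
            = ((f q - f p)⁻¹ * (v pq.2 * (f pq.2 - a))) • (w pq.1 • pq.1)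
              + ((f q - f p)⁻¹ * (w pq.1 * (a - f pq.1))) • (v pq.2 • pq.2) := by
          rintro ⟨i, j⟩ hij
          have hij' := Finset.mem_product.1 hij
          have := (hpos i hij'.1 j hij'.2).ne'
          simp only [c, smul_add, smul_smul]
          congr 2 <;> field_simp
        rw [Finset.sum_congr rfl h1, Finset.sum_add_distrib, Finset.sum_product,
          Finset.sum_product_right]
        simp only [← Finset.sum_smul, ← Finset.smul_sum, ← Finset.mul_sum, hwp, hvq]
        have e1 : ∑ j ∈ B, v j * (f j - a) = f q - a := by
          simp only [mul_sub, Finset.sum_sub_distrib, hfq, ← Finset.sum_mul, hv1, one_mul]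
        have e2 : ∑ j ∈ A, w j * (a - f j) = a - f p := by
          simp only [mul_sub, Finset.sum_sub_distrib, hfp, ← Finset.sum_mul, hw1, one_mul]
        rw [e1, e2]
      rw [hcomb]
      refine (convex_convexHull ℝ _).sum_mem ?_ ?_ ?_
      · rintro ⟨i, j⟩ hij
        have hij' := Finset.mem_product.1 hij
        have := hpos i hij'.1 j hij'.2
        have := hw0 i hij'.1
        have := hv0 j hij'.2
        positivity
      · rw [← Finset.sum_mul, Finset.sum_product]
        have : ∑ x ∈ A, ∑ y ∈ B, w x * v y * (f y - f x) = f q - f p := by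
          simp only [mul_sub, Finset.sum_sub_distrib, mul_assoc, ← Finset.mul_sum, hfq]
          simp only [← Finset.sum_mul, hw1, hv1, one_mul]
          rw [hfp]
        rw [this, mul_inv_cancel₀ hd.ne']
      · rintro ⟨i, j⟩ hij
        refine subset_convexHull ℝ _ ?_
        simp only [hF', Finset.coe_union, Finset.coe_image]
        exact Or.inr ⟨(i, j), hij, rfl⟩
    have hpF := hAF' hp
    obtain ⟨s, t, hs, ht, hst, rfl⟩ := hx
    have hfx : s * f p + t * f q ≤ a := by simpa using hxa
    rcases eq_or_lt_of_le hpa with hpa' | hpa'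
    · have ht0 : t = 0 := by
        by_contra htne
        have : 0 < t := lt_of_le_of_ne ht (Ne.symm htne)
        have h2 : s = 1 - t := by linarith
        rw [h2, hpa'] at hfx
        nlinarith
      have hs1 : s = 1 := by linarith
      simpa [ht0, hs1] using hpF
    · -- the point lies between `p` and the crossing point
      have key : s • p + t • q = (1 - t * (f q - f p) / (a - f p)) • p
          + (t * (f q - f p) / (a - f p)) • c p q := by
        have h1 : a - f p ≠ 0 := by linarith
        have hs' : s = 1 - t := by linarith
        simp only [c, smul_add, smul_smul, ← add_assoc, ← add_smul]
        congr 2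
        · rw [hs']; field_simp; ring
        · field_simp
      rw [key]
      have h1 : 0 < a - f p := by linarith
      have h3 : t * (f q - f p) / (a - f p) ≤ 1 := by
        rw [div_le_one h1]
        have hs' : s = 1 - t := by linarith
        rw [hs'] at hfx
        linarith
      exact convex_convexHull ℝ _ hpF hcr (by linarith) (by positivity) (by ring)
  · refine convexHull_min ?_ ((convex_convexHull ℝ _).inter (convex_halfSpace_le f.isLinear a))
    intro x hx
    simp only [hF', Finset.coe_union, Finset.coe_image, mem_union, mem_image] at hx
    rcases hx with hx | ⟨⟨p, q⟩, hpq, rfl⟩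
    · exact ⟨subset_convexHull ℝ _ (hAF hx), (Finset.mem_filter.1 hx).2⟩
    · have hpq' := Finset.mem_product.1 (Finset.mem_coe.1 hpq)
      have hp := (Finset.mem_filter.1 hpq'.1).2
      have hq := (Finset.mem_filter.1 hpq'.2).2
      have hd := hpos p hpq'.1 q hpq'.2
      have hdi : 0 < (f q - f p)⁻¹ := inv_pos.2 hd
      refine ⟨convex_convexHull ℝ _ (subset_convexHull ℝ _ (hAF hpq'.1))
        (subset_convexHull ℝ _ (hBF hpq'.2)) (mul_nonneg hdi.le (by linarith))
        (mul_nonneg hdi.le (by linarith)) ?_, ?_⟩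
      · field_simp; ring
      · have : f (c p q) = a := by
          simp only [c, map_add, map_smul, smul_eq_mul]
          field_simp; ring
        exact this.le

/-- The intersection of a polytope with a half-space is a polytope. -/
theorem exists_finset_convexHull_inter_half (F : Finset (Space ℓ)) (h : Hyp ℓ) (b : Bool) :
    ∃ F' : Finset (Space ℓ),
      convexHull ℝ (F : Set (Space ℓ)) ∩ h.half b = convexHull ℝ (F' : Set (Space ℓ)) := by
  cases b
  · obtain ⟨F', hF'⟩ := exists_finset_convexHull_inter_le F
      (innerₛₗ ℝ (h.2 : Space ℓ)) h.1
    refine ⟨F', ?_⟩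
    rw [← hF']
    simp [Hyp.half, real_inner_comm]
  · obtain ⟨F', hF'⟩ := exists_finset_convexHull_inter_le F
      (-(innerₛₗ ℝ (h.2 : Space ℓ))) (-h.1)
    refine ⟨F', ?_⟩
    rw [← hF']
    simp [Hyp.half, real_inner_comm]

theorem exists_finset_pathCell (W : Window ℓ) (H : Word → Hyp ℓ) (e : Word) :
    ∃ F : Finset (Space ℓ), pathCell W.carrier H e = convexHull ℝ (F : Set (Space ℓ)) := by
  induction e using List.reverseRecOn with
  | nil => rw [pathCell_nil]; exact W.isCell.1
  | append_singleton e b ih =>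
    obtain ⟨F, hF⟩ := ih
    rw [pathCell_snoc, hF]
    exact exists_finset_convexHull_inter_half F _ b

theorem isCell_pathCell_iff (W : Window ℓ) (H : Word → Hyp ℓ) (e : Word) :
    IsCell (pathCell W.carrier H e) ↔ (interior (pathCell W.carrier H e)).Nonempty :=
  ⟨fun h => h.2, fun h => ⟨exists_finset_pathCell W H e, h⟩⟩

theorem isCompact_pathCell (W : Window ℓ) (H : Word → Hyp ℓ) (e : Word) :
    IsCompact (pathCell W.carrier H e) := by
  obtain ⟨F, hF⟩ := exists_finset_pathCell W H e
  rw [hF]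
  exact F.finite_toSet.isCompact_convexHull (𝕜 := ℝ)

theorem convex_pathCell (W : Window ℓ) (H : Word → Hyp ℓ) (e : Word) :
    Convex ℝ (pathCell W.carrier H e) := by
  obtain ⟨F, hF⟩ := exists_finset_pathCell W H e
  rw [hF]
  exact convex_convexHull ℝ _

theorem Window.isCompact (W : Window ℓ) : IsCompact W.carrier := by
  obtain ⟨F, hF⟩ := W.isCell.1
  rw [hF]
  exact F.finite_toSet.isCompact_convexHull (𝕜 := ℝ)

theorem pathCell_subset (W : Set (Space ℓ)) (H : Word → Hyp ℓ) (e : Word) :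
    pathCell W H e ⊆ W := fun _ hx => hx.1

theorem hit_mono {A B : Set (Space ℓ)} (h : A ⊆ B) : hit A ⊆ hit B :=
  fun _ hx => hx.mono (inter_subset_inter_right _ h)

/-- Only the hyperplanes attached to the proper prefixes of `e` matter for the cell of `e`. -/
theorem pathCell_congr (W : Set (Space ℓ)) {H H' : Word → Hyp ℓ} {e : Word}
    (h : ∀ i < e.length, H (e.take i) = H' (e.take i)) : pathCell W H e = pathCell W H' e := by
  ext x
  refine and_congr_right fun _ => forall_congr' fun i => forall_congr' fun hi => ?_
  rw [h i hi]

end STIT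

namespace STIT

variable {ℓ : ℕ}

/-! ### Topology of cells as functions of the dividing hyperplanes -/

/-- The projection of a closed set along a compact factor is closed. -/
theorem isClosed_setOf_exists_mem_of_isCompact {X Y : Type*} [TopologicalSpace X]
    [TopologicalSpace Y] {K : Set X} (hK : IsCompact K) {F : Set (X × Y)} (hF : IsClosed F) :
    IsClosed {y | ∃ x ∈ K, (x, y) ∈ F} := by
  have := isCompact_iff_compactSpace.1 hK
  have h1 : IsClosed {p : K × Y | ((p.1 : X), p.2) ∈ F} := hF.preimage (by fun_prop)
  have h2 := isClosedMap_snd_of_compactSpace _ h1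
  convert h2 using 1
  ext y
  simp

theorem isClosed_mem_half (b : Bool) : IsClosed {p : Space ℓ × Hyp ℓ | p.1 ∈ p.2.half b} := by
  have h1 : Continuous fun p : Space ℓ × Hyp ℓ => inner ℝ p.1 (p.2.2 : Space ℓ) := by fun_prop
  have h2 : Continuous fun p : Space ℓ × Hyp ℓ => p.2.1 := by fun_prop
  cases b
  · exact isClosed_le h1 h2
  · exact isClosed_le h2 h1

theorem isClosed_mem_plane : IsClosed {p : Space ℓ × Hyp ℓ | p.1 ∈ p.2.plane} :=
  isClosed_eq (by fun_prop) (by fun_prop)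

/-- The open half-spaces bounded by a hyperplane. -/
def Hyp.openHalf (h : Hyp ℓ) : Bool → Set (Space ℓ)
  | false => {x | inner ℝ x (h.2 : Space ℓ) < h.1}
  | true => {x | h.1 < inner ℝ x (h.2 : Space ℓ)}

theorem isOpen_mem_openHalf (b : Bool) :
    IsOpen {p : Space ℓ × Hyp ℓ | p.1 ∈ p.2.openHalf b} := by
  have h1 : Continuous fun p : Space ℓ × Hyp ℓ => inner ℝ p.1 (p.2.2 : Space ℓ) := by fun_prop
  have h2 : Continuous fun p : Space ℓ × Hyp ℓ => p.2.1 := by fun_prop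
  cases b
  · exact isOpen_lt h1 h2
  · exact isOpen_lt h2 h1

theorem norm_normal (h : Hyp ℓ) : ‖(h.2 : Space ℓ)‖ = 1 := h.2.2.1

theorem isOpenMap_inner (h : Hyp ℓ) :
    IsOpenMap fun x : Space ℓ => inner ℝ x (h.2 : Space ℓ) := by
  have hs : Function.Surjective (innerSL ℝ (h.2 : Space ℓ)) := by
    intro a
    refine ⟨a • (h.2 : Space ℓ), ?_⟩
    simp [norm_normal]
  have := (innerSL ℝ (h.2 : Space ℓ)).isOpenMap hs
  simpa [real_inner_comm] using this

theorem interior_half (h : Hyp ℓ) (b : Bool) : interior (h.half b) = h.openHalf b := by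
  have hc : Continuous fun x : Space ℓ => inner ℝ x (h.2 : Space ℓ) := by fun_prop
  cases b
  · have := (isOpenMap_inner h).preimage_interior_eq_interior_preimage hc (Iic h.1)
    rw [interior_Iic] at this
    exact this.symm
  · have := (isOpenMap_inner h).preimage_interior_eq_interior_preimage hc (Ici h.1)
    rw [interior_Ici] at this
    exact this.symm

theorem half_diff_openHalf (h : Hyp ℓ) (b : Bool) : h.half b \ h.openHalf b = h.plane := by
  ext x
  cases b <;> simp only [Hyp.half, Hyp.openHalf, Hyp.plane, Set.mem_sdiff, mem_ofPred_eq, not_lt]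
  · exact ⟨fun h => le_antisymm h.1 h.2, fun h => ⟨h.le, h.ge⟩⟩
  · exact ⟨fun h => le_antisymm h.2 h.1, fun h => ⟨h.ge, h.le⟩⟩

theorem pathCell_eq_inter (W : Set (Space ℓ)) (H : Word → Hyp ℓ) (e : Word) :
    pathCell W H e = W ∩ ⋂ i : Fin e.length, (H (e.take i)).half e[i] := by
  ext x
  simp only [pathCell, mem_ofPred_eq, mem_inter_iff, mem_iInter]
  exact and_congr_right fun _ => ⟨fun h i => h i i.2, fun h i hi => h ⟨i, hi⟩⟩

theorem interior_pathCell (W : Set (Space ℓ)) (H : Word → Hyp ℓ) (e : Word) :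
    interior (pathCell W H e)
      = interior W ∩ ⋂ i : Fin e.length, (H (e.take i)).openHalf e[i] := by
  rw [pathCell_eq_inter, interior_inter, interior_iInter_of_finite]
  simp only [interior_half]

theorem isClosed_mem_pathCell (W : Window ℓ) (e : Word) :
    IsClosed {p : Space ℓ × (Word → Hyp ℓ) | p.1 ∈ pathCell W.carrier p.2 e} := by
  have : {p : Space ℓ × (Word → Hyp ℓ) | p.1 ∈ pathCell W.carrier p.2 e}
      = {p | p.1 ∈ W.carrier} ∩ ⋂ i : Fin e.length, {p | p.1 ∈ (p.2 (e.take i)).half e[i]} := by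
    ext p
    simp [pathCell_eq_inter]
  rw [this]
  refine (W.isCompact.isClosed.preimage continuous_fst).inter (isClosed_iInter fun i => ?_)
  exact (isClosed_mem_half e[i]).preimage
    (f := fun p : Space ℓ × (Word → Hyp ℓ) => (p.1, p.2 (e.take i))) (by fun_prop)

theorem isClosed_mem_hit_pathCell (W : Window ℓ) (e : Word) :
    IsClosed {p : (Word → Hyp ℓ) × Hyp ℓ | p.2 ∈ hit (pathCell W.carrier p.1 e)} := by
  have h1 : IsClosed {p : Space ℓ × ((Word → Hyp ℓ) × Hyp ℓ) |
      p.1 ∈ p.2.2.plane ∧ p.1 ∈ pathCell W.carrier p.2.1 e} :=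
    (isClosed_mem_plane.preimage
      (f := fun p : Space ℓ × ((Word → Hyp ℓ) × Hyp ℓ) => (p.1, p.2.2)) (by fun_prop)).inter
    ((isClosed_mem_pathCell W e).preimage
      (f := fun p : Space ℓ × ((Word → Hyp ℓ) × Hyp ℓ) => (p.1, p.2.1)) (by fun_prop))
  convert isClosed_setOf_exists_mem_of_isCompact W.isCompact h1 using 1
  ext p
  constructor
  · rintro ⟨x, hx, hxc⟩
    exact ⟨x, hxc.1, hx, hxc⟩
  · rintro ⟨x, -, hx, hxc⟩
    exact ⟨x, hx, hxc⟩

theorem measurableSet_mem_hit_pathCell (W : Window ℓ) (e : Word) :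
    MeasurableSet {p : (Word → Hyp ℓ) × Hyp ℓ | p.2 ∈ hit (pathCell W.carrier p.1 e)} :=
  (isClosed_mem_hit_pathCell W e).measurableSet

theorem isClosed_hit {C : Set (Space ℓ)} (hC : IsCompact C) : IsClosed (hit C) := by
  convert isClosed_setOf_exists_mem_of_isCompact hC (isClosed_mem_plane (ℓ := ℓ)) using 1
  ext h
  exact ⟨fun ⟨x, hx, hxc⟩ => ⟨x, hxc, hx⟩, fun ⟨x, hxc, hx⟩ => ⟨x, hx, hxc⟩⟩

theorem measurableSet_hit_pathCell (W : Window ℓ) (H : Word → Hyp ℓ) (e : Word) :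
    MeasurableSet (hit (pathCell W.carrier H e)) :=
  (isClosed_hit (isCompact_pathCell W H e)).measurableSet

theorem isOpen_setOf_interior_pathCell_nonempty (W : Set (Space ℓ)) (e : Word) :
    IsOpen {H : Word → Hyp ℓ | (interior (pathCell W H e)).Nonempty} := by
  have : {H : Word → Hyp ℓ | (interior (pathCell W H e)).Nonempty}
      = ⋃ x ∈ interior W, ⋂ i : Fin e.length, {H | x ∈ (H (e.take i)).openHalf e[i]} := by
    ext H
    simp [interior_pathCell, Set.Nonempty]
  rw [this]
  refine isOpen_biUnion fun x _ => isOpen_iInter_of_finite fun i => ?_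
  exact (isOpen_mem_openHalf e[i]).preimage
    (f := fun H : Word → Hyp ℓ => (x, H (e.take i))) (by fun_prop)

/-- The boundary of a cell consists of its points that lie on the boundary of the window or on one
of the dividing hyperplanes. -/
theorem frontier_pathCell (W : Window ℓ) (H : Word → Hyp ℓ) (e : Word) :
    frontier (pathCell W.carrier H e)
      = {x | x ∈ pathCell W.carrier H e ∧
        (x ∉ interior W.carrier ∨ ∃ i : Fin e.length, x ∈ (H (e.take i)).plane)} := by
  rw [(isCompact_pathCell W H e).isClosed.frontier_eq, interior_pathCell]
  ext x
  simp only [Set.mem_sdiff, mem_inter_iff, mem_iInter, mem_ofPred_eq, not_and_or, not_forall]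
  refine and_congr_right fun hx => or_congr_right (exists_congr fun i => ?_)
  rw [pathCell_eq_inter] at hx
  have hi := mem_iInter.1 hx.2 i
  rw [← half_diff_openHalf _ e[i]]
  exact ⟨fun h => ⟨hi, h⟩, fun h => h.2⟩

/-- The avoidance events that generate the `σ`-algebra on tessellations are open conditions on the
dividing hyperplanes. -/
theorem isOpen_setOf_frontier_pathCell_disjoint (W : Window ℓ) (e : Word) {A : Set (Space ℓ)}
    (hA : IsCompact A) :
    IsOpen {H : Word → Hyp ℓ | frontier (pathCell W.carrier H e) ∩ A = ∅} := by
  have h1 : IsClosed {p : Space ℓ × (Word → Hyp ℓ) | p.1 ∈ pathCell W.carrier p.2 e ∧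
      (p.1 ∉ interior W.carrier ∨ ∃ i : Fin e.length, p.1 ∈ (p.2 (e.take i)).plane)} := by
    refine (isClosed_mem_pathCell W e).inter (IsClosed.union ?_ ?_)
    · exact (isOpen_interior.isClosed_compl).preimage continuous_fst
    · have hU : {p : Space ℓ × (Word → Hyp ℓ) | ∃ i : Fin e.length, p.1 ∈ (p.2 (e.take i)).plane}
          = ⋃ i : Fin e.length, {p | p.1 ∈ (p.2 (e.take i)).plane} := by
        ext p
        simp
      change IsClosed
        {p : Space ℓ × (Word → Hyp ℓ) | ∃ i : Fin e.length, p.1 ∈ (p.2 (e.take i)).plane}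
      rw [hU]
      refine isClosed_iUnion_of_finite fun i => ?_
      exact isClosed_mem_plane.preimage
        (f := fun p : Space ℓ × (Word → Hyp ℓ) => (p.1, p.2 (e.take i))) (by fun_prop)
  have h2 := (isClosed_setOf_exists_mem_of_isCompact hA h1).isOpen_compl
  convert h2 using 1
  ext H
  simp only [frontier_pathCell, mem_compl_iff, mem_ofPred_eq, not_exists, not_and,
    eq_empty_iff_forall_notMem, mem_inter_iff]
  exact ⟨fun h x hA hx hx' => h x ⟨hx, hx'⟩ hA, fun h x hx hA => h x hA hx.1 hx.2⟩

/-! ### Hyperplanes hitting a cell -/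

theorem Hyp.measurable_translate (v : Space ℓ) : Measurable (Hyp.translate v) := by
  have : Continuous (Hyp.translate v) := by
    unfold Hyp.translate
    fun_prop
  exact this.measurable

theorem Hyp.translate_mem_hit {v : Space ℓ} {h : Hyp ℓ} {B B' : Set (Space ℓ)}
    (hB : ∀ x ∈ B, x + v ∈ B') (hh : h ∈ hit B) : h.translate v ∈ hit B' := by
  obtain ⟨x, hx, hxB⟩ := hh
  refine ⟨x + v, ?_, hB x hxB⟩
  simp only [Hyp.plane, Hyp.translate, mem_ofPred_eq, inner_add_left] at hx ⊢
  rw [hx]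

/-- All balls of radius `r` have the same measure, by translation invariance, and countably many of
them cover the space; if this measure were zero, `Λ` would vanish. -/
theorem IsHyperplaneMeasure.hit_closedBall_pos {Λ : Measure (Hyp ℓ)} (hΛ : IsHyperplaneMeasure Λ)
    (x : Space ℓ) {r : ℝ} (hr : 0 < r) : 0 < Λ (hit (Metric.closedBall x r)) := by
  rw [pos_iff_ne_zero]
  intro h0
  have hall : ∀ y : Space ℓ, Λ (hit (Metric.closedBall y r)) = 0 := by
    intro y
    refine le_antisymm ?_ zero_le
    rw [← h0, ← hΛ.translation_invariant (x - y), Measure.map_apply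
      (Hyp.measurable_translate _) (isClosed_hit (isCompact_closedBall x r)).measurableSet]
    rw [hΛ.translation_invariant]
    refine measure_mono fun h hh => Hyp.translate_mem_hit (fun z hz => ?_) hh
    simp only [Metric.mem_closedBall, dist_eq_norm] at hz ⊢
    convert hz using 2
    abel
  apply hΛ.ne_zero
  rw [← Measure.measure_univ_eq_zero]
  -- countably many balls cover the space, and every hyperplane contains a point
  have hcov : (univ : Set (Hyp ℓ)) ⊆
      ⋃ n, hit (Metric.closedBall (TopologicalSpace.denseSeq (Space ℓ) n) r) := by
    intro h _
    obtain ⟨n, hn⟩ := (TopologicalSpace.denseRange_denseSeq (Space ℓ)).exists_dist_lt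
      (h.1 • (h.2 : Space ℓ)) hr
    refine mem_iUnion.2 ⟨n, h.1 • (h.2 : Space ℓ), ?_, hn.le⟩
    simp only [Hyp.plane, mem_ofPred_eq, real_inner_smul_left, real_inner_self_eq_norm_sq,
      norm_normal]
    norm_num
  exact measure_mono_null hcov (measure_iUnion_null fun n => hall _)

theorem IsHyperplaneMeasure.hit_pos {Λ : Measure (Hyp ℓ)} (hΛ : IsHyperplaneMeasure Λ)
    {C : Set (Space ℓ)} (hC : (interior C).Nonempty) : 0 < Λ (hit C) := by
  obtain ⟨x, hx⟩ := hC
  obtain ⟨r, hr, hsub⟩ := Metric.nhds_basis_closedBall.mem_iff.1 (mem_interior_iff_mem_nhds.1 hx)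
  exact (hΛ.hit_closedBall_pos x hr).trans_le (measure_mono (hit_mono hsub))

theorem IsHyperplaneMeasure.hit_lt_top {Λ : Measure (Hyp ℓ)} (hΛ : IsHyperplaneMeasure Λ)
    {C : Set (Space ℓ)} (hC : IsCompact C) : Λ (hit C) < ∞ :=
  hΛ.locally_finite C hC.isClosed.measurableSet hC.isBounded

/-- Almost no hyperplane touches a compact set without cutting it: the touching hyperplanes whose
normal is not orthogonal to `w` have uncountably many pairwise disjoint translates in direction `w`,
which all have the same measure and all hit a fixed bounded set. -/
theorem IsHyperplaneMeasure.measure_tangent_eq_zero {Λ : Measure (Hyp ℓ)}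
    (hΛ : IsHyperplaneMeasure Λ) {C : Set (Space ℓ)} (hC : IsCompact C) (b : Bool) :
    Λ {h | h ∈ hit C ∧ C ⊆ h.half b} = 0 := by
  set A : Fin ℓ → Set (Hyp ℓ) := fun i =>
    {h | (h ∈ hit C ∧ C ⊆ h.half b) ∧ (h.2 : Space ℓ) i ≠ 0} with hA
  have hcov : {h | h ∈ hit C ∧ C ⊆ h.half b} ⊆ ⋃ i, A i := by
    intro h hh
    have : (h.2 : Space ℓ) ≠ 0 := by
      intro h0
      have := norm_normal h
      simp [h0] at this
    obtain ⟨i, hi⟩ : ∃ i, (h.2 : Space ℓ) i ≠ 0 := by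
      by_contra hcon
      push Not at hcon
      exact this (by ext i; exact hcon i)
    exact mem_iUnion.2 ⟨i, hh, hi⟩
  refine measure_mono_null hcov (measure_iUnion_null fun i => ?_)
  have hcl : IsClosed {h : Hyp ℓ | C ⊆ h.half b} := by
    have : {h : Hyp ℓ | C ⊆ h.half b} = ⋂ x ∈ C, {h | x ∈ h.half b} := by
      ext h
      simp [subset_def]
    rw [this]
    exact isClosed_biInter fun x _ =>
      (isClosed_mem_half b).preimage (f := fun h : Hyp ℓ => (x, h)) (by fun_prop)
  have hmeas : MeasurableSet (A i) := by
    refine ((isClosed_hit hC).inter hcl).measurableSet.inter ?_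
    have : IsOpen {h : Hyp ℓ | (h.2 : Space ℓ) i ≠ 0} := isOpen_ne_fun (by fun_prop) (by fun_prop)
    exact this.measurableSet
  set w : Space ℓ := EuclideanSpace.single i 1 with hw
  have hwu : ∀ (s : ℝ) (h : Hyp ℓ), inner ℝ (s • w) (h.2 : Space ℓ) = s * (h.2 : Space ℓ) i := by
    intro s h
    rw [real_inner_smul_left, hw, EuclideanSpace.inner_single_left]
    simp
  -- the signed distance of a touching hyperplane is determined by its normal
  have huniq : ∀ h h' : Hyp ℓ, h ∈ A i → h' ∈ A i → h.2 = h'.2 → h.1 = h'.1 := by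
    rintro ⟨a, u⟩ ⟨a', u'⟩ ⟨⟨⟨x, hx, hxC⟩, hs⟩, -⟩ ⟨⟨⟨x', hx', hxC'⟩, hs'⟩, -⟩ huu
    simp only at huu
    subst huu
    have h1 := hs hxC'
    have h2 := hs' hxC
    simp only [Hyp.plane, mem_ofPred_eq] at hx hx'
    cases b <;> simp only [Hyp.half, mem_ofPred_eq, hx, hx'] at h1 h2 <;> simp only <;> linarith
  set B : Icc (0 : ℝ) 1 → Set (Hyp ℓ) := fun s => Hyp.translate ((s : ℝ) • w) ⁻¹' A i with hB
  have hBmeas : ∀ s, MeasurableSet (B s) := fun s => Hyp.measurable_translate _ hmeas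
  have hBm : ∀ s, Λ (B s) = Λ (A i) := by
    intro s
    rw [hB, ← Measure.map_apply (Hyp.measurable_translate _) hmeas, hΛ.translation_invariant]
  have hdisj : Pairwise (Function.onFun Disjoint B) := by
    intro s s' hss
    refine Set.disjoint_left.2 fun h hs hs' => hss ?_
    have h1 := huniq _ _ hs hs' rfl
    simp only [Hyp.translate, hwu] at h1
    have h2 : (h.2 : Space ℓ) i ≠ 0 := hs.2
    have h3 : ((s : ℝ) - s') * (h.2 : Space ℓ) i = 0 := by linarith
    rcases mul_eq_zero.1 h3 with h4 | h4
    · exact Subtype.ext (by linarith)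
    · exact absurd h4 h2
  obtain ⟨r, hr⟩ := hC.isBounded.subset_closedBall (0 : Space ℓ)
  have hfin : Λ (⋃ s, B s) ≠ ∞ := by
    refine ne_top_of_le_ne_top (hΛ.hit_lt_top (isCompact_closedBall (0 : Space ℓ) (r + 1))).ne
      (measure_mono (iUnion_subset fun s h hs => ?_))
    obtain ⟨⟨⟨x, hx, hxC⟩, -⟩, -⟩ := hs
    refine ⟨x - (s : ℝ) • w, ?_, ?_⟩
    · simp only [Hyp.plane, Hyp.translate, mem_ofPred_eq, inner_sub_left] at hx ⊢
      rw [hx]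
      ring
    · have h1 := hr hxC
      simp only [mem_closedBall_zero_iff] at h1 ⊢
      have h2 : ‖(s : ℝ) • w‖ ≤ 1 := by
        rw [norm_smul, hw, PiLp.norm_single, Real.norm_of_nonneg s.2.1]
        simpa using s.2.2
      linarith [norm_sub_le x ((s : ℝ) • w)]
  -- a set of finite measure has only countably many disjoint parts of positive measure
  have hcount := Measure.countable_meas_pos_of_disjoint_of_meas_iUnion_ne_top Λ hBmeas hdisj hfin
  by_contra h0
  have hall : {s | 0 < Λ (B s)} = univ := by
    ext s
    simp only [hBm, mem_ofPred_eq, mem_univ, iff_true]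
    exact pos_iff_ne_zero.2 h0
  rw [hall, Set.countable_univ_iff, Set.countable_coe_iff] at hcount
  exact absurd hcount (Cardinal.Real.Icc_countable_iff.not.2 (by norm_num))

/-- Almost every hyperplane that hits a convex body hits its interior. -/
theorem IsHyperplaneMeasure.measure_hit_diff_hit_interior {Λ : Measure (Hyp ℓ)}
    (hΛ : IsHyperplaneMeasure Λ) {C : Set (Space ℓ)} (hC : IsCompact C) (hconv : Convex ℝ C)
    (hne : (interior C).Nonempty) : Λ (hit C \ hit (interior C)) = 0 := by
  refine measure_mono_null (t := {h | h ∈ hit C ∧ C ⊆ h.half false} ∪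
    {h | h ∈ hit C ∧ C ⊆ h.half true}) ?_
    (measure_union_null (hΛ.measure_tangent_eq_zero hC _) (hΛ.measure_tangent_eq_zero hC _))
  rintro h ⟨hh, hni⟩
  have hcl : closure (interior C) = C := by
    rw [hconv.closure_interior_eq_closure_of_nonempty_interior hne, hC.isClosed.closure_eq]
  have hne' : ∀ x ∈ interior C, inner ℝ x (h.2 : Space ℓ) ≠ h.1 :=
    fun x hx hxh => hni ⟨x, hxh, hx⟩
  -- the interior is connected and misses the hyperplane, hence it lies on one side of it
  have hord : OrdConnected ((fun x : Space ℓ => inner ℝ x (h.2 : Space ℓ)) '' interior C) := by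
    refine IsPreconnected.ordConnected ?_
    exact hconv.interior.isPreconnected.image _ (by fun_prop)
  have hside : (∃ b, interior C ⊆ h.half b) := by
    by_contra hcon
    push Not at hcon
    obtain ⟨x, hx, hxn⟩ := not_subset.1 (hcon false)
    obtain ⟨y, hy, hyn⟩ := not_subset.1 (hcon true)
    simp only [Hyp.half, mem_ofPred_eq, not_le] at hxn hyn
    obtain ⟨z, hz, hzh⟩ := hord.out (mem_image_of_mem _ hy) (mem_image_of_mem _ hx)
      ⟨hyn.le, hxn.le⟩
    exact hne' z hz hzh
  obtain ⟨b, hb⟩ := hside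
  have hcb : IsClosed (h.half b) :=
    (isClosed_mem_half b).preimage (f := fun x : Space ℓ => (x, h)) (by fun_prop)
  have := hcl ▸ closure_minimal hb hcb
  cases b
  · exact Or.inl ⟨hh, this⟩
  · exact Or.inr ⟨hh, this⟩

theorem nonempty_interior_inter_half {C : Set (Space ℓ)} {h : Hyp ℓ} (hh : h ∈ hit (interior C))
    (b : Bool) : (interior (C ∩ h.half b)).Nonempty := by
  obtain ⟨x, hx, hxC⟩ := hh
  have hcont : Tendsto (fun s : ℝ => x + s • (h.2 : Space ℓ)) (𝓝 0) (𝓝 x) := by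
    have : Continuous fun s : ℝ => x + s • (h.2 : Space ℓ) := by fun_prop
    simpa using this.tendsto 0
  have hev := hcont.eventually (isOpen_interior.mem_nhds hxC)
  have hval : ∀ s : ℝ, inner ℝ (x + s • (h.2 : Space ℓ)) (h.2 : Space ℓ) = h.1 + s := by
    intro s
    simp only [Hyp.plane, mem_ofPred_eq] at hx
    rw [inner_add_left, real_inner_smul_left, real_inner_self_eq_norm_sq, norm_normal, hx]
    ring
  rw [interior_inter, interior_half]
  obtain ⟨ε, hε, hball⟩ := Metric.eventually_nhds_iff.1 hev
  cases b
  · refine ⟨x + (-(ε / 2)) • (h.2 : Space ℓ), hball ?_, ?_⟩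
    · rw [Real.dist_eq, sub_zero, abs_neg, abs_of_pos (by positivity)]; linarith
    · simp only [Hyp.openHalf, mem_ofPred_eq, hval]; linarith
  · refine ⟨x + (ε / 2) • (h.2 : Space ℓ), hball ?_, ?_⟩
    · rw [Real.dist_eq, sub_zero, abs_of_pos (by positivity)]; linarith
    · simp only [Hyp.openHalf, mem_ofPred_eq, hval]; linarith

end STIT

namespace STIT

variable {ℓ : ℕ}

/-! ### Leaf sets and the tessellations they carry -/

/-- The leaf sets of the finite binary trees, in which every inner node has two children. -/
inductive IsLeafSet : Finset Word → Prop
  | root : IsLeafSet {[]}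
  | split {E : Finset Word} {e : Word} (hE : IsLeafSet E) (he : e ∈ E) :
      IsLeafSet (E.erase e ∪ {e ++ [false], e ++ [true]})

theorem mem_split_iff {E : Finset Word} {e f : Word} :
    f ∈ E.erase e ∪ {e ++ [false], e ++ [true]} ↔ (f ≠ e ∧ f ∈ E) ∨ ∃ b, f = e ++ [b] := by
  simp only [Finset.mem_union, Finset.mem_erase, Finset.mem_insert, Finset.mem_singleton,
    Bool.exists_bool]

theorem IsLeafSet.eq_of_prefix {E : Finset Word} (hE : IsLeafSet E) {e f : Word} (he : e ∈ E)
    (hf : f ∈ E) (hef : e <+: f) : e = f := by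
  induction hE generalizing e f with
  | root =>
    rw [Finset.mem_singleton] at he hf
    rw [he, hf]
  | @split E g hE hg ih =>
    rw [mem_split_iff] at he hf
    rcases he with ⟨heg, he⟩ | ⟨b, rfl⟩
    · rcases hf with ⟨-, hf⟩ | ⟨b, rfl⟩
      · exact ih he hf hef
      · rcases List.prefix_concat_iff.1 hef with h | h
        · exact h
        · exact absurd (ih he hg h) heg
    · have hgf : g <+: f := (List.prefix_append g [b]).trans hef
      rcases hf with ⟨hfg, hf⟩ | ⟨c, rfl⟩
      · exact absurd (ih hg hf hgf).symm hfg
      · exact hef.eq_of_length (by simp)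

/-- Every word is comparable with a leaf: the leaves form a maximal antichain. -/
theorem IsLeafSet.exists_comparable {E : Finset Word} (hE : IsLeafSet E) (w : Word) :
    ∃ e ∈ E, w <+: e ∨ e <+: w := by
  induction hE with
  | root => exact ⟨[], by simp, Or.inr List.nil_prefix⟩
  | @split E g hE hg ih =>
    obtain ⟨e, he, h⟩ := ih
    by_cases heg : e = g
    · subst heg
      rcases h with h | ⟨t, rfl⟩
      · exact ⟨e ++ [false], mem_split_iff.2 (Or.inr ⟨_, rfl⟩),
          Or.inl (h.trans (List.prefix_append _ _))⟩
      · cases t with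
        | nil => exact ⟨e ++ [false], mem_split_iff.2 (Or.inr ⟨_, rfl⟩), Or.inl (by simp)⟩
        | cons b t => exact ⟨e ++ [b], mem_split_iff.2 (Or.inr ⟨_, rfl⟩), Or.inr (by simp)⟩
    · exact ⟨e, mem_split_iff.2 (Or.inl ⟨heg, he⟩), h⟩

theorem IsLeafSet.nonempty {E : Finset Word} (hE : IsLeafSet E) : E.Nonempty := by
  obtain ⟨e, he, -⟩ := hE.exists_comparable []
  exact ⟨e, he⟩

theorem Hyp.half_union (h : Hyp ℓ) : h.half false ∪ h.half true = univ := by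
  ext x
  simp only [Hyp.half, mem_union, mem_ofPred_eq, mem_univ, iff_true]
  exact le_total _ _

theorem Hyp.openHalf_inter (h : Hyp ℓ) : h.openHalf false ∩ h.openHalf true = ∅ := by
  ext x
  simp only [Hyp.openHalf, mem_inter_iff, mem_ofPred_eq, mem_empty_iff_false, iff_false, not_and,
    not_lt]
  exact fun h => h.le

theorem IsLeafSet.biUnion_pathCell (W : Set (Space ℓ)) (H : Word → Hyp ℓ) {E : Finset Word}
    (hE : IsLeafSet E) : ⋃ e ∈ E, pathCell W H e = W := by
  induction hE with
  | root => simp [pathCell_nil]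
  | @split E g hE hg ih =>
    refine Subset.antisymm (iUnion₂_subset fun e _ => pathCell_subset W H e) fun x hx => ?_
    rw [← ih] at hx
    obtain ⟨e, he, hxe⟩ := mem_iUnion₂.1 hx
    by_cases heg : e = g
    · subst heg
      rcases (Hyp.half_union (H e)).symm.subset (mem_univ x) with h | h
      · exact mem_iUnion₂.2 ⟨e ++ [false], mem_split_iff.2 (Or.inr ⟨_, rfl⟩), by
          rw [pathCell_snoc]; exact ⟨hxe, h⟩⟩
      · exact mem_iUnion₂.2 ⟨e ++ [true], mem_split_iff.2 (Or.inr ⟨_, rfl⟩), by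
          rw [pathCell_snoc]; exact ⟨hxe, h⟩⟩
    · exact mem_iUnion₂.2 ⟨e, mem_split_iff.2 (Or.inl ⟨heg, he⟩), hxe⟩

theorem IsLeafSet.disjoint_interior (W : Set (Space ℓ)) (H : Word → Hyp ℓ) {E : Finset Word}
    (hE : IsLeafSet E) {e f : Word} (he : e ∈ E) (hf : f ∈ E) (hef : e ≠ f) :
    Disjoint (interior (pathCell W H e)) (interior (pathCell W H f)) := by
  induction hE generalizing e f with
  | root =>
    rw [Finset.mem_singleton] at he hf
    exact absurd (he.trans hf.symm) hef
  | @split E g hE hg ih =>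
    have hchild : ∀ b, interior (pathCell W H (g ++ [b])) ⊆ interior (pathCell W H g) := by
      intro b
      rw [pathCell_snoc]
      exact interior_mono inter_subset_left
    rw [mem_split_iff] at he hf
    rcases he with ⟨heg, he⟩ | ⟨b, rfl⟩ <;> rcases hf with ⟨hfg, hf⟩ | ⟨c, rfl⟩
    · exact ih he hf hef
    · exact (ih he hg heg).mono_right (hchild c)
    · exact (ih hg hf hfg.symm).mono_left (hchild b)
    · have hbc : b ≠ c := fun h => hef (by rw [h])
      simp only [pathCell_snoc, interior_inter, interior_half]
      refine Disjoint.mono inter_subset_right inter_subset_right ?_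
      rw [Set.disjoint_iff_inter_eq_empty]
      cases b <;> cases c
      · exact absurd rfl hbc
      · exact Hyp.openHalf_inter _
      · rw [inter_comm]; exact Hyp.openHalf_inter _
      · exact absurd rfl hbc

/-- All leaves carry cells with interior points. -/
def GoodLeaves (W : Window ℓ) (E : Finset Word) (H : Word → Hyp ℓ) : Prop :=
  ∀ e ∈ E, (interior (pathCell W.carrier H e)).Nonempty

/-- The cells of the leaves always cover the window and have disjoint interiors; only the existence
of interior points is in question. -/
theorem IsLeafSet.isTessellation_iff (W : Window ℓ) (H : Word → Hyp ℓ) {E : Finset Word}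
    (hE : IsLeafSet E) :
    IsTessellation W.carrier (pathCell W.carrier H '' (E : Set Word)) ↔ GoodLeaves W E H := by
  constructor
  · exact fun h e he => (h.isCell _ (mem_image_of_mem _ he)).2
  · intro h
    refine ⟨E.finite_toSet.image _, ?_, ?_, ?_⟩
    · rintro _ ⟨e, he, rfl⟩
      exact (isCell_pathCell_iff W H e).2 (h e he)
    · rintro _ ⟨e, he, rfl⟩ _ ⟨f, hf, rfl⟩ hef
      exact hE.disjoint_interior _ H he hf fun h => hef (by rw [h])
    · rw [sUnion_image]
      exact hE.biUnion_pathCell W.carrier H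

theorem GoodLeaves.injOn {W : Window ℓ} {E : Finset Word} {H : Word → Hyp ℓ}
    (h : GoodLeaves W E H) (hE : IsLeafSet E) : InjOn (pathCell W.carrier H) (E : Set Word) := by
  intro e he f hf hef
  by_contra hne
  have := hE.disjoint_interior W.carrier H he hf hne
  rw [hef, disjoint_self] at this
  exact (h f hf).ne_empty this

theorem Tess.ofCells_of_isTessellation {W : Window ℓ} {T : Set (Set (Space ℓ))}
    (h : IsTessellation W.carrier T) : Tess.ofCells W T = ⟨T, h⟩ :=
  dif_pos h

theorem Tess.ofCells_of_not_isTessellation {W : Window ℓ} {T : Set (Set (Space ℓ))}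
    (h : ¬ IsTessellation W.carrier T) : Tess.ofCells W T = Tess.trivial W :=
  dif_neg h

/-- The tessellation formed by the cells of the leaves. -/
def treeTess (W : Window ℓ) (E : Finset Word) (H : Word → Hyp ℓ) : Tess W :=
  Tess.ofCells W (pathCell W.carrier H '' (E : Set Word))

theorem GoodLeaves.treeTess_val {W : Window ℓ} {E : Finset Word} {H : Word → Hyp ℓ}
    (h : GoodLeaves W E H) (hE : IsLeafSet E) :
    (treeTess W E H).1 = pathCell W.carrier H '' (E : Set Word) := by
  rw [treeTess, Tess.ofCells_of_isTessellation ((hE.isTessellation_iff W H).2 h)]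

theorem measurableSet_goodLeaves (W : Window ℓ) (E : Finset Word) :
    MeasurableSet {H : Word → Hyp ℓ | GoodLeaves W E H} := by
  have : {H : Word → Hyp ℓ | GoodLeaves W E H}
      = ⋂ e ∈ E, {H | (interior (pathCell W.carrier H e)).Nonempty} := by
    ext H
    simp [GoodLeaves]
  rw [this]
  exact E.measurableSet_biInter fun e _ =>
    (isOpen_setOf_interior_pathCell_nonempty W.carrier e).measurableSet

theorem measurable_treeTess (W : Window ℓ) {E : Finset Word} (hE : IsLeafSet E) :
    Measurable (treeTess W E) := by
  refine measurable_generateFrom ?_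
  rintro _ ⟨A, hA, -, rfl⟩
  have hsplit : treeTess W E ⁻¹' {T : Tess W | boundary T.1 ∩ A = ∅}
      = ({H | GoodLeaves W E H} ∩
          ⋂ e ∈ E, {H | frontier (pathCell W.carrier H e) ∩ A = ∅}) ∪
        ({H | ¬ GoodLeaves W E H} ∩
          {_H | boundary (Tess.trivial W).1 ∩ A = ∅}) := by
    ext H
    simp only [mem_preimage, mem_ofPred_eq, mem_union, mem_inter_iff, mem_iInter]
    by_cases h : GoodLeaves W E H
    · simp only [h, h.treeTess_val hE, boundary, biUnion_image, true_and, not_true_eq_false,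
        false_and, or_false, iUnion_inter, iUnion_eq_empty, Finset.mem_coe]
    · have : treeTess W E H = Tess.trivial W :=
        Tess.ofCells_of_not_isTessellation ((hE.isTessellation_iff W H).not.2 h)
      simp only [h, this, false_and, not_false_eq_true, true_and, false_or]
  rw [hsplit]
  refine ((measurableSet_goodLeaves W E).inter ?_).union
    ((measurableSet_goodLeaves W E).compl.inter (MeasurableSet.const _))
  exact E.measurableSet_biInter fun e _ =>
    (isOpen_setOf_frontier_pathCell_disjoint W e hA).measurableSet

theorem GoodLeaves.zeta_treeTess {W : Window ℓ} {E : Finset Word} {H : Word → Hyp ℓ}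
    (h : GoodLeaves W E H) (hE : IsLeafSet E) (Λ : Measure (Hyp ℓ)) :
    zeta Λ (treeTess W E H) = ∑ e ∈ E, Λ (hit (pathCell W.carrier H e)) := by
  rw [zeta, h.treeTess_val hE,
    tsum_image (fun C => Λ (hit C)) (h.injOn hE)]
  exact Finset.tsum_subtype E fun e => Λ (hit (pathCell W.carrier H e))

theorem GoodLeaves.gam_treeTess {W : Window ℓ} {E : Finset Word} {H : Word → Hyp ℓ}
    (h : GoodLeaves W E H) (hE : IsLeafSet E) (Λ : Measure (Hyp ℓ)) :
    gam Λ (treeTess W E H) = ∑ e ∈ E, Λ.restrict (hit (pathCell W.carrier H e)) := by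
  ext s hs
  rw [gam, Measure.sum_apply _ hs, h.treeTess_val hE,
    tsum_image (fun C => Λ.restrict (hit C) s) (h.injOn hE), Measure.finsetSum_apply]
  exact Finset.tsum_subtype E fun e => Λ.restrict (hit (pathCell W.carrier H e)) s

/-! ### Histories of successive divisions -/

instance : MeasurableSpace Word := ⊤
instance : MeasurableSpace (Option Word) := ⊤
instance : DiscreteMeasurableSpace (Option Word) := ⟨fun _ => trivial⟩

/-- A jump of a tessellation process: the holding time before the jump, the word of the divided cell
(`none` if no cell is divided), and the dividing hyperplane. -/
abbrev Datum (ℓ : ℕ) := ℝ × Option Word × Hyp ℓ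

/-- A function defined by cases according to a countable-valued measurable function is measurable if
all its branches are. -/
theorem measurable_of_countable_cases {α β ι : Type*} [MeasurableSpace α] [MeasurableSpace β]
    [MeasurableSpace ι] [Countable ι] [MeasurableSingletonClass ι] {c : α → ι} {F : ι → α → β}
    (hc : Measurable c) (hF : ∀ i, Measurable (F i)) : Measurable fun a => F (c a) a :=
  (measurable_from_prod_countable_right (f := fun p : ι × α => F p.1 p.2) hF).comp
    (hc.prodMk measurable_id)

instance : DiscreteMeasurableSpace (Finset Word) :=
  ⟨fun s => s.to_countable.measurableSet⟩

/-- The leaves after division of `e`; nothing happens if `e` is not a leaf. -/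
def splitLeaves (E : Finset Word) : Option Word → Finset Word
  | none => E
  | some e => if e ∈ E then E.erase e ∪ {e ++ [false], e ++ [true]} else E

/-- The hyperplanes attached to the inner nodes after division of the cell of `e` by `h`. -/
def splitHyp (E : Finset Word) (H : Word → Hyp ℓ) : Option Word → Hyp ℓ → Word → Hyp ℓ
  | none, _ => H
  | some e, h => if e ∈ E then Function.update H e h else H

theorem IsLeafSet.splitLeaves {E : Finset Word} (hE : IsLeafSet E) (o : Option Word) :
    IsLeafSet (splitLeaves E o) := by
  cases o with
  | none => exact hE
  | some e =>
    by_cases he : e ∈ E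
    · simpa [STIT.splitLeaves, he] using hE.split he
    · simpa [STIT.splitLeaves, he] using hE

/-- Attaching a hyperplane to `e` does not change the cells of words that do not properly extend
`e`. -/
theorem pathCell_update_of_not_prefix (W : Set (Space ℓ)) (H : Word → Hyp ℓ) {e f : Word}
    (h : Hyp ℓ) (hef : e <+: f → e = f) :
    pathCell W (Function.update H e h) f = pathCell W H f := by
  refine pathCell_congr W fun i hi => ?_
  rw [Function.update_of_ne]
  rintro rfl
  have := congrArg List.length (hef (List.take_prefix i f))
  rw [List.length_take] at this
  omega

theorem IsLeafSet.pathCell_update {E : Finset Word} (hE : IsLeafSet E) (W : Set (Space ℓ))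
    (H : Word → Hyp ℓ) {e f : Word} (h : Hyp ℓ) (he : e ∈ E) (hf : f ∈ E) :
    pathCell W (Function.update H e h) f = pathCell W H f :=
  pathCell_update_of_not_prefix W H h fun hp => hE.eq_of_prefix he hf hp

theorem pathCell_update_snoc (W : Set (Space ℓ)) (H : Word → Hyp ℓ) (e : Word) (h : Hyp ℓ)
    (b : Bool) :
    pathCell W (Function.update H e h) (e ++ [b]) = pathCell W H e ∩ h.half b := by
  rw [pathCell_snoc, Function.update_self, pathCell_update_of_not_prefix W H h fun _ => rfl]

theorem GoodLeaves.split {W : Window ℓ} {E : Finset Word} {H : Word → Hyp ℓ}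
    (hg : GoodLeaves W E H) (hE : IsLeafSet E) {e : Word} {h : Hyp ℓ} (he : e ∈ E)
    (hh : h ∈ hit (interior (pathCell W.carrier H e))) :
    GoodLeaves W (splitLeaves E (some e)) (splitHyp E H (some e) h) := by
  intro f hf
  simp only [splitLeaves, he, if_true, splitHyp] at hf ⊢
  rcases mem_split_iff.1 hf with ⟨-, hf⟩ | ⟨b, rfl⟩
  · rw [hE.pathCell_update _ H h he hf]
    exact hg f hf
  · rw [pathCell_update_snoc]
    exact nonempty_interior_inter_half hh b

/-- The leaves after the first `n` jumps of the history `d`. -/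
def leaves (d : ℕ → Datum ℓ) : ℕ → Finset Word
  | 0 => {[]}
  | n + 1 => splitLeaves (leaves d n) (d n).2.1

/-- The hyperplanes attached to the inner nodes after the first `n` jumps of the history `d`. -/
def hypMap [Inhabited (Hyp ℓ)] (d : ℕ → Datum ℓ) : ℕ → Word → Hyp ℓ
  | 0 => fun _ => default
  | n + 1 => splitHyp (leaves d n) (hypMap d n) (d n).2.1 (d n).2.2

theorem isLeafSet_leaves (d : ℕ → Datum ℓ) (n : ℕ) : IsLeafSet (leaves d n) := by
  induction n with
  | zero => exact .root
  | succ n ih => exact ih.splitLeaves _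

theorem leaves_congr {d d' : ℕ → Datum ℓ} {n : ℕ} (h : ∀ j < n, d j = d' j) :
    leaves d n = leaves d' n := by
  induction n with
  | zero => rfl
  | succ n ih => rw [leaves, leaves, ih fun j hj => h j (by omega), h n (by omega)]

theorem hypMap_congr [Inhabited (Hyp ℓ)] {d d' : ℕ → Datum ℓ} {n : ℕ} (h : ∀ j < n, d j = d' j) :
    hypMap d n = hypMap d' n := by
  induction n with
  | zero => rfl
  | succ n ih =>
    rw [hypMap, hypMap, ih fun j hj => h j (by omega), h n (by omega),
      leaves_congr fun j hj => h j (by omega)]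

theorem card_leaves_le (d : ℕ → Datum ℓ) (n : ℕ) : (leaves d n).card ≤ n + 1 := by
  induction n with
  | zero => simp [leaves]
  | succ n ih =>
    rw [leaves]
    cases h : (d n).2.1 with
    | none => simp only [splitLeaves]; omega
    | some e =>
      simp only [splitLeaves]
      split_ifs with he
      · refine (Finset.card_union_le _ _).trans ?_
        rw [Finset.card_erase_of_mem he]
        have h1 : ({e ++ [false], e ++ [true]} : Finset Word).card ≤ 2 := Finset.card_le_two
        have h2 : 0 < (leaves d n).card := Finset.card_pos.2 ⟨e, he⟩
        omega
      · omega

theorem measurable_leaves (n : ℕ) : Measurable fun d : ℕ → Datum ℓ => leaves d n := by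
  induction n with
  | zero => exact measurable_const
  | succ n ih =>
    have h1 : Measurable fun d : ℕ → Datum ℓ => (leaves d n, (d n).2.1) :=
      ih.prodMk (by fun_prop)
    exact (measurable_from_prod_countable_right
      (f := fun p : Finset Word × Option Word => splitLeaves p.1 p.2)
      fun _ => Measurable.of_discrete).comp h1

theorem measurable_hypMap [Inhabited (Hyp ℓ)] (n : ℕ) :
    Measurable fun d : ℕ → Datum ℓ => hypMap d n := by
  induction n with
  | zero => exact measurable_const
  | succ n ih =>
    have h1 : ∀ (E : Finset Word) (o : Option Word),
        Measurable fun d : ℕ → Datum ℓ => splitHyp E (hypMap d n) o (d n).2.2 := by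
      intro E o
      cases o with
      | none => exact ih
      | some e =>
        by_cases he : e ∈ E
        · simp only [splitHyp, he, if_true]
          refine measurable_pi_iff.2 fun f => ?_
          by_cases hfe : f = e
          · subst hfe
            simp only [Function.update_self]
            fun_prop
          · simp only [Function.update_of_ne hfe]
            exact (measurable_pi_apply f).comp ih
        · simp only [splitHyp, he, if_false]
          exact ih
    refine measurable_of_countable_cases (measurable_leaves n)
      (F := fun E d => splitHyp E (hypMap d n) (d n).2.1 (d n).2.2) fun E => ?_
    exact measurable_of_countable_cases (c := fun d : ℕ → Datum ℓ => (d n).2.1)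
      (F := fun o d => splitHyp E (hypMap d n) o (d n).2.2) (by fun_prop) fun o => h1 E o

/-- All cells present after `n` jumps have interior points. -/
def Good [Inhabited (Hyp ℓ)] (W : Window ℓ) (n : ℕ) (d : ℕ → Datum ℓ) : Prop :=
  GoodLeaves W (leaves d n) (hypMap d n)

theorem measurableSet_good [Inhabited (Hyp ℓ)] (W : Window ℓ) (n : ℕ) :
    MeasurableSet {d : ℕ → Datum ℓ | Good W n d} := by
  have h : Measurable fun d : ℕ → Datum ℓ => GoodLeaves W (leaves d n) (hypMap d n) :=
    measurable_of_countable_cases (measurable_leaves n)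
      (F := fun E d => GoodLeaves W E (hypMap d n)) fun E =>
        measurableSet_setOfPred.1 ((measurable_hypMap n) (measurableSet_goodLeaves W E))
  exact measurableSet_setOfPred.2 h

/-- The tessellation after the first `n` jumps of the history `d`. -/
def tessOf [Inhabited (Hyp ℓ)] (W : Window ℓ) (n : ℕ) (d : ℕ → Datum ℓ) : Tess W :=
  treeTess W (leaves d n) (hypMap d n)

theorem measurable_tessOf [Inhabited (Hyp ℓ)] (W : Window ℓ) (n : ℕ) :
    Measurable (tessOf (ℓ := ℓ) W n) := by
  classical
  have : tessOf (ℓ := ℓ) W n = fun d => (fun (E : Finset Word) (d : ℕ → Datum ℓ) =>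
      if IsLeafSet E then treeTess W E (hypMap d n) else Tess.trivial W) (leaves d n) d := by
    ext1 d
    simp [tessOf, isLeafSet_leaves]
  rw [this]
  refine measurable_of_countable_cases (measurable_leaves n) (F := fun (E : Finset Word) d =>
    if IsLeafSet E then treeTess W E (hypMap d n) else Tess.trivial W) fun E => ?_
  by_cases hE : IsLeafSet E
  · simp only [hE, if_true]
    exact (measurable_treeTess W hE).comp (measurable_hypMap n)
  · simp only [hE, if_false]
    exact measurable_const

end STIT

namespace STIT

/-! ### Infinite product measures -/

section InfinitePi

variable {ι : Type*} {X : Type*} [MeasurableSpace X]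

/-- Resampling one coordinate of an infinite product. -/
theorem map_update_infinitePi [DecidableEq ι] (m : Measure X) [IsProbabilityMeasure m] (e : ι) :
    (m.prod (Measure.infinitePi fun _ : ι => m)).map (fun p => Function.update p.2 e p.1)
      = Measure.infinitePi fun _ : ι => m := by
  have hmeas : Measurable fun p : X × (ι → X) => Function.update p.2 e p.1 := by
    refine measurable_pi_iff.2 fun f => ?_
    by_cases hf : f = e
    · subst hf
      simpa using measurable_fst
    · simp only [Function.update_of_ne hf]
      fun_prop
  refine Measure.eq_infinitePi _ fun s t ht => ?_
  rw [Measure.map_apply hmeas (MeasurableSet.pi s.countable_toSet fun i _ => ht i)]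
  have hpre : (fun p : X × (ι → X) => Function.update p.2 e p.1) ⁻¹' (Set.pi s t)
      = (if e ∈ s then t e else univ) ×ˢ Set.pi (s.erase e : Finset ι) t := by
    ext ⟨x, ω⟩
    simp only [mem_preimage, Set.mem_pi, Finset.mem_coe, mem_prod, Finset.mem_erase]
    constructor
    · intro h
      refine ⟨?_, fun i hi => ?_⟩
      · split_ifs with he
        · simpa using h e he
        · trivial
      · simpa [Function.update_of_ne hi.1] using h i hi.2
    · rintro ⟨h1, h2⟩ i hi
      by_cases hie : i = e
      · subst hie
        simpa [hi] using h1
      · simpa [Function.update_of_ne hie] using h2 i ⟨hie, hi⟩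
  rw [hpre, Measure.prod_prod, Measure.infinitePi_pi _ fun i _ => ht i]
  by_cases he : e ∈ s
  · simp only [he, if_true]
    exact Finset.mul_prod_erase s (fun i => m (t i)) he
  · simp [he]

theorem measurable_update_prod [DecidableEq ι] (e : ι) :
    Measurable fun p : X × (ι → X) => Function.update p.2 e p.1 := by
  refine measurable_pi_iff.2 fun f => ?_
  by_cases hf : f = e
  · subst hf
    simpa using measurable_fst
  · simp only [Function.update_of_ne hf]
    fun_prop

/-- The first term and the remaining terms of an i.i.d. sequence. -/
theorem map_head_tail_infinitePi (m : Measure X) [IsProbabilityMeasure m] :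
    (Measure.infinitePi fun _ : ℕ => m).map (fun ω => (ω 0, fun n => ω (n + 1)))
      = m.prod (Measure.infinitePi fun _ : ℕ => m) := by
  conv_lhs => rw [← map_update_infinitePi m 0]
  rw [Measure.map_map (by fun_prop) (measurable_update_prod 0)]
  have : ((fun ω : ℕ → X => (ω 0, fun n => ω (n + 1))) ∘
      fun p : X × (ℕ → X) => Function.update p.2 0 p.1)
      = Prod.map id (fun ω : ℕ → X => fun n => ω (n + 1)) := by
    ext p <;> simp
  rw [this, ← Measure.map_prod_map _ _ measurable_id (by fun_prop), Measure.map_id,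
    Measure.map_infinitePi_infinitePi_of_inj (P := fun _ => m) (add_left_injective 1)]

/-- A family of independent pairs with independent components is a pair of independent families. -/
theorem map_unzip_infinitePi {Y : Type*} [MeasurableSpace Y] (m : Measure X)
    [IsProbabilityMeasure m] (m' : Measure Y) [IsProbabilityMeasure m'] :
    (Measure.infinitePi fun _ : ι => m.prod m').map (fun ω => (fun i => (ω i).1, fun i => (ω i).2))
      = (Measure.infinitePi fun _ : ι => m).prod (Measure.infinitePi fun _ : ι => m') := by
  classical
  symm
  refine Measure.prod_eq_generateFrom generateFrom_squareCylinders generateFrom_squareCylinders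
    (isPiSystem_squareCylinders (fun _ => MeasurableSpace.isPiSystem_measurableSet) (by simp))
    (isPiSystem_squareCylinders (fun _ => MeasurableSpace.isPiSystem_measurableSet) (by simp))
    ⟨fun _ => univ, fun _ => ⟨∅, fun _ => univ, by simp, by simp⟩,
      fun _ => measure_lt_top _ _, iUnion_const _⟩
    ⟨fun _ => univ, fun _ => ⟨∅, fun _ => univ, by simp, by simp⟩,
      fun _ => measure_lt_top _ _, iUnion_const _⟩ ?_
  rintro _ ⟨s, t, ht, rfl⟩ _ ⟨s', t', ht', rfl⟩
  have ht1 : ∀ i, MeasurableSet (t i) := fun i => ht i (mem_univ i)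
  have ht1' : ∀ i, MeasurableSet (t' i) := fun i => ht' i (mem_univ i)
  rw [Measure.map_apply (by fun_prop) ((MeasurableSet.pi s.countable_toSet fun i _ => ht1 i).prod
    (MeasurableSet.pi s'.countable_toSet fun i _ => ht1' i))]
  have hpre : (fun ω : ι → X × Y => (fun i => (ω i).1, fun i => (ω i).2)) ⁻¹'
      (Set.pi s t ×ˢ Set.pi s' t')
      = Set.pi (s ∪ s' : Finset ι)
        (fun i => (if i ∈ s then t i else univ) ×ˢ (if i ∈ s' then t' i else univ)) := by
    ext ω
    simp only [mem_preimage, mem_prod, Set.mem_pi, Finset.mem_coe, Finset.mem_union]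
    constructor
    · rintro ⟨h1, h2⟩ i -
      constructor
      · split_ifs with hi
        · exact h1 i hi
        · trivial
      · split_ifs with hi
        · exact h2 i hi
        · trivial
    · intro h
      exact ⟨fun i hi => by simpa [hi] using (h i (Or.inl hi)).1,
        fun i hi => by simpa [hi] using (h i (Or.inr hi)).2⟩
  rw [hpre, Measure.infinitePi_pi _ (by
      intro i _
      refine MeasurableSet.prod ?_ ?_
      · split_ifs
        exacts [ht1 i, .univ]
      · split_ifs
        exacts [ht1' i, .univ]),
    Measure.infinitePi_pi _ fun i _ => ht1 i, Measure.infinitePi_pi _ fun i _ => ht1' i]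
  simp only [Measure.prod_prod, Finset.prod_mul_distrib, apply_ite m, apply_ite m', measure_univ]
  congr 1
  · rw [Finset.prod_ite_mem, Finset.union_inter_cancel_left]
  · rw [Finset.prod_ite_mem, Finset.union_inter_cancel_right]

end InfinitePi

/-! ### Chains driven by a renewing source of randomness -/

section ChainDefs

variable {𝓓 Ω₁ : Type*} [Inhabited 𝓓]

/-- The history formed by the first `n` terms of `d`. -/
def trunc (n : ℕ) (d : ℕ → 𝓓) : ℕ → 𝓓 := fun j => if j < n then d j else default

theorem trunc_apply {n j : ℕ} (h : j < n) (d : ℕ → 𝓓) : trunc n d j = d j := if_pos h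

/-- The chain that starts from the empty history and the source `ω`: at step `n`, the history is
extended by the datum `D n`, and the source is replaced by `R n`. -/
def chain (D : ℕ → (ℕ → 𝓓) × Ω₁ → 𝓓) (R : ℕ → (ℕ → 𝓓) × Ω₁ → Ω₁) (ω : Ω₁) :
    ℕ → (ℕ → 𝓓) × Ω₁
  | 0 => (fun _ => default, ω)
  | n + 1 => (Function.update (chain D R ω n).1 n (D n (chain D R ω n)), R n (chain D R ω n))

/-- The sequence of the data of a chain. -/
def chainData (D : ℕ → (ℕ → 𝓓) × Ω₁ → 𝓓) (R : ℕ → (ℕ → 𝓓) × Ω₁ → Ω₁) (ω : Ω₁) (n : ℕ) : 𝓓 :=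
  D n (chain D R ω n)

theorem chain_fst (D : ℕ → (ℕ → 𝓓) × Ω₁ → 𝓓) (R : ℕ → (ℕ → 𝓓) × Ω₁ → Ω₁) (ω : Ω₁) (n : ℕ) :
    (chain D R ω n).1 = trunc n (chainData D R ω) := by
  induction n with
  | zero =>
    ext1 j
    simp [chain, trunc]
  | succ n ih =>
    ext1 j
    rw [chain]
    simp only
    by_cases hj : j = n
    · subst hj
      simp [trunc, chainData]
    · rw [Function.update_of_ne hj, ih]
      have : j < n + 1 ↔ j < n := by omega
      simp [trunc, this]

end ChainDefs

section Chain

variable {𝓢 𝓢' 𝓓 Ω₁ Ω₂ : Type*} [MeasurableSpace 𝓢] [MeasurableSpace 𝓢'] [MeasurableSpace 𝓓]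
  [MeasurableSpace Ω₁] [MeasurableSpace Ω₂]

/-- One step of a chain: the state `S` is updated by a datum drawn with the help of a source of
randomness independent of `S`, which renews itself independently of the datum. The law of the new
state is the one obtained from any other source that yields the same conditional law of the datum,
and the renewed source is again independent of it. -/
theorem map_prod_step (P : Measure 𝓢) [IsProbabilityMeasure P] (μ₁ : Measure Ω₁)
    [IsProbabilityMeasure μ₁] (μ₂ : Measure Ω₂) [IsProbabilityMeasure μ₂] {D₁ : 𝓢 × Ω₁ → 𝓓}
    (hD₁ : Measurable D₁) {D₂ : 𝓢 × Ω₂ → 𝓓} (hD₂ : Measurable D₂) {R₂ : 𝓢 × Ω₂ → Ω₂}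
    (hR₂ : Measurable R₂) {up : 𝓢 × 𝓓 → 𝓢'} (hup : Measurable up)
    (h : ∀ᵐ S ∂P, μ₂.map (fun ω => (D₂ (S, ω), R₂ (S, ω)))
      = (μ₁.map fun ω => D₁ (S, ω)).prod μ₂) :
    (P.prod μ₂).map (fun p => (up (p.1, D₂ p), R₂ p))
      = ((P.prod μ₁).map fun p => up (p.1, D₁ p)).prod μ₂ := by
  have hm1 : Measurable fun p : 𝓢 × Ω₁ => up (p.1, D₁ p) := by fun_prop
  have hm2 : Measurable fun p : 𝓢 × Ω₂ => (up (p.1, D₂ p), R₂ p) := by fun_prop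
  have := Measure.isProbabilityMeasure_map (μ := P.prod μ₁) hm1.aemeasurable
  symm
  refine Measure.prod_eq fun A B hA hB => ?_
  rw [Measure.map_apply hm2 (hA.prod hB), Measure.map_apply hm1 hA,
    Measure.prod_apply (hm2 (hA.prod hB)), Measure.prod_apply (hm1 hA),
    ← lintegral_mul_const _ (measurable_measure_prodMk_left (hm1 hA))]
  refine lintegral_congr_ae ?_
  filter_upwards [h] with S hS
  have hset : MeasurableSet ({d | up (S, d) ∈ A} ×ˢ B) :=
    ((hup.comp measurable_prodMk_left) hA).prod hB
  have h1 := congrArg (fun ν => ν ({d | up (S, d) ∈ A} ×ˢ B)) hS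
  have : IsProbabilityMeasure (μ₁.map fun ω => D₁ (S, ω)) :=
    Measure.isProbabilityMeasure_map (by fun_prop)
  rw [Measure.map_apply (by fun_prop) hset, Measure.prod_prod,
    Measure.map_apply (by fun_prop)
      (show MeasurableSet {d | up (S, d) ∈ A} from (hup.comp measurable_prodMk_left) hA)] at h1
  exact h1

theorem measurable_update_history (n : ℕ) :
    Measurable fun p : (ℕ → 𝓓) × 𝓓 => Function.update p.1 n p.2 := by
  refine measurable_pi_iff.2 fun f => ?_
  by_cases hf : f = n
  · subst hf
    simpa using measurable_snd
  · simp only [Function.update_of_ne hf]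
    fun_prop

theorem measurable_extend {D : ℕ → (ℕ → 𝓓) × Ω₁ → 𝓓} (hD : ∀ n, Measurable (D n)) (n : ℕ) :
    Measurable fun p : (ℕ → 𝓓) × Ω₁ => Function.update p.1 n (D n p) :=
  (measurable_update_history n).comp (measurable_fst.prodMk (hD n))

theorem map_fst_eq {S : 𝓢} {D : 𝓢 × Ω₁ → 𝓓} (hD : Measurable D) {R : 𝓢 × Ω₁ → Ω₁}
    (hR : Measurable R) (μ : Measure Ω₁) [IsProbabilityMeasure μ] {κ : Measure 𝓓}
    (h : μ.map (fun ω => (D (S, ω), R (S, ω))) = κ.prod μ) : μ.map (fun ω => D (S, ω)) = κ := by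
  have h1 := congrArg (Measure.map Prod.fst) h
  rw [Measure.map_map measurable_fst (by
    exact (hD.comp measurable_prodMk_left).prodMk (hR.comp measurable_prodMk_left)),
    Measure.map_fst_prod, measure_univ, one_smul] at h1
  exact h1

variable [Inhabited 𝓓]

theorem measurable_trunc (n : ℕ) : Measurable (trunc (𝓓 := 𝓓) n) := by
  refine measurable_pi_iff.2 fun j => ?_
  unfold trunc
  split_ifs
  · fun_prop
  · exact measurable_const

/-- The law of a sequence is determined by the laws of its initial segments. -/
theorem eq_of_map_trunc_eq {μ ν : Measure (ℕ → 𝓓)} [IsFiniteMeasure μ]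
    (h : ∀ n, μ.map (trunc n) = ν.map (trunc n)) : μ = ν := by
  have hI : ∀ I : Finset ℕ, μ.map I.restrict = ν.map I.restrict := by
    intro I
    obtain ⟨n, hn⟩ : ∃ n, ∀ i ∈ I, i < n :=
      ⟨I.sup id + 1, fun i hi => Nat.lt_succ_of_le (Finset.le_sup (f := id) hi)⟩
    have hc : (I.restrict : (ℕ → 𝓓) → _) = I.restrict ∘ trunc n := by
      ext d i
      simp [trunc, hn i i.2]
    rw [hc, ← Measure.map_map (by fun_prop) (measurable_trunc n), h n,
      Measure.map_map (by fun_prop) (measurable_trunc n)]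
  have h1 : IsProjectiveLimit μ fun I : Finset ℕ => ν.map I.restrict := hI
  have : ∀ I : Finset ℕ, IsFiniteMeasure (ν.map (I.restrict (π := fun _ : ℕ => 𝓓))) :=
    fun I => hI I ▸ inferInstance
  exact h1.unique fun _ => rfl

theorem measurable_chain {D : ℕ → (ℕ → 𝓓) × Ω₁ → 𝓓} (hD : ∀ n, Measurable (D n))
    {R : ℕ → (ℕ → 𝓓) × Ω₁ → Ω₁} (hR : ∀ n, Measurable (R n)) (n : ℕ) :
    Measurable fun ω => chain D R ω n := by
  induction n with
  | zero => exact measurable_const.prodMk measurable_id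
  | succ n ih =>
    exact ((measurable_update_history n).comp (ih.fst.prodMk ((hD n).comp ih))).prodMk
      ((hR n).comp ih)

theorem measurable_chainData {D : ℕ → (ℕ → 𝓓) × Ω₁ → 𝓓} (hD : ∀ n, Measurable (D n))
    {R : ℕ → (ℕ → 𝓓) × Ω₁ → Ω₁} (hR : ∀ n, Measurable (R n)) :
    Measurable (chainData D R) :=
  measurable_pi_iff.2 fun n => (hD n).comp (measurable_chain hD hR n)

/-- If, on good histories, the data have the conditional law `κ` and the source renews itself, and
if almost every datum extends a good history to a good history, then the histories are almost surely
good, and the source remains independent of the history. -/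
theorem map_chain {D : ℕ → (ℕ → 𝓓) × Ω₁ → 𝓓} (hD : ∀ n, Measurable (D n))
    {R : ℕ → (ℕ → 𝓓) × Ω₁ → Ω₁} (hR : ∀ n, Measurable (R n)) (μ : Measure Ω₁)
    [IsProbabilityMeasure μ] (κ : ℕ → (ℕ → 𝓓) → Measure 𝓓)
    {𝓖 : ℕ → (ℕ → 𝓓) → Prop} (h𝓖 : ∀ n, MeasurableSet {S | 𝓖 n S}) (h0 : 𝓖 0 fun _ => default)
    (hκ : ∀ n S, 𝓖 n S → μ.map (fun ω => (D n (S, ω), R n (S, ω))) = (κ n S).prod μ)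
    (hstep : ∀ n S, 𝓖 n S → ∀ᵐ d ∂κ n S, 𝓖 (n + 1) (Function.update S n d)) (n : ℕ) :
    μ.map (fun ω => chain D R ω n) = (μ.map fun ω => (chain D R ω n).1).prod μ ∧
      ∀ᵐ S ∂μ.map (fun ω => (chain D R ω n).1), 𝓖 n S := by
  have hD' : ∀ n S, 𝓖 n S → μ.map (fun ω => D n (S, ω)) = κ n S := fun n S hS =>
    map_fst_eq (hD n) (hR n) μ (hκ n S hS)
  induction n with
  | zero =>
    simp only [chain]
    refine ⟨?_, ?_⟩
    · rw [Measure.map_const, measure_univ, one_smul, Measure.dirac_prod]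
    · rw [Measure.map_const, measure_univ, one_smul, ae_dirac_iff (h𝓖 0)]
      exact h0
  | succ n ih =>
    obtain ⟨ih1, ih2⟩ := ih
    have hc := measurable_chain hD hR n
    set P := μ.map fun ω => (chain D R ω n).1 with hP
    have : IsProbabilityMeasure P := Measure.isProbabilityMeasure_map hc.fst.aemeasurable
    have hup := measurable_update_history (𝓓 := 𝓓) n
    have hstep' := map_prod_step P μ μ (hD n) (hD n) (hR n) hup (by
      filter_upwards [ih2] with S hS
      rw [hκ n S hS, hD' n S hS])
    have hm : Measurable fun p : (ℕ → 𝓓) × Ω₁ => (Function.update p.1 n (D n p), R n p) :=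
      (measurable_extend hD n).prodMk (hR n)
    have h1 : μ.map (fun ω => chain D R ω (n + 1))
        = (P.prod μ).map fun p => (Function.update p.1 n (D n p), R n p) := by
      rw [← ih1, Measure.map_map hm hc]
      rfl
    have h2 : μ.map (fun ω => (chain D R ω (n + 1)).1)
        = (P.prod μ).map fun p => Function.update p.1 n (D n p) := by
      rw [← ih1, Measure.map_map (measurable_extend hD n) hc]
      rfl
    refine ⟨by rw [h1, h2]; exact hstep', ?_⟩
    rw [h2, ae_map_iff (measurable_extend hD n).aemeasurable (h𝓖 (n + 1))]
    refine Measure.ae_prod_iff_ae_ae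
      ((measurable_extend hD n) (h𝓖 (n + 1))) |>.2 ?_
    filter_upwards [ih2] with S hS
    have h3 := hstep n S hS
    rw [← hD' n S hS] at h3
    exact ae_of_ae_map ((hD n).comp measurable_prodMk_left).aemeasurable h3

/-- Two chains whose data have the same conditional laws given almost every history have the same
laws of histories, and the source of the second chain remains independent of the history, if this
holds for the first chain. -/
theorem map_chain_of_ae {D₁ : ℕ → (ℕ → 𝓓) × Ω₁ → 𝓓} (hD₁ : ∀ n, Measurable (D₁ n))
    {R₁ : ℕ → (ℕ → 𝓓) × Ω₁ → Ω₁} (hR₁ : ∀ n, Measurable (R₁ n)) (μ₁ : Measure Ω₁)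
    [IsProbabilityMeasure μ₁]
    {D₂ : ℕ → (ℕ → 𝓓) × Ω₂ → 𝓓} (hD₂ : ∀ n, Measurable (D₂ n))
    {R₂ : ℕ → (ℕ → 𝓓) × Ω₂ → Ω₂} (hR₂ : ∀ n, Measurable (R₂ n)) (μ₂ : Measure Ω₂)
    [IsProbabilityMeasure μ₂]
    (h₁ : ∀ n, μ₁.map (fun ω => chain D₁ R₁ ω n) = (μ₁.map fun ω => (chain D₁ R₁ ω n).1).prod μ₁)
    (h : ∀ n, ∀ᵐ S ∂μ₁.map (fun ω => (chain D₁ R₁ ω n).1),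
      μ₂.map (fun ω => (D₂ n (S, ω), R₂ n (S, ω))) = (μ₁.map fun ω => D₁ n (S, ω)).prod μ₂)
    (n : ℕ) :
    μ₂.map (fun ω => chain D₂ R₂ ω n) = (μ₁.map fun ω => (chain D₁ R₁ ω n).1).prod μ₂ := by
  induction n with
  | zero =>
    simp only [chain]
    rw [Measure.map_const, measure_univ, one_smul, Measure.dirac_prod]
  | succ n ih =>
    have hm₁ := measurable_chain hD₁ hR₁ n
    have hm₂ := measurable_chain hD₂ hR₂ n
    set P := μ₁.map fun ω => (chain D₁ R₁ ω n).1 with hP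
    have : IsProbabilityMeasure P := Measure.isProbabilityMeasure_map hm₁.fst.aemeasurable
    have h1 : μ₁.map (fun ω => (chain D₁ R₁ ω (n + 1)).1)
        = (P.prod μ₁).map fun p => Function.update p.1 n (D₁ n p) := by
      rw [← h₁ n, Measure.map_map (measurable_extend hD₁ n) hm₁]
      rfl
    have hm : Measurable fun p : (ℕ → 𝓓) × Ω₂ => (Function.update p.1 n (D₂ n p), R₂ n p) :=
      (measurable_extend hD₂ n).prodMk (hR₂ n)
    have h2 : μ₂.map (fun ω => chain D₂ R₂ ω (n + 1))
        = (P.prod μ₂).map fun p => (Function.update p.1 n (D₂ n p), R₂ n p) := by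
      rw [← ih, Measure.map_map hm hm₂]
      rfl
    rw [h1, h2]
    exact map_prod_step P μ₁ μ₂ (hD₁ n) (hD₂ n) (hR₂ n) (measurable_update_history n) (h n)

/-- The conditional laws of the data need to agree only given almost every history of the first
chain, whose source is known to remain independent of the history. -/
theorem map_chainData_eq_of_ae {D₁ : ℕ → (ℕ → 𝓓) × Ω₁ → 𝓓} (hD₁ : ∀ n, Measurable (D₁ n))
    {R₁ : ℕ → (ℕ → 𝓓) × Ω₁ → Ω₁} (hR₁ : ∀ n, Measurable (R₁ n)) (μ₁ : Measure Ω₁)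
    [IsProbabilityMeasure μ₁]
    {D₂ : ℕ → (ℕ → 𝓓) × Ω₂ → 𝓓} (hD₂ : ∀ n, Measurable (D₂ n))
    {R₂ : ℕ → (ℕ → 𝓓) × Ω₂ → Ω₂} (hR₂ : ∀ n, Measurable (R₂ n)) (μ₂ : Measure Ω₂)
    [IsProbabilityMeasure μ₂]
    (h₁ : ∀ n, μ₁.map (fun ω => chain D₁ R₁ ω n) = (μ₁.map fun ω => (chain D₁ R₁ ω n).1).prod μ₁)
    (h : ∀ n, ∀ᵐ S ∂μ₁.map (fun ω => (chain D₁ R₁ ω n).1),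
      μ₂.map (fun ω => (D₂ n (S, ω), R₂ n (S, ω))) = (μ₁.map fun ω => D₁ n (S, ω)).prod μ₂) :
    μ₁.map (chainData D₁ R₁) = μ₂.map (chainData D₂ R₂) := by
  have : IsProbabilityMeasure (μ₁.map (chainData D₁ R₁)) :=
    Measure.isProbabilityMeasure_map (measurable_chainData hD₁ hR₁).aemeasurable
  refine eq_of_map_trunc_eq fun n => ?_
  rw [Measure.map_map (measurable_trunc n) (measurable_chainData hD₁ hR₁),
    Measure.map_map (measurable_trunc n) (measurable_chainData hD₂ hR₂)]
  have h1 := congrArg (Measure.map Prod.fst) (map_chain_of_ae hD₁ hR₁ μ₁ hD₂ hR₂ μ₂ h₁ h n)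
  rw [Measure.map_map measurable_fst (measurable_chain hD₂ hR₂ n), Measure.map_fst_prod,
    measure_univ, one_smul] at h1
  have h2 : (trunc n ∘ chainData D₂ R₂) = Prod.fst ∘ fun ω => chain D₂ R₂ ω n := by
    ext1 ω
    exact (chain_fst D₂ R₂ ω n).symm
  have h3 : (trunc n ∘ chainData D₁ R₁) = fun ω => (chain D₁ R₁ ω n).1 := by
    ext1 ω
    exact (chain_fst D₁ R₁ ω n).symm
  rw [h2, h3, h1]

/-- The law of the data of a chain depends on the conditional laws of the data only. -/
theorem map_chainData_eq {D₁ : ℕ → (ℕ → 𝓓) × Ω₁ → 𝓓} (hD₁ : ∀ n, Measurable (D₁ n))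
    {R₁ : ℕ → (ℕ → 𝓓) × Ω₁ → Ω₁} (hR₁ : ∀ n, Measurable (R₁ n)) (μ₁ : Measure Ω₁)
    [IsProbabilityMeasure μ₁]
    {D₂ : ℕ → (ℕ → 𝓓) × Ω₂ → 𝓓} (hD₂ : ∀ n, Measurable (D₂ n))
    {R₂ : ℕ → (ℕ → 𝓓) × Ω₂ → Ω₂} (hR₂ : ∀ n, Measurable (R₂ n)) (μ₂ : Measure Ω₂)
    [IsProbabilityMeasure μ₂] (κ : ℕ → (ℕ → 𝓓) → Measure 𝓓)
    {𝓖 : ℕ → (ℕ → 𝓓) → Prop} (h𝓖 : ∀ n, MeasurableSet {S | 𝓖 n S}) (h0 : 𝓖 0 fun _ => default)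
    (hκ₁ : ∀ n S, 𝓖 n S → μ₁.map (fun ω => (D₁ n (S, ω), R₁ n (S, ω))) = (κ n S).prod μ₁)
    (hκ₂ : ∀ n S, 𝓖 n S → μ₂.map (fun ω => (D₂ n (S, ω), R₂ n (S, ω))) = (κ n S).prod μ₂)
    (hstep : ∀ n S, 𝓖 n S → ∀ᵐ d ∂κ n S, 𝓖 (n + 1) (Function.update S n d)) :
    μ₁.map (chainData D₁ R₁) = μ₂.map (chainData D₂ R₂) := by
  have hc := map_chain hD₁ hR₁ μ₁ κ h𝓖 h0 hκ₁ hstep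
  refine map_chainData_eq_of_ae hD₁ hR₁ μ₁ hD₂ hR₂ μ₂ (fun n => (hc n).1) fun n => ?_
  filter_upwards [(hc n).2] with S hS
  rw [hκ₂ n S hS, map_fst_eq (hD₁ n) (hR₁ n) μ₁ (hκ₁ n S hS)]

end Chain

end STIT

namespace STIT

/-! ### Exponential lifetimes -/

instance : IsProbabilityMeasure (expMeasure 1) := isProbabilityMeasure_expMeasure one_pos

theorem lintegral_expMeasure_one (f : ℝ → ℝ≥0∞) (hf : Measurable f) :
    ∫⁻ x, f x ∂expMeasure 1 = ∫⁻ x in Ioi 0, ENNReal.ofReal (Real.exp (-x)) * f x := by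
  have h1 : expMeasure 1 = volume.withDensity (exponentialPDF 1) := rfl
  have hm : Measurable (exponentialPDF 1) := (measurable_exponentialPDFReal 1).ennreal_ofReal
  rw [h1, lintegral_withDensity_eq_lintegral_mul _ hm hf, ← lintegral_indicator measurableSet_Ioi]
  refine lintegral_congr_ae ?_
  filter_upwards [(measure_eq_zero_iff_ae_notMem (μ := volume) (s := {(0 : ℝ)})).1 (by simp)]
    with x hx
  have hx0 : x ≠ 0 := hx
  rcases lt_or_gt_of_ne hx0 with h | h
  · simp [exponentialPDF_of_neg h, h.le]
  · simp [exponentialPDF_of_nonneg h.le, h]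

theorem expMeasure_one_ae_nonneg : ∀ᵐ x ∂expMeasure 1, 0 ≤ x := by
  rw [ae_iff]
  have hms : MeasurableSet {x : ℝ | ¬ 0 ≤ x} := measurableSet_Ici.compl
  have := lintegral_expMeasure_one ({x : ℝ | ¬ 0 ≤ x}.indicator 1) (measurable_one.indicator hms)
  rw [lintegral_indicator_one hms] at this
  rw [this, lintegral_eq_zero_iff' (by
    refine (AEMeasurable.mul (by fun_prop) ?_)
    exact (measurable_one.indicator hms).aemeasurable)]
  filter_upwards [ae_restrict_mem measurableSet_Ioi] with x hx
  have : (0 : ℝ) ≤ x := le_of_lt hx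
  simp [this]

/-- Absence of memory. -/
theorem setLIntegral_expMeasure_one_sub {a : ℝ} (ha : 0 ≤ a) (g : ℝ → ℝ≥0∞) (hg : Measurable g) :
    ∫⁻ x in Ioi a, g (x - a) ∂expMeasure 1
      = ENNReal.ofReal (Real.exp (-a)) * ∫⁻ x, g x ∂expMeasure 1 := by
  rw [← lintegral_indicator measurableSet_Ioi, lintegral_expMeasure_one _
    ((show Measurable fun x => g (x - a) by fun_prop).indicator measurableSet_Ioi),
    lintegral_expMeasure_one _ hg, ← lintegral_const_mul _ (by fun_prop),
    ← lintegral_indicator measurableSet_Ioi, ← lintegral_indicator measurableSet_Ioi,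
    ← lintegral_add_right_eq_self _ a]
  refine lintegral_congr fun x => ?_
  by_cases hx : 0 < x
  · have h1 : 0 < x + a := by linarith
    simp only [indicator, mem_Ioi, h1, hx, if_true, lt_add_iff_pos_left, add_sub_cancel_right]
    rw [← mul_assoc, ← ENNReal.ofReal_mul (Real.exp_pos _).le, ← Real.exp_add, neg_add_rev]
  · simp [indicator, hx]

theorem lintegral_Ioi_comp_mul_left {c : ℝ} (hc : 0 < c) (g : ℝ → ℝ≥0∞) (hg : Measurable g) :
    ∫⁻ x in Ioi 0, g (c * x) = ENNReal.ofReal c⁻¹ * ∫⁻ x in Ioi 0, g x := by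
  rw [← lintegral_indicator measurableSet_Ioi, ← lintegral_indicator measurableSet_Ioi]
  have h1 : ∫⁻ x, (Ioi (0 : ℝ)).indicator g (c * x)
      = ∫⁻ x, (Ioi (0 : ℝ)).indicator g x ∂(volume.map (c * ·)) :=
    (lintegral_map (hg.indicator measurableSet_Ioi) (by fun_prop)).symm
  rw [Real.map_volume_mul_left hc.ne', lintegral_smul_measure, abs_of_pos (inv_pos.2 hc)] at h1
  rw [smul_eq_mul] at h1
  rw [← h1]
  refine lintegral_congr fun x => ?_
  simp [indicator, mul_pos_iff_of_pos_left hc]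

/-- The first of several exponential clocks: if one clock has rate `r` and the total rate is `s`,
then the time at which this clock rings, on the event that the other clocks are still
running, is exponential with rate `s`, up to the probability `r / s` of the event. -/
theorem lintegral_expMeasure_one_race {r s : ℝ} (hr : 0 < r) (hs : 0 < s) (F : ℝ → ℝ≥0∞)
    (hF : Measurable F) :
    ∫⁻ z, ENNReal.ofReal (Real.exp (-((s - r) * (r⁻¹ * z)))) * F (r⁻¹ * z) ∂expMeasure 1
      = ENNReal.ofReal (r / s) * ∫⁻ v, F (s⁻¹ * v) ∂expMeasure 1 := by
  have key : ∀ c : ℝ, 0 < c →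
      ∫⁻ z in Ioi 0, ENNReal.ofReal (Real.exp (-(s * (c⁻¹ * z)))) * F (c⁻¹ * z)
        = ENNReal.ofReal c * ∫⁻ z in Ioi 0, ENNReal.ofReal (Real.exp (-(s * z))) * F z := by
    intro c hc
    rw [lintegral_Ioi_comp_mul_left (inv_pos.2 hc)
      (fun z => ENNReal.ofReal (Real.exp (-(s * z))) * F z) (by fun_prop), inv_inv]
  rw [lintegral_expMeasure_one _ (by fun_prop), lintegral_expMeasure_one _ (by fun_prop)]
  have h1 : ∀ z : ℝ, ENNReal.ofReal (Real.exp (-z)) *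
      (ENNReal.ofReal (Real.exp (-((s - r) * (r⁻¹ * z)))) * F (r⁻¹ * z))
      = ENNReal.ofReal (Real.exp (-(s * (r⁻¹ * z)))) * F (r⁻¹ * z) := by
    intro z
    rw [← mul_assoc, ← ENNReal.ofReal_mul (Real.exp_pos _).le, ← Real.exp_add]
    congr 4
    field_simp
    ring
  have h2 : ∀ z : ℝ, ENNReal.ofReal (Real.exp (-z)) * F (s⁻¹ * z)
      = ENNReal.ofReal (Real.exp (-(s * (s⁻¹ * z)))) * F (s⁻¹ * z) := by
    intro z
    congr 4
    field_simp
  simp only [h1, h2]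
  rw [key r hr, key s hs, ← mul_assoc, ← ENNReal.ofReal_mul (by positivity)]
  congr 2
  field_simp

/-! ### Competing exponential clocks -/

open Classical in
/-- The element of `L` at which `ρ` has a strict minimum, if there is one. -/
def strictArgmin {ι : Type*} (L : Finset ι) (ρ : ι → ℝ) : Option ι :=
  if h : ∃ e, e ∈ L ∧ ∀ f ∈ L, f ≠ e → ρ e < ρ f then some h.choose else none

theorem strictArgmin_eq_some_iff {ι : Type*} {L : Finset ι} {ρ : ι → ℝ} {e : ι} :
    strictArgmin L ρ = some e ↔ e ∈ L ∧ ∀ f ∈ L, f ≠ e → ρ e < ρ f := by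
  have huniq : ∀ e e', (e ∈ L ∧ ∀ f ∈ L, f ≠ e → ρ e < ρ f) →
      (e' ∈ L ∧ ∀ f ∈ L, f ≠ e' → ρ e' < ρ f) → e = e' := by
    intro e e' h h'
    by_contra hne
    exact lt_asymm (h.2 e' h'.1 (Ne.symm hne)) (h'.2 e h.1 hne)
  unfold strictArgmin
  constructor
  · intro h
    split_ifs at h with hex
    rw [Option.some_inj] at h
    exact h ▸ hex.choose_spec
  · intro h
    have hex : ∃ e, e ∈ L ∧ ∀ f ∈ L, f ≠ e → ρ e < ρ f := ⟨e, h⟩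
    rw [dif_pos hex, huniq _ _ hex.choose_spec h]

section ClockLaw

variable {ι 𝓨 : Type*} [MeasurableSpace 𝓨] [MeasurableSpace (Option ι)]

/-- The conditional law of the datum produced by competing clocks: an exponential time with the
total rate, and, independently, a label chosen proportionally to the rates, with its mark. -/
def clockLaw (L : Finset ι) (r : ι → ℝ) (χ : ι → Measure 𝓨) :
    Measure (ℝ × Option ι × 𝓨) :=
  ∑ e ∈ L, ENNReal.ofReal (r e / ∑ f ∈ L, r f) •
    ((expMeasure 1).map fun v => (∑ f ∈ L, r f)⁻¹ * v).prod ((Measure.dirac (some e)).prod (χ e))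

theorem isProbabilityMeasure_clockLaw {L : Finset ι} (hL : L.Nonempty) {r : ι → ℝ}
    (hr : ∀ e ∈ L, 0 < r e) (χ : ι → Measure 𝓨) (hχ : ∀ e ∈ L, IsProbabilityMeasure (χ e)) :
    IsProbabilityMeasure (clockLaw L r χ) := by
  have hs : 0 < ∑ f ∈ L, r f := Finset.sum_pos hr hL
  have : IsProbabilityMeasure ((expMeasure 1).map fun v => (∑ f ∈ L, r f)⁻¹ * v) :=
    Measure.isProbabilityMeasure_map (by fun_prop)
  constructor
  rw [clockLaw, Measure.finsetSum_apply]
  have h1 : ∀ e ∈ L, (ENNReal.ofReal (r e / ∑ f ∈ L, r f) •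
      ((expMeasure 1).map fun v => (∑ f ∈ L, r f)⁻¹ * v).prod
        ((Measure.dirac (some e)).prod (χ e))) univ = ENNReal.ofReal (r e / ∑ f ∈ L, r f) := by
    intro e he
    have := hχ e he
    rw [Measure.smul_apply, measure_univ, smul_eq_mul, mul_one]
  rw [Finset.sum_congr rfl h1, ← ENNReal.ofReal_sum_of_nonneg fun e he => by
    have := hr e he
    positivity]
  rw [← Finset.sum_div, div_self hs.ne', ENNReal.ofReal_one]

end ClockLaw

section ClockDefs

variable {ι 𝓠 𝓨 : Type*} [DecidableEq ι]

/-- Let the clocks in `L`, with rates `r`, run for the time `t`. -/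
def runClocks (L : Finset ι) (r : ι → ℝ) (t : ℝ) (ω : ι → ℝ × 𝓠) : ι → ℝ × 𝓠 :=
  fun f => if f ∈ L then ((ω f).1 - r f * t, (ω f).2) else ω f

variable [Inhabited 𝓨]

/-- The datum produced by competing clocks: the time at which the first clock rings, the label of
this clock, and the mark that it carries. If there is no strict minimum, which has probability zero,
there is no label. -/
def clockDatum (L : Finset ι) (r : ι → ℝ) (cons : ι → 𝓠 → 𝓨 × ℝ × 𝓠) (ω : ι → ℝ × 𝓠) :
    ℝ × Option ι × 𝓨 :=
  match strictArgmin L fun e => (r e)⁻¹ * (ω e).1 with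
  | some e => ((r e)⁻¹ * (ω e).1, some e, (cons e (ω e).2).1)
  | none => (0, none, default)

/-- The clocks after the first of them has rung: this clock is replaced by a new one, the other ones
go on. Nothing changes if there is no strict minimum. -/
def clockRenew (L : Finset ι) (r : ι → ℝ) (cons : ι → 𝓠 → 𝓨 × ℝ × 𝓠) (ω : ι → ℝ × 𝓠) :
    ι → ℝ × 𝓠 :=
  match strictArgmin L fun e => (r e)⁻¹ * (ω e).1 with
  | some e => Function.update (runClocks (L.erase e) r ((r e)⁻¹ * (ω e).1) ω) e (cons e (ω e).2).2
  | none => ω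

end ClockDefs

section Clocks

variable {ι 𝓠 𝓨 : Type*} [DecidableEq ι] [MeasurableSpace 𝓠] [MeasurableSpace 𝓨]

/-- Absence of memory for a clock that carries an independent mark. -/
theorem expMeasure_prod_apply_sub (Q : Measure 𝓠) [IsProbabilityMeasure Q] {a : ℝ} (ha : 0 ≤ a)
    {B : Set (ℝ × 𝓠)} (hB : MeasurableSet B) :
    ((expMeasure 1).prod Q) {x | a < x.1 ∧ (x.1 - a, x.2) ∈ B}
      = ENNReal.ofReal (Real.exp (-a)) * ((expMeasure 1).prod Q) B := by
  have hm : Measurable fun x : ℝ × 𝓠 => (x.1 - a, x.2) := by fun_prop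
  have hset : MeasurableSet {x : ℝ × 𝓠 | a < x.1 ∧ (x.1 - a, x.2) ∈ B} :=
    (measurableSet_lt measurable_const measurable_fst).inter (hm hB)
  rw [Measure.prod_apply hset, Measure.prod_apply hB,
    ← setLIntegral_expMeasure_one_sub ha _ (measurable_measure_prodMk_left hB),
    ← lintegral_indicator measurableSet_Ioi]
  refine lintegral_congr fun z => ?_
  by_cases hz : a < z
  · rw [indicator_of_mem (by exact hz)]
    congr 1
    ext q
    simp [hz]
  · rw [indicator_of_notMem (by exact hz)]
    have : Prod.mk z ⁻¹' {x : ℝ × 𝓠 | a < x.1 ∧ (x.1 - a, x.2) ∈ B} = ∅ := by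
      ext q
      simp [hz]
    rw [this, measure_empty]

theorem measurable_runClocks (L : Finset ι) (r : ι → ℝ) :
    Measurable fun p : ℝ × (ι → ℝ × 𝓠) => runClocks L r p.1 p.2 := by
  refine measurable_pi_iff.2 fun f => ?_
  unfold runClocks
  split_ifs <;> fun_prop

/-- If none of the clocks has rung before time `t`, then the remaining times have the same law as
the original ones. -/
theorem infinitePi_apply_runClocks (Q : Measure 𝓠) [IsProbabilityMeasure Q] (L : Finset ι)
    {r : ι → ℝ} (hr : ∀ f ∈ L, 0 ≤ r f) {t : ℝ} (ht : 0 ≤ t) {B : Set (ι → ℝ × 𝓠)}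
    (hB : MeasurableSet B) :
    (Measure.infinitePi fun _ : ι => (expMeasure 1).prod Q)
        {ω | (∀ f ∈ L, r f * t < (ω f).1) ∧ runClocks L r t ω ∈ B}
      = ENNReal.ofReal (Real.exp (-((∑ f ∈ L, r f) * t))) *
        (Measure.infinitePi fun _ : ι => (expMeasure 1).prod Q) B := by
  set m := (expMeasure 1).prod Q with hm
  set μ := Measure.infinitePi fun _ : ι => m with hμ
  set c := ENNReal.ofReal (Real.exp (-((∑ f ∈ L, r f) * t))) with hc
  have hc0 : c ≠ 0 := by simp [hc, Real.exp_pos]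
  have hct : c ≠ ∞ := ENNReal.ofReal_ne_top
  have hcprod : c = ∏ f ∈ L, ENNReal.ofReal (Real.exp (-(r f * t))) := by
    rw [hc, ← ENNReal.ofReal_prod_of_nonneg fun f _ => (Real.exp_pos _).le, ← Real.exp_sum,
      Finset.sum_neg_distrib, Finset.sum_mul]
  have hrun : Measurable (runClocks (𝓠 := 𝓠) L r t) := by
    refine measurable_pi_iff.2 fun f => ?_
    unfold runClocks
    split_ifs <;> fun_prop
  have hcond : MeasurableSet {ω : ι → ℝ × 𝓠 | ∀ f ∈ L, r f * t < (ω f).1} := by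
    have : {ω : ι → ℝ × 𝓠 | ∀ f ∈ L, r f * t < (ω f).1}
        = ⋂ f ∈ L, {ω | r f * t < (ω f).1} := by
      ext ω
      simp
    rw [this]
    exact L.measurableSet_biInter fun f _ => measurableSet_lt measurable_const (by fun_prop)
  have key : c⁻¹ • (μ.restrict {ω | ∀ f ∈ L, r f * t < (ω f).1}).map (runClocks L r t) = μ := by
    refine Measure.eq_infinitePi _ fun s B hB => ?_
    rw [Measure.smul_apply, Measure.map_apply hrun (MeasurableSet.pi s.countable_toSet
      fun i _ => hB i), Measure.restrict_apply (hrun (MeasurableSet.pi s.countable_toSet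
      fun i _ => hB i))]
    set T : ι → Set (ℝ × 𝓠) := fun f => if f ∈ L then
      {x | r f * t < x.1 ∧ (x.1 - r f * t, x.2) ∈ (if f ∈ s then B f else univ)}
      else (if f ∈ s then B f else univ) with hT
    have hB' : ∀ f, MeasurableSet (if f ∈ s then B f else univ) := by
      intro f
      split_ifs
      exacts [hB f, .univ]
    have hTm : ∀ f, MeasurableSet (T f) := by
      intro f
      simp only [hT]
      split_ifs with h1
      · exact (measurableSet_lt measurable_const measurable_fst).inter
          ((show Measurable fun x : ℝ × 𝓠 => (x.1 - r f * t, x.2) by fun_prop) (hB f))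
      · exact (measurableSet_lt measurable_const measurable_fst).inter
          ((show Measurable fun x : ℝ × 𝓠 => (x.1 - r f * t, x.2) by fun_prop) .univ)
      · exact hB f
      · exact .univ
    have hset : runClocks L r t ⁻¹' Set.pi s B ∩ {ω | ∀ f ∈ L, r f * t < (ω f).1}
        = Set.pi (s ∪ L : Finset ι) T := by
      ext ω
      simp only [mem_inter_iff, mem_preimage, Set.mem_pi, Finset.mem_coe, mem_ofPred_eq,
        Finset.mem_union, hT, runClocks]
      constructor
      · rintro ⟨h1, h2⟩ f -
        by_cases hfL : f ∈ L
        · simp only [hfL, if_true, mem_ofPred_eq]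
          refine ⟨h2 f hfL, ?_⟩
          split_ifs with hfs
          · simpa [hfL] using h1 f hfs
          · trivial
        · simp only [hfL, if_false]
          split_ifs with hfs
          · simpa [hfL] using h1 f hfs
          · trivial
      · intro h
        refine ⟨fun f hfs => ?_, fun f hfL => ?_⟩
        · have := h f (Or.inl hfs)
          by_cases hfL : f ∈ L
          · simp only [hfL, if_true, hfs, mem_ofPred_eq] at this ⊢
            exact this.2
          · simpa [hfL, hfs] using this
        · have := h f (Or.inr hfL)
          simp only [hfL, if_true, mem_ofPred_eq] at this
          exact this.1
    have hTmass : ∀ f, m (T f) = (if f ∈ L then ENNReal.ofReal (Real.exp (-(r f * t))) else 1) *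
        (if f ∈ s then m (B f) else 1) := by
      intro f
      have h1 : m (if f ∈ s then B f else univ) = if f ∈ s then m (B f) else 1 := by
        split_ifs
        · rfl
        · exact measure_univ
      by_cases hfL : f ∈ L
      · simp only [hT, hfL, if_true]
        rw [expMeasure_prod_apply_sub Q (mul_nonneg (hr f hfL) ht) (hB' f), h1]
      · simp only [hT, hfL, if_false, one_mul]
        exact h1
    rw [hset, Measure.infinitePi_pi _ fun f _ => hTm f]
    simp only [hTmass, Finset.prod_mul_distrib]
    rw [Finset.prod_ite_mem, Finset.prod_ite_mem, Finset.union_inter_cancel_left,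
      Finset.union_inter_cancel_right, ← hcprod, smul_eq_mul, ← mul_assoc,
      ENNReal.inv_mul_cancel hc0 hct, one_mul]
  have h1 : (μ.restrict {ω | ∀ f ∈ L, r f * t < (ω f).1}).map (runClocks L r t) = c • μ := by
    rw [← key, smul_smul, ENNReal.mul_inv_cancel hc0 hct, one_smul, key]
  have h2 := congrArg (fun ν => ν B) h1
  simp only [Measure.smul_apply, smul_eq_mul] at h2
  rw [Measure.map_apply hrun hB, Measure.restrict_apply (hrun hB)] at h2
  rw [← h2]
  congr 1
  ext ω
  exact and_comm

variable [MeasurableSpace (Option ι)]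

/-- The law of the datum and of the renewed clocks on the event that the clock `e` rings first. On
this event the other clocks have run for an exponential time, and by absence of memory their
remaining times are as good as new. -/
theorem infinitePi_apply_clock (Q : Measure 𝓠) [IsProbabilityMeasure Q] {L : Finset ι} {r : ι → ℝ}
    (hr : ∀ e ∈ L, 0 < r e) {cons : ι → 𝓠 → 𝓨 × ℝ × 𝓠} {χ : ι → Measure 𝓨}
    {e : ι} (he : e ∈ L) (hcm : Measurable (cons e)) [IsProbabilityMeasure (χ e)]
    (hcons : Q.map (cons e) = (χ e).prod ((expMeasure 1).prod Q))
    {S : Set ((ℝ × Option ι × 𝓨) × (ι → ℝ × 𝓠))} (hS : MeasurableSet S) :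
    (Measure.infinitePi fun _ : ι => (expMeasure 1).prod Q)
        {ω | (∀ f ∈ L.erase e, r f * ((r e)⁻¹ * (ω e).1) < (ω f).1) ∧
          (((r e)⁻¹ * (ω e).1, some e, (cons e (ω e).2).1),
            Function.update (runClocks (L.erase e) r ((r e)⁻¹ * (ω e).1) ω) e
              (cons e (ω e).2).2) ∈ S}
      = ENNReal.ofReal (r e / ∑ f ∈ L, r f) * ∫⁻ v, ∫⁻ y,
          (Measure.infinitePi fun _ : ι => (expMeasure 1).prod Q)
            (Prod.mk ((∑ f ∈ L, r f)⁻¹ * v, some e, y) ⁻¹' S) ∂χ e ∂expMeasure 1 := by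
  set m := (expMeasure 1).prod Q with hm
  set μ := Measure.infinitePi fun _ : ι => m with hμ
  set s := ∑ f ∈ L, r f with hs
  have hs0 : 0 < s := Finset.sum_pos hr ⟨e, he⟩
  have hre : 0 < r e := hr e he
  have hup := measurable_update_prod (X := ℝ × 𝓠) e
  -- the probability given the first time, the mark and the new clock
  set G : ℝ → 𝓨 × ℝ × 𝓠 → ℝ≥0∞ := fun t p =>
    μ {ω | ((t, some e, p.1), Function.update ω e p.2) ∈ S} with hG
  have hGm : Measurable fun p : ℝ × 𝓨 × ℝ × 𝓠 => G p.1 p.2 := by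
    have hmap : Measurable fun p : (ℝ × 𝓨 × ℝ × 𝓠) × (ι → ℝ × 𝓠) =>
        (((p.1.1, some e, p.1.2.1), Function.update p.2 e p.1.2.2) :
          (ℝ × Option ι × 𝓨) × (ι → ℝ × 𝓠)) := by
      refine Measurable.prodMk (by fun_prop) ?_
      exact hup.comp (show Measurable fun p : (ℝ × 𝓨 × ℝ × 𝓠) × (ι → ℝ × 𝓠) =>
        (p.1.2.2, p.2) by fun_prop)
    exact measurable_measure_prodMk_left (hmap hS)
  set F : ℝ → ℝ≥0∞ := fun t => ∫⁻ y, μ (Prod.mk (t, some e, y) ⁻¹' S) ∂χ e with hF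
  have hFm : Measurable F := by
    refine Measurable.lintegral_prod_right' (f := fun p : ℝ × 𝓨 =>
      μ (Prod.mk (p.1, some e, p.2) ⁻¹' S)) ?_
    exact (measurable_measure_prodMk_left hS).comp
      (show Measurable fun p : ℝ × 𝓨 => ((p.1, some e, p.2) : ℝ × Option ι × 𝓨) by fun_prop)
  -- resampling the clock `e` together with the others gives back the product measure
  have hGF : ∀ t, ∫⁻ q, G t (cons e q) ∂Q = F t := by
    intro t
    have hGt : Measurable (G t) := hGm.comp measurable_prodMk_left
    rw [← lintegral_map hGt hcm, hcons, lintegral_prod _ hGt.aemeasurable]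
    refine lintegral_congr fun y => ?_
    have hmap : Measurable fun p : (ℝ × 𝓠) × (ι → ℝ × 𝓠) =>
        (((t, some e, y), Function.update p.2 e p.1) : (ℝ × Option ι × 𝓨) × (ι → ℝ × 𝓠)) :=
      measurable_const.prodMk hup
    have h1 : (m.prod μ) ((fun p : (ℝ × 𝓠) × (ι → ℝ × 𝓠) =>
        (((t, some e, y), Function.update p.2 e p.1) : (ℝ × Option ι × 𝓨) × (ι → ℝ × 𝓠))) ⁻¹' S)
        = μ (Prod.mk (t, some e, y) ⁻¹' S) := by
      conv_rhs => rw [hμ, ← map_update_infinitePi m e, Measure.map_apply hup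
        (measurable_prodMk_left hS)]
      rfl
    rw [← h1, Measure.prod_apply (hmap hS)]
    rfl
  have hset : MeasurableSet {p : (ℝ × 𝓠) × (ι → ℝ × 𝓠) |
      (∀ f ∈ L.erase e, r f * ((r e)⁻¹ * p.1.1) < (p.2 f).1) ∧
        (((r e)⁻¹ * p.1.1, some e, (cons e p.1.2).1),
          Function.update (runClocks (L.erase e) r ((r e)⁻¹ * p.1.1) p.2) e
            (cons e p.1.2).2) ∈ S} := by
    refine MeasurableSet.inter ?_ ?_
    · have : {p : (ℝ × 𝓠) × (ι → ℝ × 𝓠) |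
          ∀ f ∈ L.erase e, r f * ((r e)⁻¹ * p.1.1) < (p.2 f).1}
          = ⋂ f ∈ L.erase e, {p | r f * ((r e)⁻¹ * p.1.1) < (p.2 f).1} := by
        ext p
        simp
      change MeasurableSet {p : (ℝ × 𝓠) × (ι → ℝ × 𝓠) |
          ∀ f ∈ L.erase e, r f * ((r e)⁻¹ * p.1.1) < (p.2 f).1}
      rw [this]
      exact Finset.measurableSet_biInter _ fun f _ =>
        measurableSet_lt (by fun_prop) (by fun_prop)
    · have hmap : Measurable fun p : (ℝ × 𝓠) × (ι → ℝ × 𝓠) =>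
          ((((r e)⁻¹ * p.1.1, some e, (cons e p.1.2).1),
          Function.update (runClocks (L.erase e) r ((r e)⁻¹ * p.1.1) p.2) e
            (cons e p.1.2).2) : (ℝ × Option ι × 𝓨) × (ι → ℝ × 𝓠)) := by
        refine Measurable.prodMk (by fun_prop) ?_
        refine hup.comp (Measurable.prodMk (by fun_prop) ?_)
        exact (measurable_runClocks (L.erase e) r).comp
          (show Measurable fun p : (ℝ × 𝓠) × (ι → ℝ × 𝓠) => ((r e)⁻¹ * p.1.1, p.2) by fun_prop)
      exact hmap hS
  conv_lhs => rw [hμ, ← map_update_infinitePi m e]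
  have hset' : MeasurableSet {ω : ι → ℝ × 𝓠 |
      (∀ f ∈ L.erase e, r f * ((r e)⁻¹ * (ω e).1) < (ω f).1) ∧
          (((r e)⁻¹ * (ω e).1, some e, (cons e (ω e).2).1),
            Function.update (runClocks (L.erase e) r ((r e)⁻¹ * (ω e).1) ω) e
              (cons e (ω e).2).2) ∈ S} :=
    (show Measurable fun ω : ι → ℝ × 𝓠 => (ω e, ω) by fun_prop) hset
  rw [Measure.map_apply hup hset']
  have hpre : (fun p : (ℝ × 𝓠) × (ι → ℝ × 𝓠) => Function.update p.2 e p.1) ⁻¹' {ω : ι → ℝ × 𝓠 |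
      (∀ f ∈ L.erase e, r f * ((r e)⁻¹ * (ω e).1) < (ω f).1) ∧
          (((r e)⁻¹ * (ω e).1, some e, (cons e (ω e).2).1),
            Function.update (runClocks (L.erase e) r ((r e)⁻¹ * (ω e).1) ω) e
              (cons e (ω e).2).2) ∈ S}
      = {p : (ℝ × 𝓠) × (ι → ℝ × 𝓠) |
      (∀ f ∈ L.erase e, r f * ((r e)⁻¹ * p.1.1) < (p.2 f).1) ∧
        (((r e)⁻¹ * p.1.1, some e, (cons e p.1.2).1),
          Function.update (runClocks (L.erase e) r ((r e)⁻¹ * p.1.1) p.2) e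
            (cons e p.1.2).2) ∈ S} := by
    ext ⟨x, ω⟩
    have h1 : ∀ f ∈ L.erase e, Function.update ω e x f = ω f := fun f hf =>
      Function.update_of_ne (Finset.ne_of_mem_erase hf) _ _
    have h2 : Function.update (runClocks (L.erase e) r ((r e)⁻¹ * x.1) (Function.update ω e x)) e
        (cons e x.2).2
        = Function.update (runClocks (L.erase e) r ((r e)⁻¹ * x.1) ω) e (cons e x.2).2 := by
      ext1 f
      by_cases hf : f = e
      · subst hf
        simp
      · simp only [Function.update_of_ne hf, runClocks]
    simp only [mem_preimage, mem_ofPred_eq, Function.update_self, h2]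
    refine and_congr_left fun _ => forall₂_congr fun f hf => ?_
    rw [h1 f hf]
  rw [hpre, Measure.prod_apply hset]
  have hsum : ∑ f ∈ L.erase e, r f = s - r e := by
    rw [hs, ← Finset.add_sum_erase L r he]
    ring
  have hinner : ∀ᵐ x ∂m, μ (Prod.mk x ⁻¹' {p : (ℝ × 𝓠) × (ι → ℝ × 𝓠) |
      (∀ f ∈ L.erase e, r f * ((r e)⁻¹ * p.1.1) < (p.2 f).1) ∧
        (((r e)⁻¹ * p.1.1, some e, (cons e p.1.2).1),
          Function.update (runClocks (L.erase e) r ((r e)⁻¹ * p.1.1) p.2) e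
            (cons e p.1.2).2) ∈ S})
      = ENNReal.ofReal (Real.exp (-((s - r e) * ((r e)⁻¹ * x.1)))) *
        G ((r e)⁻¹ * x.1) (cons e x.2) := by
    have hpos : ∀ᵐ x ∂m, 0 ≤ x.1 := by
      rw [hm]
      exact Measure.quasiMeasurePreserving_fst.ae expMeasure_one_ae_nonneg
    filter_upwards [hpos] with x hx
    have hB : MeasurableSet {ω : ι → ℝ × 𝓠 |
        (((r e)⁻¹ * x.1, some e, (cons e x.2).1), Function.update ω e (cons e x.2).2) ∈ S} := by
      have hmap : Measurable fun ω : ι → ℝ × 𝓠 =>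
          ((((r e)⁻¹ * x.1, some e, (cons e x.2).1), Function.update ω e (cons e x.2).2) :
            (ℝ × Option ι × 𝓨) × (ι → ℝ × 𝓠)) :=
        measurable_const.prodMk (hup.comp measurable_prodMk_left)
      exact hmap hS
    have := infinitePi_apply_runClocks Q (L.erase e) (r := r)
      (fun f hf => (hr f (Finset.mem_of_mem_erase hf)).le) (t := (r e)⁻¹ * x.1)
      (mul_nonneg (inv_nonneg.2 hre.le) hx) hB
    rw [hsum] at this
    exact this
  rw [lintegral_congr_ae hinner, hm, lintegral_prod _ (by
    refine Measurable.aemeasurable (Measurable.mul (by fun_prop) ?_)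
    exact hGm.comp (show Measurable fun x : ℝ × 𝓠 => ((r e)⁻¹ * x.1, cons e x.2) by fun_prop))]
  have h3 : ∀ z : ℝ, ∫⁻ q, ENNReal.ofReal (Real.exp (-((s - r e) * ((r e)⁻¹ * z)))) *
      G ((r e)⁻¹ * z) (cons e q) ∂Q
      = ENNReal.ofReal (Real.exp (-((s - r e) * ((r e)⁻¹ * z)))) * F ((r e)⁻¹ * z) := by
    intro z
    rw [lintegral_const_mul _ (show Measurable fun q => G ((r e)⁻¹ * z) (cons e q) from
      hGm.comp (show Measurable fun q : 𝓠 => ((r e)⁻¹ * z, cons e q) by fun_prop)), hGF]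
  simp only [h3]
  exact lintegral_expMeasure_one_race hre hs0 F hFm

variable [Inhabited 𝓨]

/-- The datum produced by competing clocks follows `clockLaw`, and the renewed clocks are
independent of it and have the original law. -/
theorem map_clock (Q : Measure 𝓠) [IsProbabilityMeasure Q] {L : Finset ι} (hL : L.Nonempty)
    {r : ι → ℝ} (hr : ∀ e ∈ L, 0 < r e) {cons : ι → 𝓠 → 𝓨 × ℝ × 𝓠} {χ : ι → Measure 𝓨}
    (hcm : ∀ e, Measurable (cons e)) (hχ : ∀ e ∈ L, IsProbabilityMeasure (χ e))
    (hcons : ∀ e ∈ L, Q.map (cons e) = (χ e).prod ((expMeasure 1).prod Q))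
    (hmeas : Measurable fun ω => (clockDatum L r cons ω, clockRenew L r cons ω)) :
    (Measure.infinitePi fun _ : ι => (expMeasure 1).prod Q).map
        (fun ω => (clockDatum L r cons ω, clockRenew L r cons ω))
      = (clockLaw L r χ).prod (Measure.infinitePi fun _ : ι => (expMeasure 1).prod Q) := by
  set μ := Measure.infinitePi fun _ : ι => (expMeasure 1).prod Q with hμ
  -- both sides are probability measures, so that one inequality suffices, and ties can be ignored
  have := isProbabilityMeasure_clockLaw hL hr χ hχ
  have : IsProbabilityMeasure (μ.map fun ω => (clockDatum L r cons ω, clockRenew L r cons ω)) :=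
    Measure.isProbabilityMeasure_map hmeas.aemeasurable
  symm
  refine Measure.eq_of_le_of_isProbabilityMeasure (Measure.le_iff.2 fun S hS => ?_)
  rw [Measure.map_apply hmeas hS]
  set A : ι → Set (ι → ℝ × 𝓠) := fun e =>
    {ω | (∀ f ∈ L.erase e, r f * ((r e)⁻¹ * (ω e).1) < (ω f).1) ∧
          (((r e)⁻¹ * (ω e).1, some e, (cons e (ω e).2).1),
            Function.update (runClocks (L.erase e) r ((r e)⁻¹ * (ω e).1) ω) e
              (cons e (ω e).2).2) ∈ S} with hA
  have hargmin : ∀ e ∈ L, ∀ ω ∈ A e,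
      strictArgmin L (fun e => (r e)⁻¹ * (ω e).1) = some e := by
    intro e he ω hω
    refine strictArgmin_eq_some_iff.2 ⟨he, fun f hf hfe => ?_⟩
    have h1 := hω.1 f (Finset.mem_erase.2 ⟨hfe, hf⟩)
    have h2 := hr f hf
    rw [lt_inv_mul_iff₀ h2]
    exact h1
  have hAm : ∀ e ∈ L, MeasurableSet (A e) := by
    intro e he
    refine MeasurableSet.inter ?_ ?_
    · have : {ω : ι → ℝ × 𝓠 | ∀ f ∈ L.erase e, r f * ((r e)⁻¹ * (ω e).1) < (ω f).1}
          = ⋂ f ∈ L.erase e, {ω | r f * ((r e)⁻¹ * (ω e).1) < (ω f).1} := by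
        ext p
        simp
      change MeasurableSet {ω : ι → ℝ × 𝓠 |
        ∀ f ∈ L.erase e, r f * ((r e)⁻¹ * (ω e).1) < (ω f).1}
      rw [this]
      exact Finset.measurableSet_biInter _ fun f _ =>
        measurableSet_lt (by fun_prop) (by fun_prop)
    · have hmap : Measurable fun ω : ι → ℝ × 𝓠 =>
          ((((r e)⁻¹ * (ω e).1, some e, (cons e (ω e).2).1),
          Function.update (runClocks (L.erase e) r ((r e)⁻¹ * (ω e).1) ω) e
            (cons e (ω e).2).2) : (ℝ × Option ι × 𝓨) × (ι → ℝ × 𝓠)) := by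
        have := hcm e
        refine Measurable.prodMk (by fun_prop) ?_
        refine (measurable_update_prod e).comp (Measurable.prodMk (by fun_prop) ?_)
        exact (measurable_runClocks (L.erase e) r).comp
          (show Measurable fun ω : ι → ℝ × 𝓠 => ((r e)⁻¹ * (ω e).1, ω) by fun_prop)
      exact hmap hS
  have hsub : (⋃ e ∈ L, A e) ⊆ (fun ω => (clockDatum L r cons ω, clockRenew L r cons ω)) ⁻¹' S := by
    refine iUnion₂_subset fun e he ω hω => ?_
    have h1 := hargmin e he ω hω
    have h2 := hω.2
    simp only [mem_preimage, clockDatum, clockRenew, h1]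
    exact h2
  have hdisj : (L : Set ι).PairwiseDisjoint A := by
    intro e he f hf hef
    refine Set.disjoint_left.2 fun ω hωe hωf => hef ?_
    have h1 := hargmin e he ω hωe
    rw [hargmin f hf ω hωf] at h1
    exact (Option.some_inj.1 h1).symm
  refine le_trans (le_of_eq ?_) (measure_mono hsub)
  rw [measure_biUnion_finset hdisj hAm, Measure.prod_apply hS, clockLaw,
    lintegral_finsetSum_measure]
  refine Finset.sum_congr rfl fun e he => ?_
  have := hχ e he
  rw [lintegral_smul_measure, hA, infinitePi_apply_clock Q hr he (hcm e) (hcons e he) hS,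
    smul_eq_mul]
  congr 1
  set g : ℝ × Option ι × 𝓨 → ℝ≥0∞ := fun d => μ (Prod.mk d ⁻¹' S) with hg
  have hf : Measurable g := measurable_measure_prodMk_left hS
  rw [lintegral_prod _ hf.aemeasurable, lintegral_map hf.lintegral_prod_right' (by fun_prop)]
  refine lintegral_congr fun v => ?_
  have hf' : Measurable fun p : Option ι × 𝓨 => g ((∑ f ∈ L, r f)⁻¹ * v, p) :=
    hf.comp measurable_prodMk_left
  rw [lintegral_prod _ hf'.aemeasurable, lintegral_dirac' _ hf'.lintegral_prod_right']

end Clocks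

end STIT

namespace STIT

/-! ### Rejection sampling -/

theorem measurable_sInf_nat {α : Type*} [MeasurableSpace α] {p : ℕ → α → Prop}
    (hp : ∀ k, MeasurableSet {x | p k x}) : Measurable fun x => sInf {k | p k x} := by
  refine measurable_to_countable' fun k => ?_
  have hset : (fun x => sInf {k | p k x}) ⁻¹' {k}
      = ({x | p k x} ∩ ⋂ j, ⋂ (_ : j < k), {x | p j x}ᶜ) ∪ ({_x | k = 0} ∩ ⋂ j, {x | p j x}ᶜ) := by
    ext x
    simp only [mem_preimage, mem_singleton_iff, mem_union, mem_inter_iff, mem_ofPred_eq,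
      mem_iInter, mem_compl_iff]
    constructor
    · rintro rfl
      by_cases h : {k | p k x}.Nonempty
      · exact Or.inl ⟨Nat.sInf_mem h, fun j hj => Nat.notMem_of_lt_sInf hj⟩
      · have h' := not_nonempty_iff_eq_empty.1 h
        exact Or.inr ⟨by rw [h', Nat.sInf_empty], fun j hj => h ⟨j, hj⟩⟩
    · rintro (⟨h1, h2⟩ | ⟨rfl, h⟩)
      · refine le_antisymm (Nat.sInf_le h1) ?_
        by_contra hlt
        exact h2 _ (not_le.1 hlt) (Nat.sInf_mem (s := {k | p k x}) ⟨k, h1⟩)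
      · have : {k | p k x} = ∅ := by
          ext j
          simp [h j]
        rw [this, Nat.sInf_empty]
  rw [hset]
  refine ((hp k).inter ?_).union ((MeasurableSet.const _).inter ?_)
  · exact MeasurableSet.iInter fun j => MeasurableSet.iInter fun _ => (hp j).compl
  · exact MeasurableSet.iInter fun j => (hp j).compl

section Rejection

variable {Y : Type*}

open Classical in
/-- The first term of the sequence `q` that lies in `A`; the default value if there is none. -/
def firstIn [Inhabited Y] (A : Set Y) (q : ℕ → Y) : Y :=
  if ∃ k, q k ∈ A then q (sInf {k | q k ∈ A}) else default

open Classical in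
/-- The terms of the sequence `q` after the first one that lies in `A`; a default sequence if there
is none. -/
def afterIn [Inhabited Y] (A : Set Y) (q : ℕ → Y) : ℕ → Y :=
  if ∃ k, q k ∈ A then fun n => q (sInf {k | q k ∈ A} + 1 + n) else fun _ => default

theorem sInf_eq_zero_of_mem {A : Set Y} {q : ℕ → Y} (h : q 0 ∈ A) : sInf {k | q k ∈ A} = 0 :=
  Nat.le_zero.1 (Nat.sInf_le h)

theorem sInf_eq_succ_of_notMem {A : Set Y} {q : ℕ → Y} (h : q 0 ∉ A) (hex : ∃ k, q (k + 1) ∈ A) :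
    sInf {k | q k ∈ A} = sInf {k | q (k + 1) ∈ A} + 1 := by
  have h1 : q (sInf {k | q (k + 1) ∈ A} + 1) ∈ A := Nat.sInf_mem (s := {k | q (k + 1) ∈ A}) hex
  refine le_antisymm (Nat.sInf_le h1) ?_
  have hne : {k | q k ∈ A}.Nonempty := ⟨_, h1⟩
  have h2 := Nat.sInf_mem hne
  rcases Nat.eq_zero_or_pos (sInf {k | q k ∈ A}) with h0 | h0
  · rw [h0] at h2
    exact absurd h2 h
  · obtain ⟨j, hj⟩ := Nat.exists_eq_succ_of_ne_zero h0.ne'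
    rw [hj] at h2 ⊢
    exact Nat.succ_le_succ (Nat.sInf_le h2)

theorem firstIn_of_mem [Inhabited Y] {A : Set Y} {q : ℕ → Y} (h : q 0 ∈ A) : firstIn A q = q 0 := by
  rw [firstIn, if_pos ⟨0, h⟩, sInf_eq_zero_of_mem h]

theorem afterIn_of_mem [Inhabited Y] {A : Set Y} {q : ℕ → Y} (h : q 0 ∈ A) :
    afterIn A q = fun n => q (n + 1) := by
  rw [afterIn, if_pos ⟨0, h⟩, sInf_eq_zero_of_mem h]
  simp only [zero_add, add_comm 1]

theorem exists_mem_succ_iff {A : Set Y} {q : ℕ → Y} (h : q 0 ∉ A) :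
    (∃ k, q k ∈ A) ↔ ∃ k, q (k + 1) ∈ A := by
  constructor
  · rintro ⟨k, hk⟩
    cases k with
    | zero => exact absurd hk h
    | succ k => exact ⟨k, hk⟩
  · rintro ⟨k, hk⟩
    exact ⟨k + 1, hk⟩

theorem firstIn_of_notMem [Inhabited Y] {A : Set Y} {q : ℕ → Y} (h : q 0 ∉ A) :
    firstIn A q = firstIn A fun n => q (n + 1) := by
  unfold firstIn
  by_cases hex : ∃ k, q (k + 1) ∈ A
  · rw [if_pos ((exists_mem_succ_iff h).2 hex), if_pos hex, sInf_eq_succ_of_notMem h hex]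
  · rw [if_neg (mt (exists_mem_succ_iff h).1 hex), if_neg hex]

theorem afterIn_of_notMem [Inhabited Y] {A : Set Y} {q : ℕ → Y} (h : q 0 ∉ A) :
    afterIn A q = afterIn A fun n => q (n + 1) := by
  unfold afterIn
  by_cases hex : ∃ k, q (k + 1) ∈ A
  · rw [if_pos ((exists_mem_succ_iff h).2 hex), if_pos hex, sInf_eq_succ_of_notMem h hex]
    ext1 n
    exact congrArg q (by ring)
  · rw [if_neg (mt (exists_mem_succ_iff h).1 hex), if_neg hex]

variable [MeasurableSpace Y]

theorem measurable_firstIn_afterIn [Inhabited Y] {α : Type*} [MeasurableSpace α] {A : α → Set Y}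
    (hA : MeasurableSet {p : α × Y | p.2 ∈ A p.1}) :
    Measurable fun p : α × (ℕ → Y) => (firstIn (A p.1) p.2, afterIn (A p.1) p.2) := by
  classical
  have hk : ∀ k, MeasurableSet {p : α × (ℕ → Y) | p.2 k ∈ A p.1} := fun k =>
    (show Measurable fun p : α × (ℕ → Y) => (p.1, p.2 k) by fun_prop) hA
  have hex : MeasurableSet {p : α × (ℕ → Y) | ∃ k, p.2 k ∈ A p.1} := by
    have : {p : α × (ℕ → Y) | ∃ k, p.2 k ∈ A p.1} = ⋃ k, {p | p.2 k ∈ A p.1} := by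
      ext p
      simp
    rw [this]
    exact MeasurableSet.iUnion hk
  have hs : Measurable fun p : α × (ℕ → Y) => sInf {k | p.2 k ∈ A p.1} := measurable_sInf_nat hk
  refine Measurable.prodMk ?_ ?_
  · unfold firstIn
    refine Measurable.ite hex ?_ measurable_const
    exact measurable_of_countable_cases hs (F := fun k (p : α × (ℕ → Y)) => p.2 k)
      fun k => by fun_prop
  · unfold afterIn
    refine Measurable.ite hex ?_ measurable_const
    exact measurable_of_countable_cases hs (F := fun k (p : α × (ℕ → Y)) n => p.2 (k + 1 + n))
      fun k => by fun_prop

theorem ae_exists_mem_infinitePi (ν : Measure Y) [IsProbabilityMeasure ν] {A : Set Y}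
    (hA : MeasurableSet A) (h0 : ν A ≠ 0) :
    ∀ᵐ q ∂Measure.infinitePi (fun _ : ℕ => ν), ∃ k, q k ∈ A := by
  set μ := Measure.infinitePi (fun _ : ℕ => ν) with hμ
  have hN : MeasurableSet {q : ℕ → Y | ∀ k, q k ∉ A} := by
    have : {q : ℕ → Y | ∀ k, q k ∉ A} = ⋂ k, {q | q k ∉ A} := by
      ext q
      simp
    rw [this]
    exact MeasurableSet.iInter fun k => (measurable_pi_apply k hA).compl
  have h1 : μ {q | ∀ k, q k ∉ A} = ν Aᶜ * μ {q | ∀ k, q k ∉ A} := by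
    rw [← Measure.prod_prod, hμ, ← map_head_tail_infinitePi,
      Measure.map_apply (by fun_prop) (hA.compl.prod (hN))]
    congr 1
    ext q
    simp only [mem_ofPred_eq, mem_preimage, mem_prod, mem_compl_iff]
    exact ⟨fun h => ⟨h 0, fun k => h (k + 1)⟩, fun h k => by cases k with
      | zero => exact h.1
      | succ k => exact h.2 k⟩
  have hlt : ν Aᶜ < 1 := by
    rw [prob_compl_eq_one_sub hA]
    exact ENNReal.sub_lt_self ENNReal.one_ne_top one_ne_zero h0
  have hz : μ {q | ∀ k, q k ∉ A} = 0 := by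
    by_contra hne
    have h2 : ν Aᶜ * μ {q | ∀ k, q k ∉ A} < 1 * μ {q | ∀ k, q k ∉ A} := by
      rw [mul_comm, mul_comm 1]
      exact ENNReal.mul_lt_mul_right hne (measure_ne_top μ _) hlt
    rw [one_mul, ← h1] at h2
    exact lt_irrefl _ h2
  rw [ae_iff]
  simpa using hz

/-- Rejection sampling from an i.i.d. sequence produces the conditional law and leaves an
independent i.i.d. sequence of the same kind. -/
theorem map_firstIn_afterIn [Inhabited Y] (ν : Measure Y) [IsProbabilityMeasure ν] {A : Set Y}
    (hA : MeasurableSet A) (h0 : ν A ≠ 0) :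
    (Measure.infinitePi fun _ : ℕ => ν).map (fun q => (firstIn A q, afterIn A q))
      = ((ν A)⁻¹ • ν.restrict A).prod (Measure.infinitePi fun _ : ℕ => ν) := by
  set μ := Measure.infinitePi (fun _ : ℕ => ν) with hμ
  have h0' := (measurable_firstIn_afterIn (α := Unit) (A := fun _ => A)
    (measurable_snd hA)).comp (measurable_prodMk_left (x := ()))
  have hm : Measurable fun q : ℕ → Y => (firstIn A q, afterIn A q) := h0'
  have : SigmaFinite ((ν A)⁻¹ • ν.restrict A) := by
    have : IsFiniteMeasure ((ν A)⁻¹ • ν.restrict A) :=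
      Measure.smul_finite _ (ENNReal.inv_ne_top.2 h0)
    infer_instance
  symm
  refine Measure.prod_eq fun B D hB hD => ?_
  rw [Measure.map_apply hm (hB.prod hD)]
  set E := (fun q : ℕ → Y => (firstIn A q, afterIn A q)) ⁻¹' B ×ˢ D with hE
  have hEm : MeasurableSet E := hm (hB.prod hD)
  -- condition on the first term
  have h1 : μ E = ν (B ∩ A) * μ D + ν Aᶜ * μ E := by
    have hset : E = (fun q : ℕ → Y => (q 0, fun n => q (n + 1))) ⁻¹'
        ((B ∩ A) ×ˢ D ∪ Aᶜ ×ˢ E) := by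
      ext q
      simp only [hE, mem_preimage, mem_prod, mem_union, mem_inter_iff, mem_compl_iff]
      by_cases hq : q 0 ∈ A
      · simp [hq, firstIn_of_mem hq, afterIn_of_mem hq]
      · simp [hq, firstIn_of_notMem hq, afterIn_of_notMem hq]
    conv_lhs => rw [hset]
    rw [← Measure.map_apply (by fun_prop) (((hB.inter hA).prod hD).union (hA.compl.prod hEm)),
      hμ, map_head_tail_infinitePi, measure_union _ (hA.compl.prod (hEm)),
      Measure.prod_prod, Measure.prod_prod]
    refine Set.disjoint_left.2 ?_
    rintro ⟨y, q⟩ h2 h3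
    exact h3.1 h2.1.2
  have h2 : ν A * μ E = ν (B ∩ A) * μ D := by
    have h3 : ν A * μ E + ν Aᶜ * μ E = ν (B ∩ A) * μ D + ν Aᶜ * μ E := by
      rw [← add_mul, measure_add_measure_compl hA, measure_univ, one_mul, ← h1]
    exact (ENNReal.add_left_inj (ENNReal.mul_ne_top (measure_ne_top _ _)
      (measure_ne_top _ _))).1 h3
  rw [Measure.smul_apply, Measure.restrict_apply hB, smul_eq_mul, mul_assoc, ← h2, ← mul_assoc,
    ENNReal.inv_mul_cancel h0 (measure_ne_top _ _), one_mul]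

end Rejection

/-! ### Hyperplane laws of the cells -/

variable {ℓ : ℕ}

theorem IsHyperplaneMeasure.isProbabilityMeasure_normalized {Λ : Measure (Hyp ℓ)}
    (hΛ : IsHyperplaneMeasure Λ) {C : Set (Space ℓ)} (hC : IsCompact C)
    (hne : (interior C).Nonempty) : IsProbabilityMeasure (normalized Λ C) := by
  constructor
  rw [normalized, Measure.smul_apply, Measure.restrict_apply_univ, smul_eq_mul,
    ENNReal.inv_mul_cancel (hΛ.hit_pos hne).ne' (hΛ.hit_lt_top hC).ne]

theorem IsHyperplaneMeasure.isProbabilityMeasure_window {Λ : Measure (Hyp ℓ)}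
    (hΛ : IsHyperplaneMeasure Λ) (W : Window ℓ) :
    IsProbabilityMeasure (normalized Λ W.carrier) :=
  hΛ.isProbabilityMeasure_normalized W.isCompact W.isCell.2

theorem IsHyperplaneMeasure.normalized_window_apply {Λ : Measure (Hyp ℓ)} (W : Window ℓ)
    {C : Set (Space ℓ)} (hCW : C ⊆ W.carrier) {B : Set (Hyp ℓ)} (hB : B ⊆ hit C) :
    normalized Λ W.carrier B = (Λ (hit W.carrier))⁻¹ * Λ B := by
  rw [normalized, Measure.smul_apply, smul_eq_mul,
    Measure.restrict_eq_self _ (hB.trans (hit_mono hCW))]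

/-- Conditioning the normalized measure of the window to hit a smaller cell. -/
theorem IsHyperplaneMeasure.condition_normalized {Λ : Measure (Hyp ℓ)}
    (hΛ : IsHyperplaneMeasure Λ) (W : Window ℓ) {C : Set (Space ℓ)} (hC : IsCompact C)
    (hCW : C ⊆ W.carrier) :
    (normalized Λ W.carrier (hit C))⁻¹ • (normalized Λ W.carrier).restrict (hit C)
      = normalized Λ C := by
  have hm := (isClosed_hit hC).measurableSet
  ext B hB
  have hW0 : Λ (hit W.carrier) ≠ 0 := (hΛ.hit_pos W.isCell.2).ne'
  have hWt : Λ (hit W.carrier) ≠ ∞ := (hΛ.hit_lt_top W.isCompact).ne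
  rw [Measure.smul_apply, Measure.restrict_apply hB, normalized_window_apply W hCW subset_rfl,
    normalized_window_apply W hCW inter_subset_right, normalized, Measure.smul_apply,
    Measure.restrict_apply hB, smul_eq_mul, smul_eq_mul,
    ENNReal.mul_inv (Or.inl (ENNReal.inv_ne_zero.2 hWt)) (Or.inl (ENNReal.inv_ne_top.2 hW0)),
    inv_inv, mul_assoc, mul_left_comm, ← mul_assoc (Λ (hit W.carrier)),
    ENNReal.mul_inv_cancel hW0 hWt, one_mul]

theorem IsHyperplaneMeasure.normalized_window_ne_zero {Λ : Measure (Hyp ℓ)}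
    (hΛ : IsHyperplaneMeasure Λ) (W : Window ℓ) {C : Set (Space ℓ)} (hCW : C ⊆ W.carrier)
    (hne : (interior C).Nonempty) : normalized Λ W.carrier (hit C) ≠ 0 := by
  rw [normalized_window_apply W hCW subset_rfl]
  exact mul_ne_zero (ENNReal.inv_ne_zero.2 (hΛ.hit_lt_top W.isCompact).ne) (hΛ.hit_pos hne).ne'

theorem IsHyperplaneMeasure.ae_normalized {Λ : Measure (Hyp ℓ)} (hΛ : IsHyperplaneMeasure Λ)
    {C : Set (Space ℓ)} (hC : IsCompact C) (hconv : Convex ℝ C) (hne : (interior C).Nonempty) :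
    ∀ᵐ h ∂normalized Λ C, h ∈ hit (interior C) := by
  have h1 : ∀ᵐ h ∂Λ.restrict (hit C), h ∈ hit (interior C) := by
    rw [ae_restrict_iff' (isClosed_hit hC).measurableSet, ae_iff]
    convert hΛ.measure_hit_diff_hit_interior hC hconv hne using 2
    ext h
    simp
  exact Measure.ae_smul_measure h1 _

theorem IsHyperplaneMeasure.measurable_hit_pathCell {Λ : Measure (Hyp ℓ)}
    (hΛ : IsHyperplaneMeasure Λ) (W : Window ℓ) (e : Word) :
    Measurable fun H : Word → Hyp ℓ => Λ (hit (pathCell W.carrier H e)) := by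
  have hfin : IsFiniteMeasure (Λ.restrict (hit W.carrier)) :=
    ⟨by rw [Measure.restrict_apply_univ]; exact hΛ.hit_lt_top W.isCompact⟩
  have h1 := measurable_measure_prodMk_left (ν := Λ.restrict (hit W.carrier))
    (measurableSet_mem_hit_pathCell W e)
  convert h1 using 2 with H
  exact (Measure.restrict_eq_self _ (hit_mono (pathCell_subset _ H e))).symm

/-- The supply attached to a word: a sequence of hyperplanes, used for rejection sampling,
and a sequence of lifetimes, used to replace clocks that have rung. -/
abbrev Supply (ℓ : ℕ) := (ℕ → Hyp ℓ) × (ℕ → ℝ)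

/-- The law of the supply. -/
def supplyLaw (Λ : Measure (Hyp ℓ)) (W : Window ℓ) : Measure (Supply ℓ) :=
  (Measure.infinitePi fun _ : ℕ => normalized Λ W.carrier).prod
    (Measure.infinitePi fun _ : ℕ => expMeasure 1)

/-- The law of all clocks and supplies. -/
def clockSource (Λ : Measure (Hyp ℓ)) (W : Window ℓ) : Measure (Word → ℝ × Supply ℓ) :=
  Measure.infinitePi fun _ => (expMeasure 1).prod (supplyLaw Λ W)

theorem IsHyperplaneMeasure.isProbabilityMeasure_supplyLaw {Λ : Measure (Hyp ℓ)}
    (hΛ : IsHyperplaneMeasure Λ) (W : Window ℓ) : IsProbabilityMeasure (supplyLaw Λ W) := by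
  have := hΛ.isProbabilityMeasure_window W
  unfold supplyLaw
  infer_instance

theorem IsHyperplaneMeasure.isProbabilityMeasure_clockSource {Λ : Measure (Hyp ℓ)}
    (hΛ : IsHyperplaneMeasure Λ) (W : Window ℓ) : IsProbabilityMeasure (clockSource Λ W) := by
  have := hΛ.isProbabilityMeasure_supplyLaw W
  unfold clockSource
  infer_instance

theorem measurable_strictArgmin {α : Type*} [MeasurableSpace α] (L : Finset Word)
    {ρ : α → Word → ℝ} (hρ : ∀ e, Measurable fun a => ρ a e) :
    Measurable fun a => strictArgmin L (ρ a) := by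
  have hsome : ∀ e, MeasurableSet {a | strictArgmin L (ρ a) = some e} := by
    intro e
    simp only [strictArgmin_eq_some_iff]
    refine (MeasurableSet.const (e ∈ L)).inter ?_
    have : {a | ∀ f ∈ L, f ≠ e → ρ a e < ρ a f}
        = ⋂ f ∈ L, {a | f ≠ e → ρ a e < ρ a f} := by
      ext a
      simp
    change MeasurableSet {a | ∀ f ∈ L, f ≠ e → ρ a e < ρ a f}
    rw [this]
    refine L.measurableSet_biInter fun f _ => ?_
    by_cases hf : f = e
    · simp [hf]
    · simpa [hf] using measurableSet_lt (hρ e) (hρ f)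
  refine measurable_to_countable' fun o => ?_
  cases o with
  | some e => exact hsome e
  | none =>
    have : (fun a => strictArgmin L (ρ a)) ⁻¹' {none}
        = (⋃ e, {a | strictArgmin L (ρ a) = some e})ᶜ := by
      ext a
      simp only [mem_preimage, mem_singleton_iff, mem_compl_iff, mem_iUnion, mem_ofPred_eq]
      cases strictArgmin L (ρ a) <;> simp
    rw [this]
    exact (MeasurableSet.iUnion hsome).compl

theorem ae_clockLaw {L : Finset Word} {r : Word → ℝ} {χ : Word → Measure (Hyp ℓ)}
    (hχ : ∀ e ∈ L, IsProbabilityMeasure (χ e)) {p : Word → Hyp ℓ → Prop}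
    (h : ∀ e ∈ L, ∀ᵐ y ∂χ e, p e y) :
    ∀ᵐ d ∂clockLaw L r χ, ∃ e ∈ L, d.2.1 = some e ∧ p e d.2.2 := by
  rw [ae_iff, clockLaw, Measure.finsetSum_apply]
  refine Finset.sum_eq_zero fun e he => ?_
  have := hχ e he
  rw [← ae_iff]
  refine Measure.ae_smul_measure ?_ _
  have h1 : ∀ᵐ q ∂(Measure.dirac (some e)).prod (χ e), q.1 = some e ∧ p e q.2 :=
    (Measure.quasiMeasurePreserving_fst.ae
      ((ae_dirac_iff (p := fun o : Option Word => o = some e) MeasurableSet.of_discrete).2 rfl)).and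
      (Measure.quasiMeasurePreserving_snd.ae (h e he))
  filter_upwards [Measure.quasiMeasurePreserving_snd.ae h1] with d hd
  exact ⟨e, he, hd⟩

/-! ### The chain of competing clocks -/

section ClockSystem

variable [Inhabited (Hyp ℓ)]

/-- The rate at which the cell of the word `e` is divided, given the first `n` jumps of `S`. -/
def rate (Λ : Measure (Hyp ℓ)) (W : Window ℓ) (n : ℕ) (S : ℕ → Datum ℓ) (e : Word) : ℝ :=
  (Λ (hit (pathCell W.carrier (hypMap S n) e))).toReal

theorem IsHyperplaneMeasure.measurable_rate {Λ : Measure (Hyp ℓ)} (hΛ : IsHyperplaneMeasure Λ)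
    (W : Window ℓ) (n : ℕ) (e : Word) : Measurable fun S => rate Λ W n S e :=
  ((hΛ.measurable_hit_pathCell W e).comp (measurable_hypMap n)).ennreal_toReal

theorem IsHyperplaneMeasure.rate_pos {Λ : Measure (Hyp ℓ)} (hΛ : IsHyperplaneMeasure Λ)
    {W : Window ℓ} {n : ℕ} {S : ℕ → Datum ℓ} (hS : Good W n S) {e : Word} (he : e ∈ leaves S n) :
    0 < rate Λ W n S e :=
  ENNReal.toReal_pos (hΛ.hit_pos (hS e he)).ne' (hΛ.hit_lt_top (isCompact_pathCell _ _ _)).ne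

/-- Draw from the supply a hyperplane hitting `C` and a new lifetime. -/
def consume (C : Set (Space ℓ)) (q : Supply ℓ) : Hyp ℓ × ℝ × Supply ℓ :=
  (firstIn (hit C) q.1, q.2 0, afterIn (hit C) q.1, fun n => q.2 (n + 1))

theorem measurable_consume {α : Type*} [MeasurableSpace α] {C : α → Set (Space ℓ)}
    (hC : MeasurableSet {p : α × Hyp ℓ | p.2 ∈ hit (C p.1)}) :
    Measurable fun p : α × Supply ℓ => consume (C p.1) p.2 := by
  have h0 := measurable_firstIn_afterIn (A := fun a => hit (C a)) hC
  have h1 := h0.comp (show Measurable fun p : α × Supply ℓ => (p.1, p.2.1) by fun_prop)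
  have h2 : Measurable fun p : α × Supply ℓ => p.2.2 0 := by fun_prop
  have h3 : Measurable fun (p : α × Supply ℓ) (n : ℕ) => p.2.2 (n + 1) := by fun_prop
  have h4 := measurable_fst.comp h1
  have h5 := measurable_snd.comp h1
  have h6 := h4.prodMk (h2.prodMk (h5.prodMk h3))
  exact h6

/-- The hyperplane drawn from the supply has the normalized law of the cell, and is independent of
the new lifetime and of the renewed supply. -/
theorem IsHyperplaneMeasure.map_consume {Λ : Measure (Hyp ℓ)} (hΛ : IsHyperplaneMeasure Λ)
    (W : Window ℓ) {C : Set (Space ℓ)} (hC : IsCompact C) (hCW : C ⊆ W.carrier)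
    (hne : (interior C).Nonempty) :
    (supplyLaw Λ W).map (consume C)
      = (normalized Λ C).prod ((expMeasure 1).prod (supplyLaw Λ W)) := by
  have := hΛ.isProbabilityMeasure_window W
  have := hΛ.isProbabilityMeasure_normalized hC hne
  have hm := (isClosed_hit hC).measurableSet
  set N := Measure.infinitePi fun _ : ℕ => normalized Λ W.carrier with hN
  set E := Measure.infinitePi fun _ : ℕ => expMeasure 1 with hE
  have h1 : MeasurePreserving (fun q : ℕ → Hyp ℓ => (firstIn (hit C) q, afterIn (hit C) q)) N
      ((normalized Λ C).prod N) := by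
    have h0 := (measurable_firstIn_afterIn (α := Unit) (A := fun _ => hit C)
      (measurable_snd hm)).comp (measurable_prodMk_left (x := ()))
    refine ⟨h0, ?_⟩
    rw [hN, map_firstIn_afterIn _ hm (hΛ.normalized_window_ne_zero W hCW hne),
      hΛ.condition_normalized W hC hCW]
  have h2 : MeasurePreserving (fun q : ℕ → ℝ => (q 0, fun n => q (n + 1))) E
      ((expMeasure 1).prod E) := ⟨by fun_prop, map_head_tail_infinitePi _⟩
  have h3 := h1.prod h2
  have h4 := measurePreserving_prodAssoc (normalized Λ C) N ((expMeasure 1).prod E)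
  have h5 : MeasurePreserving (fun p : (ℕ → Hyp ℓ) × ℝ × (ℕ → ℝ) => (p.2.1, p.1, p.2.2))
      (N.prod ((expMeasure 1).prod E)) ((expMeasure 1).prod (N.prod E)) := by
    have h6 := (measurePreserving_prodAssoc N (expMeasure 1) E).symm
    have h7 := (Measure.measurePreserving_swap (μ := N) (ν := expMeasure 1)).prod
      (MeasurePreserving.id E)
    have h8 := measurePreserving_prodAssoc (expMeasure 1) N E
    exact h8.comp (h7.comp h6)
  have h6 := (((MeasurePreserving.id (normalized Λ C)).prod h5).comp (h4.comp h3)).map_eq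
  exact h6

/-- The data of the chain of competing clocks. -/
def clockD (Λ : Measure (Hyp ℓ)) (W : Window ℓ) (n : ℕ)
    (p : (ℕ → Datum ℓ) × (Word → ℝ × Supply ℓ)) : Datum ℓ :=
  clockDatum (leaves p.1 n) (rate Λ W n p.1)
    (fun e => consume (pathCell W.carrier (hypMap p.1 n) e)) p.2

/-- The renewal of the clocks in the chain of competing clocks. -/
def clockR (Λ : Measure (Hyp ℓ)) (W : Window ℓ) (n : ℕ)
    (p : (ℕ → Datum ℓ) × (Word → ℝ × Supply ℓ)) : Word → ℝ × Supply ℓ :=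
  clockRenew (leaves p.1 n) (rate Λ W n p.1)
    (fun e => consume (pathCell W.carrier (hypMap p.1 n) e)) p.2

theorem measurable_clockDatum_clockRenew {α 𝓠 𝓨 : Type*} [MeasurableSpace α] [MeasurableSpace 𝓠]
    [MeasurableSpace 𝓨] [Inhabited 𝓨] {E : α → Finset Word} (hE : Measurable E)
    {r : α → Word → ℝ} (hr : ∀ e, Measurable fun a => r a e) {cons : α → Word → 𝓠 → 𝓨 × ℝ × 𝓠}
    (hcons : ∀ e, Measurable fun p : α × 𝓠 => cons p.1 e p.2) :
    Measurable fun p : α × (Word → ℝ × 𝓠) =>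
      (clockDatum (E p.1) (r p.1) (cons p.1) p.2, clockRenew (E p.1) (r p.1) (cons p.1) p.2) := by
  have hr' : ∀ e, Measurable fun p : α × (Word → ℝ × 𝓠) => r p.1 e :=
    fun e => (hr e).comp measurable_fst
  have hc : ∀ e, Measurable fun p : α × (Word → ℝ × 𝓠) => cons p.1 e (p.2 e).2 := fun e =>
    (hcons e).comp (show Measurable fun p : α × (Word → ℝ × 𝓠) => (p.1, (p.2 e).2) by fun_prop)
  have hρ : ∀ e, Measurable fun p : α × (Word → ℝ × 𝓠) => (r p.1 e)⁻¹ * (p.2 e).1 :=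
    fun e => (hr' e).inv.mul (by fun_prop)
  refine measurable_of_countable_cases (hE.comp measurable_fst)
    (F := fun L (p : α × (Word → ℝ × 𝓠)) =>
      (clockDatum L (r p.1) (cons p.1) p.2, clockRenew L (r p.1) (cons p.1) p.2)) fun L => ?_
  set D : Option Word → α × (Word → ℝ × 𝓠) → ℝ × Option Word × 𝓨 := fun o p =>
    match o with
    | some e => ((r p.1 e)⁻¹ * (p.2 e).1, some e, (cons p.1 e (p.2 e).2).1)
    | none => (0, none, default) with hD
  set R : Option Word → α × (Word → ℝ × 𝓠) → (Word → ℝ × 𝓠) := fun o p =>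
    match o with
    | some e => Function.update (runClocks (L.erase e) (r p.1) ((r p.1 e)⁻¹ * (p.2 e).1) p.2) e
        (cons p.1 e (p.2 e).2).2
    | none => p.2 with hR
  have hDm : ∀ o, Measurable (D o) := by
    intro o
    cases o with
    | none => exact measurable_const
    | some e => exact (hρ e).prodMk (measurable_const.prodMk (measurable_fst.comp (hc e)))
  have hRm : ∀ o, Measurable (R o) := by
    intro o
    cases o with
    | none => exact measurable_snd
    | some e =>
      have h1 : Measurable fun p : α × (Word → ℝ × 𝓠) =>
          runClocks (L.erase e) (r p.1) ((r p.1 e)⁻¹ * (p.2 e).1) p.2 := by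
        refine measurable_pi_iff.2 fun f => ?_
        by_cases hf : f ∈ L.erase e
        · simp only [runClocks, hf, if_true]
          exact Measurable.prodMk (Measurable.sub (by fun_prop) ((hr' f).mul (hρ e)))
            (by fun_prop)
        · simp only [runClocks, hf, if_false]
          fun_prop
      have h2 := (measurable_update_prod e).comp ((measurable_snd.comp (hc e)).prodMk h1)
      exact h2
  have ho := measurable_strictArgmin L hρ
  have h1 := (measurable_of_countable_cases ho hDm).prodMk (measurable_of_countable_cases ho hRm)
  convert h1 using 2 with p
  cases h : strictArgmin L fun e => (r p.1 e)⁻¹ * (p.2 e).1 <;>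
    simp [clockDatum, clockRenew, hD, hR, h]

theorem IsHyperplaneMeasure.measurable_clock {Λ : Measure (Hyp ℓ)} (hΛ : IsHyperplaneMeasure Λ)
    (W : Window ℓ) (n : ℕ) :
    Measurable fun p => ((clockD Λ W n p, clockR Λ W n p) : Datum ℓ × (Word → ℝ × Supply ℓ)) :=
  measurable_clockDatum_clockRenew (measurable_leaves n) (hΛ.measurable_rate W n)
    (cons := fun S e => consume (pathCell W.carrier (hypMap S n) e)) fun e =>
    measurable_consume (α := ℕ → Datum ℓ) (C := fun S => pathCell W.carrier (hypMap S n) e)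
      ((((measurable_hypMap n).comp measurable_fst).prodMk measurable_snd)
        (measurableSet_mem_hit_pathCell W e))

/-- The conditional law of a jump, given the first `n` jumps of `S`: the holding time is exponential
with the total rate, the divided cell is chosen proportionally to the rates, and the dividing
hyperplane follows the normalized measure of this cell. -/
def jumpLaw (Λ : Measure (Hyp ℓ)) (W : Window ℓ) (n : ℕ) (S : ℕ → Datum ℓ) : Measure (Datum ℓ) :=
  clockLaw (leaves S n) (rate Λ W n S) fun e => normalized Λ (pathCell W.carrier (hypMap S n) e)

/-- Conditionally on a good history, the next datum follows `jumpLaw`, and the clocks renew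
themselves. -/
theorem IsHyperplaneMeasure.map_clockD_clockR {Λ : Measure (Hyp ℓ)} (hΛ : IsHyperplaneMeasure Λ)
    {W : Window ℓ} {n : ℕ} {S : ℕ → Datum ℓ} (hS : Good W n S) :
    (clockSource Λ W).map (fun ω => (clockD Λ W n (S, ω), clockR Λ W n (S, ω)))
      = (jumpLaw Λ W n S).prod (clockSource Λ W) := by
  have := hΛ.isProbabilityMeasure_supplyLaw W
  have hcm : ∀ e, Measurable (consume (pathCell W.carrier (hypMap S n) e)) := by
    intro e
    have h1 := (measurable_consume (α := Unit) (C := fun _ => pathCell W.carrier (hypMap S n) e)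
      (measurable_snd (measurableSet_hit_pathCell W _ e))).comp (measurable_prodMk_left (x := ()))
    exact h1
  have hmeas := (hΛ.measurable_clock W n).comp (measurable_prodMk_left (x := S))
  exact map_clock (supplyLaw Λ W) (isLeafSet_leaves S n).nonempty
    (fun e he => hΛ.rate_pos hS he) hcm
    (fun e he => hΛ.isProbabilityMeasure_normalized (isCompact_pathCell _ _ _) (hS e he))
    (fun e he => hΛ.map_consume W (isCompact_pathCell _ _ _) (pathCell_subset _ _ _) (hS e he))
    hmeas

/-- In the first `n` jumps of the history, a cell is divided each time, and all cells that appear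
have interior points. -/
def Proper (W : Window ℓ) (n : ℕ) (S : ℕ → Datum ℓ) : Prop :=
  Good W n S ∧ ∀ j < n, ∃ e ∈ leaves S j, (S j).2.1 = some e

theorem good_congr {W : Window ℓ} {n : ℕ} {d d' : ℕ → Datum ℓ} (h : ∀ j < n, d j = d' j) :
    Good W n d ↔ Good W n d' := by
  rw [Good, Good, leaves_congr h, hypMap_congr h]

theorem Proper.extend {W : Window ℓ} {n : ℕ} {S : ℕ → Datum ℓ} (hS : Proper W n S) {d : Datum ℓ}
    (hd : ∃ e ∈ leaves S n, d.2.1 = some e ∧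
      d.2.2 ∈ hit (interior (pathCell W.carrier (hypMap S n) e))) :
    Proper W (n + 1) (Function.update S n d) := by
  obtain ⟨e, he, hde, hh⟩ := hd
  have hcongr : ∀ m ≤ n, ∀ j < m, Function.update S n d j = S j := fun m hm j hj =>
    Function.update_of_ne (by omega) _ _
  constructor
  · rw [Good, leaves, hypMap, Function.update_self, leaves_congr (hcongr n le_rfl),
      hypMap_congr (hcongr n le_rfl), hde]
    exact hS.1.split (isLeafSet_leaves S n) he hh
  · intro j hj
    rw [leaves_congr (hcongr j (by omega))]
    rcases Nat.lt_succ_iff_lt_or_eq.1 hj with hj | rfl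
    · rw [Function.update_of_ne hj.ne]
      exact hS.2 j hj
    · exact ⟨e, he, by rw [Function.update_self, hde]⟩

theorem measurableSet_proper (W : Window ℓ) (n : ℕ) :
    MeasurableSet {S : ℕ → Datum ℓ | Proper W n S} := by
  refine (measurableSet_good W n).inter ?_
  have : {S : ℕ → Datum ℓ | ∀ j < n, ∃ e ∈ leaves S j, (S j).2.1 = some e}
      = ⋂ j, ⋂ (_ : j < n), {S | ∃ e ∈ leaves S j, (S j).2.1 = some e} := by
    ext S
    simp
  change MeasurableSet {S : ℕ → Datum ℓ | ∀ j < n, ∃ e ∈ leaves S j, (S j).2.1 = some e}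
  rw [this]
  refine MeasurableSet.iInter fun j => MeasurableSet.iInter fun _ => ?_
  have h1 : Measurable fun S : ℕ → Datum ℓ => (leaves S j, (S j).2.1) :=
    (measurable_leaves j).prodMk (by fun_prop)
  exact h1 (MeasurableSet.of_discrete (s := {p : Finset Word × Option Word |
    ∃ e ∈ p.1, p.2 = some e}))

theorem proper_zero (W : Window ℓ) (S : ℕ → Datum ℓ) : Proper W 0 S := by
  refine ⟨fun e he => ?_, fun j hj => absurd hj (Nat.not_lt_zero j)⟩
  rw [leaves, Finset.mem_singleton] at he
  rw [he, pathCell_nil]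
  exact W.isCell.2

/-- A jump almost surely divides a cell by a hyperplane that hits its interior. -/
theorem IsHyperplaneMeasure.ae_jumpLaw {Λ : Measure (Hyp ℓ)} (hΛ : IsHyperplaneMeasure Λ)
    {W : Window ℓ} {n : ℕ} {S : ℕ → Datum ℓ} (hS : Proper W n S) :
    ∀ᵐ d ∂jumpLaw Λ W n S, Proper W (n + 1) (Function.update S n d) := by
  have h1 := ae_clockLaw (L := leaves S n) (r := rate Λ W n S)
    (χ := fun e => normalized Λ (pathCell W.carrier (hypMap S n) e))
    (p := fun e h => h ∈ hit (interior (pathCell W.carrier (hypMap S n) e)))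
    (fun e he => hΛ.isProbabilityMeasure_normalized (isCompact_pathCell _ _ _) (hS.1 e he))
    fun e he => hΛ.ae_normalized (isCompact_pathCell _ _ _) (convex_pathCell _ _ _) (hS.1 e he)
  filter_upwards [h1] with d hd
  exact hS.extend hd

end ClockSystem

end STIT

namespace STIT

/-! ### Selection of a cell by a uniform variable -/

open Classical in
/-- The number of words in `L` that are smaller than `e`. -/
def wordRank (L : Finset Word) (e : Word) : ℕ := (L.filter fun e' => wlt e' e).card

open Classical in
/-- The word whose interval contains `u`, when `[0,1)` is divided into consecutive intervals of
equal length, indexed in increasing order by the words in `L`. -/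
def selectWord (L : Finset Word) (u : ℝ) : Option Word :=
  if h : ∃ e, e ∈ L ∧
    u ∈ Ico ((wordRank L e : ℝ) / L.card) (((wordRank L e : ℝ) + 1) / L.card) then some h.choose
  else none

theorem wlt_trans {e e' e'' : Word} (h : wlt e e') (h' : wlt e' e'') : wlt e e'' := by
  rw [wlt, List.shortlex_def] at *
  rcases h with h | ⟨h1, h2⟩ <;> rcases h' with h' | ⟨h1', h2'⟩
  · exact Or.inl (h.trans h')
  · exact Or.inl (by omega)
  · exact Or.inl (by omega)
  · exact Or.inr ⟨h1.trans h1', lt_trans (show e < e' from h2) h2'⟩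

theorem wlt_irrefl (e : Word) : ¬ wlt e e := wlt_wf.irrefl.irrefl e

theorem wlt_trichotomy (e e' : Word) : wlt e e' ∨ e = e' ∨ wlt e' e := by
  rcases lt_trichotomy e.length e'.length with h | h | h
  · exact Or.inl (List.Shortlex.of_length_lt h)
  · rcases lt_trichotomy e e' with h' | h' | h'
    · exact Or.inl (List.Shortlex.of_lex h h')
    · exact Or.inr (Or.inl h')
    · exact Or.inr (Or.inr (List.Shortlex.of_lex h.symm h'))
  · exact Or.inr (Or.inr (List.Shortlex.of_length_lt h))

theorem wordRank_lt_wordRank {L : Finset Word} {e e' : Word} (he : e ∈ L) (h : wlt e e') :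
    wordRank L e < wordRank L e' := by
  classical
  refine Finset.card_lt_card ⟨fun f hf => ?_, fun hsub => ?_⟩
  · rw [Finset.mem_filter] at hf ⊢
    exact ⟨hf.1, wlt_trans hf.2 h⟩
  · exact wlt_irrefl e (Finset.mem_filter.1 (hsub (Finset.mem_filter.2 ⟨he, h⟩))).2

theorem wordRank_injOn (L : Finset Word) : InjOn (wordRank L) (L : Set Word) := by
  intro e he e' he' h
  rcases wlt_trichotomy e e' with h' | h' | h'
  · exact absurd h (wordRank_lt_wordRank he h').ne
  · exact h'
  · exact absurd h (wordRank_lt_wordRank he' h').ne'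

theorem wordRank_lt_card {L : Finset Word} {e : Word} (he : e ∈ L) : wordRank L e < L.card := by
  classical
  refine Finset.card_lt_card ⟨Finset.filter_subset _ _, fun hsub => ?_⟩
  exact wlt_irrefl e (Finset.mem_filter.1 (hsub he)).2

theorem selectWord_eq_some_iff {L : Finset Word} {u : ℝ} {e : Word} :
    selectWord L u = some e ↔ e ∈ L ∧
      u ∈ Ico ((wordRank L e : ℝ) / L.card) (((wordRank L e : ℝ) + 1) / L.card) := by
  have huniq : ∀ e e', (e ∈ L ∧
      u ∈ Ico ((wordRank L e : ℝ) / L.card) (((wordRank L e : ℝ) + 1) / L.card)) →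
      (e' ∈ L ∧
      u ∈ Ico ((wordRank L e' : ℝ) / L.card) (((wordRank L e' : ℝ) + 1) / L.card)) → e = e' := by
    rintro e e' ⟨he, h1, h2⟩ ⟨he', h3, h4⟩
    have hN : (0 : ℝ) < L.card := by exact_mod_cast Finset.card_pos.2 ⟨e, he⟩
    have h5 : (wordRank L e : ℝ) < wordRank L e' + 1 :=
      (div_lt_div_iff_of_pos_right hN).1 (h1.trans_lt h4)
    have h6 : (wordRank L e' : ℝ) < wordRank L e + 1 :=
      (div_lt_div_iff_of_pos_right hN).1 (h3.trans_lt h2)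
    have h7 : wordRank L e < wordRank L e' + 1 := by exact_mod_cast h5
    have h8 : wordRank L e' < wordRank L e + 1 := by exact_mod_cast h6
    exact wordRank_injOn L he he' (by omega)
  unfold selectWord
  constructor
  · intro h
    split_ifs at h with hex
    rw [Option.some_inj] at h
    exact h ▸ hex.choose_spec
  · intro h
    have hex : ∃ e, e ∈ L ∧
      u ∈ Ico ((wordRank L e : ℝ) / L.card) (((wordRank L e : ℝ) + 1) / L.card) := ⟨e, h⟩
    rw [dif_pos hex, huniq _ _ hex.choose_spec h]

theorem measurable_selectWord (L : Finset Word) : Measurable (selectWord L) := by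
  have hsome : ∀ e, MeasurableSet {u | selectWord L u = some e} := by
    intro e
    simp only [selectWord_eq_some_iff]
    exact (MeasurableSet.const (e ∈ L)).inter measurableSet_Ico
  refine measurable_to_countable' fun o => ?_
  cases o with
  | some e => exact hsome e
  | none =>
    have : selectWord L ⁻¹' {none} = (⋃ e, {a | selectWord L a = some e})ᶜ := by
      ext a
      simp only [mem_preimage, mem_singleton_iff, mem_compl_iff, mem_iUnion, mem_ofPred_eq]
      cases selectWord L a <;> simp
    rw [this]
    exact (MeasurableSet.iUnion hsome).compl

/-- Each word is selected with the same probability. -/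
theorem volume_selectWord {L : Finset Word} {e : Word} (he : e ∈ L) :
    volume.restrict (Ico (0 : ℝ) 1) {u | selectWord L u = some e} = (L.card : ℝ≥0∞)⁻¹ := by
  have hN : (0 : ℝ) < L.card := by exact_mod_cast Finset.card_pos.2 ⟨e, he⟩
  have h1 : {u | selectWord L u = some e}
      = Ico ((wordRank L e : ℝ) / L.card) (((wordRank L e : ℝ) + 1) / L.card) := by
    ext u
    simp only [mem_ofPred_eq, selectWord_eq_some_iff, he, true_and]
  have h2 : Ico ((wordRank L e : ℝ) / L.card) (((wordRank L e : ℝ) + 1) / L.card) ⊆ Ico 0 1 := by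
    refine Ico_subset_Ico (by positivity) ((div_le_one hN).2 ?_)
    exact_mod_cast wordRank_lt_card he
  rw [h1, Measure.restrict_eq_self _ h2, Real.volume_Ico, ← sub_div, add_sub_cancel_left,
    one_div, ENNReal.ofReal_inv_of_pos hN, ENNReal.ofReal_natCast]

variable {ℓ : ℕ}

open Classical in
/-- The words in `E` whose cell is hit by `h`. -/
def hitWords (W : Set (Space ℓ)) (E : Finset Word) (H : Word → Hyp ℓ) (h : Hyp ℓ) : Finset Word :=
  E.filter fun e => h ∈ hit (pathCell W H e)

theorem mem_hitWords_iff {W : Set (Space ℓ)} {E : Finset Word} {H : Word → Hyp ℓ} {h : Hyp ℓ}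
    {e : Word} : e ∈ hitWords W E H h ↔ e ∈ E ∧ h ∈ hit (pathCell W H e) := by
  classical
  rw [hitWords, Finset.mem_filter]

theorem measurable_hitWords (W : Window ℓ) (E : Finset Word) :
    Measurable fun p : (Word → Hyp ℓ) × Hyp ℓ => hitWords W.carrier E p.1 p.2 := by
  refine measurable_to_countable' fun L => ?_
  have : (fun p : (Word → Hyp ℓ) × Hyp ℓ => hitWords W.carrier E p.1 p.2) ⁻¹' {L}
      = ⋂ e, {p | e ∈ L ↔ e ∈ E ∧ p.2 ∈ hit (pathCell W.carrier p.1 e)} := by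
    ext p
    simp only [mem_preimage, mem_singleton_iff, mem_iInter, mem_ofPred_eq, hitWords,
      Finset.ext_iff, Finset.mem_filter]
    exact forall_congr' fun e => iff_comm
  rw [this]
  refine MeasurableSet.iInter fun e => ?_
  have h1 := measurableSet_mem_hit_pathCell W e
  exact MeasurableSet.iff (MeasurableSet.const _) ((MeasurableSet.const _).inter h1)

theorem measurable_selectWord_hitWords (W : Window ℓ) (E : Finset Word) (H : Word → Hyp ℓ) :
    Measurable fun p : ℝ × Hyp ℓ => (selectWord (hitWords W.carrier E H p.2) p.1, p.2) := by
  have h1 := (measurable_hitWords W E).comp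
    (show Measurable fun p : ℝ × Hyp ℓ => (H, p.2) by fun_prop)
  exact (measurable_of_countable_cases h1 (F := fun L (p : ℝ × Hyp ℓ) => selectWord L p.1)
    fun L => (measurable_selectWord L).comp measurable_fst).prodMk measurable_snd

/-- The sum of the restrictions of `Λ` has, with respect to `Λ`, the density that counts the cells
hit. -/
theorem lintegral_sum_restrict_hit (Λ : Measure (Hyp ℓ)) (W : Window ℓ) (E : Finset Word)
    (H : Word → Hyp ℓ) {F : Hyp ℓ → ℝ≥0∞} (hF : Measurable F) :
    ∫⁻ h, F h ∂(∑ e ∈ E, Λ.restrict (hit (pathCell W.carrier H e)))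
      = ∫⁻ h, F h * (hitWords W.carrier E H h).card ∂Λ := by
  rw [lintegral_finsetSum_measure]
  have hm : ∀ e, MeasurableSet (hit (pathCell W.carrier H e)) := measurableSet_hit_pathCell W H
  simp only [← lintegral_indicator (hm _)]
  rw [← lintegral_finsetSum _ fun e _ => hF.indicator (hm e)]
  refine lintegral_congr fun h => ?_
  simp only [hitWords, indicator, Finset.card_filter, Nat.cast_sum, Finset.mul_sum]
  refine Finset.sum_congr rfl fun e _ => ?_
  split_ifs <;> simp

/-- Draw a hyperplane from the normalized sum of the restrictions of `Λ` to the hyperplanes hitting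
the cells, then choose one of the cells hit with equal probabilities: this is the same as choosing
a cell proportionally to its measure, and then a hyperplane hitting it. -/
theorem map_selectWord {Λ : Measure (Hyp ℓ)} (hΛ : IsHyperplaneMeasure Λ) (W : Window ℓ)
    {E : Finset Word} (hE : IsLeafSet E) {H : Word → Hyp ℓ} (hg : GoodLeaves W E H) :
    IsProbabilityMeasure (gamHat Λ (treeTess W E H)) ∧
    ((volume.restrict (Ico (0 : ℝ) 1)).prod (gamHat Λ (treeTess W E H))).map
        (fun p => (selectWord (hitWords W.carrier E H p.2) p.1, p.2))
      = ∑ e ∈ E, ENNReal.ofReal ((Λ (hit (pathCell W.carrier H e))).toReal /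
          ∑ f ∈ E, (Λ (hit (pathCell W.carrier H f))).toReal) •
        (Measure.dirac (some e)).prod (normalized Λ (pathCell W.carrier H e)) := by
  set C : Word → Set (Hyp ℓ) := fun e => hit (pathCell W.carrier H e) with hC
  have hCm : ∀ e, MeasurableSet (C e) := measurableSet_hit_pathCell W H
  have hpos : ∀ e ∈ E, Λ (C e) ≠ 0 := fun e he => (hΛ.hit_pos (hg e he)).ne'
  have hfin : ∀ e, Λ (C e) ≠ ∞ := fun e => (hΛ.hit_lt_top (isCompact_pathCell _ _ _)).ne
  set ζ := ∑ e ∈ E, Λ (C e) with hζ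
  obtain ⟨e₀, he₀⟩ := hE.nonempty
  have hζ0 : ζ ≠ 0 := fun h => hpos e₀ he₀ (Finset.sum_eq_zero_iff.1 h e₀ he₀)
  have hζt : ζ ≠ ∞ := ENNReal.sum_ne_top.2 fun e _ => hfin e
  have hgam : gamHat Λ (treeTess W E H) = ζ⁻¹ • ∑ e ∈ E, Λ.restrict (C e) := by
    rw [gamHat, hg.zeta_treeTess hE, hg.gam_treeTess hE]
  have hweight : ∀ e ∈ E, ENNReal.ofReal ((Λ (C e)).toReal / ∑ f ∈ E, (Λ (C f)).toReal)
      = Λ (C e) * ζ⁻¹ := by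
    intro e he
    rw [← ENNReal.toReal_sum fun f _ => hfin f, ← ENNReal.toReal_div,
      ENNReal.ofReal_toReal (ENNReal.div_ne_top (hfin e) hζ0), div_eq_mul_inv]
  have hprob : IsProbabilityMeasure (gamHat Λ (treeTess W E H)) := by
    constructor
    rw [hgam, Measure.smul_apply, Measure.finsetSum_apply]
    simp only [Measure.restrict_apply_univ, smul_eq_mul]
    exact ENNReal.inv_mul_cancel hζ0 hζt
  refine ⟨hprob, ?_⟩
  have hunif : IsProbabilityMeasure (volume.restrict (Ico (0 : ℝ) 1)) := ⟨by simp⟩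
  have hm := measurable_selectWord_hitWords W E H
  set ν := ((volume.restrict (Ico (0 : ℝ) 1)).prod (gamHat Λ (treeTess W E H))).map
    (fun p => (selectWord (hitWords W.carrier E H p.2) p.1, p.2)) with hν
  have hνp : IsProbabilityMeasure ν := Measure.isProbabilityMeasure_map hm.aemeasurable
  have hχ : ∀ e ∈ E, IsProbabilityMeasure (normalized Λ (pathCell W.carrier H e)) := fun e he =>
    hΛ.isProbabilityMeasure_normalized (isCompact_pathCell _ _ _) (hg e he)
  have hRp : IsProbabilityMeasure (∑ e ∈ E, ENNReal.ofReal ((Λ (C e)).toReal /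
      ∑ f ∈ E, (Λ (C f)).toReal) •
        (Measure.dirac (some e)).prod (normalized Λ (pathCell W.carrier H e))) := by
    constructor
    rw [Measure.finsetSum_apply]
    have h1 : ∀ e ∈ E, (ENNReal.ofReal ((Λ (C e)).toReal / ∑ f ∈ E, (Λ (C f)).toReal) •
        (Measure.dirac (some e)).prod (normalized Λ (pathCell W.carrier H e))) univ
        = Λ (C e) * ζ⁻¹ := by
      intro e he
      have := hχ e he
      rw [Measure.smul_apply, measure_univ, smul_eq_mul, mul_one, hweight e he]
    rw [Finset.sum_congr rfl h1, ← Finset.sum_mul, ENNReal.mul_inv_cancel hζ0 hζt]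
  -- both sides are probability measures, so that one inequality suffices
  symm
  refine Measure.eq_of_le_of_isProbabilityMeasure (Measure.le_iff.2 fun B hB => ?_)
  have hBe : ∀ e : Word, MeasurableSet {h : Hyp ℓ | (some e, h) ∈ B} := fun e =>
    measurable_prodMk_left hB
  have hpart : ∀ e ∈ E, ν (B ∩ Prod.fst ⁻¹' {some e}) = ζ⁻¹ * Λ ({h | (some e, h) ∈ B} ∩ C e) := by
    intro e he
    have hBm : MeasurableSet (B ∩ Prod.fst ⁻¹' {some e}) :=
      hB.inter (measurable_fst (MeasurableSet.singleton (some e)))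
    have hF : Measurable fun h : Hyp ℓ => ({h | (some e, h) ∈ B} ∩ C e).indicator
        (fun h => ((hitWords W.carrier E H h).card : ℝ≥0∞)⁻¹) h := by
      refine Measurable.indicator ?_ ((hBe e).inter (hCm e))
      have h1 := (measurable_hitWords W E).comp
        (show Measurable fun h : Hyp ℓ => (H, h) by fun_prop)
      exact (Measurable.of_discrete (f := fun L : Finset Word => ((L.card : ℝ≥0∞))⁻¹)).comp h1
    rw [hν, Measure.map_apply hm hBm, Measure.prod_apply_symm (hm hBm)]
    have h1 : ∀ h, (volume.restrict (Ico (0 : ℝ) 1)) ((fun u => (u, h)) ⁻¹'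
        ((fun p : ℝ × Hyp ℓ => (selectWord (hitWords W.carrier E H p.2) p.1, p.2)) ⁻¹'
          (B ∩ Prod.fst ⁻¹' {some e})))
        = ({h | (some e, h) ∈ B} ∩ C e).indicator
          (fun h => ((hitWords W.carrier E H h).card : ℝ≥0∞)⁻¹) h := by
      intro h
      by_cases hh : h ∈ {h | (some e, h) ∈ B} ∩ C e
      · rw [indicator_of_mem hh, ← volume_selectWord (L := hitWords W.carrier E H h) (e := e)
          (mem_hitWords_iff.2 ⟨he, hh.2⟩)]
        congr 1
        ext u
        simp only [mem_preimage, mem_inter_iff, mem_singleton_iff, mem_ofPred_eq]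
        exact ⟨fun h => h.2, fun h' => ⟨by rw [h']; exact hh.1, h'⟩⟩
      · rw [indicator_of_notMem hh]
        convert measure_empty (μ := volume.restrict (Ico (0 : ℝ) 1)) using 2
        ext u
        simp only [mem_preimage, mem_inter_iff, mem_singleton_iff, mem_empty_iff_false, iff_false,
          not_and]
        intro h1 h2
        rw [h2] at h1
        exact hh ⟨h1, (mem_hitWords_iff.1 (selectWord_eq_some_iff.1 h2).1).2⟩
    simp only [h1]
    rw [hgam, lintegral_smul_measure, lintegral_sum_restrict_hit Λ W E H hF, smul_eq_mul]
    congr 1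
    rw [← lintegral_indicator_one ((hBe e).inter (hCm e))]
    refine lintegral_congr fun h => ?_
    by_cases hh : h ∈ {h | (some e, h) ∈ B} ∩ C e
    · have hmem : e ∈ hitWords W.carrier E H h := mem_hitWords_iff.2 ⟨he, hh.2⟩
      rw [indicator_of_mem hh, indicator_of_mem hh, ENNReal.inv_mul_cancel, Pi.one_apply]
      · exact_mod_cast (Finset.card_pos.2 ⟨e, hmem⟩).ne'
      · exact ENNReal.natCast_ne_top _
    · rw [indicator_of_notMem hh, indicator_of_notMem hh, zero_mul]
  have hle : ∑ e ∈ E, ν (B ∩ Prod.fst ⁻¹' {some e}) ≤ ν B := by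
    rw [← measure_biUnion_finset]
    · exact measure_mono (iUnion₂_subset fun e _ => inter_subset_left)
    · intro e _ f _ hef
      refine Set.disjoint_left.2 ?_
      rintro ⟨o, h⟩ ⟨-, h1⟩ ⟨-, h2⟩
      exact hef (Option.some_inj.1 (h1.symm.trans h2))
    · exact fun e _ => hB.inter (measurable_fst (MeasurableSet.singleton (some e)))
  refine le_trans (le_of_eq ?_) hle
  rw [Measure.finsetSum_apply]
  refine Finset.sum_congr rfl fun e he => ?_
  have := hχ e he
  rw [hpart e he, Measure.smul_apply, hweight e he, Measure.dirac_prod,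
    Measure.map_apply measurable_prodMk_left hB, normalized, Measure.smul_apply,
    Measure.restrict_apply (measurable_prodMk_left hB), smul_eq_mul, smul_eq_mul, ← mul_assoc,
    mul_comm (Λ (C e)), mul_assoc ζ⁻¹, ENNReal.mul_inv_cancel (hpos e he) (hfin e), mul_one]
  rfl

/-! ### The law of the jumps when the hyperplane is drawn first -/

section NewDatum

variable [Inhabited (Hyp ℓ)]

/-- The jump produced by a uniform variable, an exponential variable and a hyperplane, when the
hyperplane is given before the cell is selected. -/
def newDatum (Λ : Measure (Hyp ℓ)) (W : Window ℓ) (n : ℕ) (S : ℕ → Datum ℓ)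
    (x : ℝ × ℝ × Hyp ℓ) : Datum ℓ :=
  ((∑ e ∈ leaves S n, rate Λ W n S e)⁻¹ * x.2.1,
    selectWord (hitWords W.carrier (leaves S n) (hypMap S n) x.2.2) x.1, x.2.2)

theorem IsHyperplaneMeasure.measurable_newDatum {Λ : Measure (Hyp ℓ)} (hΛ : IsHyperplaneMeasure Λ)
    (W : Window ℓ) (n : ℕ) :
    Measurable fun p : (ℕ → Datum ℓ) × ℝ × ℝ × Hyp ℓ => newDatum Λ W n p.1 p.2 := by
  have hE : Measurable fun p : (ℕ → Datum ℓ) × ℝ × ℝ × Hyp ℓ => leaves p.1 n :=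
    (measurable_leaves n).comp measurable_fst
  have h1 : Measurable fun p : (ℕ → Datum ℓ) × ℝ × ℝ × Hyp ℓ =>
      (∑ e ∈ leaves p.1 n, rate Λ W n p.1 e)⁻¹ * p.2.2.1 := by
    refine Measurable.mul (Measurable.inv ?_) (by fun_prop)
    refine measurable_of_countable_cases hE (F := fun E (p : (ℕ → Datum ℓ) × ℝ × ℝ × Hyp ℓ) =>
      ∑ e ∈ E, rate Λ W n p.1 e) fun E => ?_
    exact Finset.measurable_sum _ fun e _ => (hΛ.measurable_rate W n e).comp measurable_fst
  have h2 : Measurable fun p : (ℕ → Datum ℓ) × ℝ × ℝ × Hyp ℓ =>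
      hitWords W.carrier (leaves p.1 n) (hypMap p.1 n) p.2.2.2 := by
    refine measurable_of_countable_cases hE (F := fun E (p : (ℕ → Datum ℓ) × ℝ × ℝ × Hyp ℓ) =>
      hitWords W.carrier E (hypMap p.1 n) p.2.2.2) fun E => ?_
    have h3 := ((measurable_hypMap n).comp (measurable_fst
      (α := ℕ → Datum ℓ) (β := ℝ × ℝ × Hyp ℓ))).prodMk
        (show Measurable fun p : (ℕ → Datum ℓ) × ℝ × ℝ × Hyp ℓ => p.2.2.2 by fun_prop)
    have h4 := (measurable_hitWords W E).comp h3
    exact h4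
  have h5 : Measurable fun p : (ℕ → Datum ℓ) × ℝ × ℝ × Hyp ℓ =>
      selectWord (hitWords W.carrier (leaves p.1 n) (hypMap p.1 n) p.2.2.2) p.2.1 :=
    measurable_of_countable_cases h2 (F := fun L (p : (ℕ → Datum ℓ) × ℝ × ℝ × Hyp ℓ) =>
      selectWord L p.2.1) fun L => (measurable_selectWord L).comp (by fun_prop)
  exact h1.prodMk (h5.prodMk (by fun_prop))

/-- If the hyperplane follows the normalized sum of the restrictions of `Λ`, then the jump has the
same conditional law as the one produced by competing clocks. -/
theorem IsHyperplaneMeasure.map_newDatum {Λ : Measure (Hyp ℓ)} (hΛ : IsHyperplaneMeasure Λ)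
    {W : Window ℓ} {n : ℕ} {S : ℕ → Datum ℓ} (hS : Good W n S) :
    ((volume.restrict (Ico (0 : ℝ) 1)).prod ((expMeasure 1).prod (gamHat Λ (tessOf W n S)))).map
      (newDatum Λ W n S) = jumpLaw Λ W n S := by
  obtain ⟨hp, hlaw⟩ := map_selectWord hΛ W (isLeafSet_leaves S n) hS
  change IsProbabilityMeasure (gamHat Λ (tessOf W n S)) at hp
  set U := volume.restrict (Ico (0 : ℝ) 1) with hU
  set γ := gamHat Λ (tessOf W n S) with hγ
  set c := (∑ e ∈ leaves S n, rate Λ W n S e)⁻¹ with hc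
  have h5 : MeasurePreserving (fun p : ℝ × ℝ × Hyp ℓ => (p.2.1, p.1, p.2.2))
      (U.prod ((expMeasure 1).prod γ)) ((expMeasure 1).prod (U.prod γ)) := by
    have h6 := (measurePreserving_prodAssoc U (expMeasure 1) γ).symm
    have h7 := (Measure.measurePreserving_swap (μ := U) (ν := expMeasure 1)).prod
      (MeasurePreserving.id γ)
    have h8 := measurePreserving_prodAssoc (expMeasure 1) U γ
    exact h8.comp (h7.comp h6)
  have hsel := measurable_selectWord_hitWords W (leaves S n) (hypMap S n)
  have hcm : Measurable fun v : ℝ => c * v := by fun_prop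
  have h9 : newDatum Λ W n S = (Prod.map (fun v : ℝ => c * v) fun p : ℝ × Hyp ℓ =>
      (selectWord (hitWords W.carrier (leaves S n) (hypMap S n) p.2) p.1, p.2)) ∘
      fun p : ℝ × ℝ × Hyp ℓ => (p.2.1, p.1, p.2.2) := rfl
  have hsf : SFinite ((U.prod γ).map fun p : ℝ × Hyp ℓ =>
      (selectWord (hitWords W.carrier (leaves S n) (hypMap S n) p.2) p.1, p.2)) := inferInstance
  rw [hγ, tessOf, hlaw] at hsf
  rw [h9, ← Measure.map_map (hcm.prodMap hsel) h5.measurable, h5.map_eq,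
    ← Measure.map_prod_map _ _ hcm hsel, hγ, tessOf, hlaw, jumpLaw, clockLaw]
  ext B hB
  have hχ : ∀ e ∈ leaves S n,
      IsProbabilityMeasure (normalized Λ (pathCell W.carrier (hypMap S n) e)) := fun e he =>
    hΛ.isProbabilityMeasure_normalized (isCompact_pathCell _ _ _) (hS e he)
  rw [Measure.prod_apply hB]
  simp only [Measure.finsetSum_apply, Measure.smul_apply, smul_eq_mul]
  rw [lintegral_finsetSum' _ fun e he => by
    have := hχ e he
    exact ((measurable_measure_prodMk_left hB).const_mul _).aemeasurable]
  refine Finset.sum_congr rfl fun e he => ?_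
  have := hχ e he
  rw [lintegral_const_mul _ (measurable_measure_prodMk_left hB), Measure.prod_apply hB]
  rfl

theorem newDatum_congr {Λ : Measure (Hyp ℓ)} {W : Window ℓ} {n : ℕ} {S S' : ℕ → Datum ℓ}
    (h : ∀ j < n, S j = S' j) : newDatum Λ W n S = newDatum Λ W n S' := by
  unfold newDatum rate
  rw [leaves_congr h, hypMap_congr h]

theorem tessOf_congr {W : Window ℓ} {n : ℕ} {S S' : ℕ → Datum ℓ}
    (h : ∀ j < n, S j = S' j) : tessOf W n S = tessOf W n S' := by
  unfold tessOf
  rw [leaves_congr h, hypMap_congr h]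

/-- In the chain of competing clocks, the clocks remain independent of the history, and almost
surely a cell is divided in each step and all cells have interior points. -/
theorem IsHyperplaneMeasure.map_chain_clock {Λ : Measure (Hyp ℓ)} (hΛ : IsHyperplaneMeasure Λ)
    (W : Window ℓ) (n : ℕ) :
    (clockSource Λ W).map (fun ω => chain (clockD Λ W) (clockR Λ W) ω n)
      = ((clockSource Λ W).map fun ω => (chain (clockD Λ W) (clockR Λ W) ω n).1).prod
        (clockSource Λ W) ∧
    ∀ᵐ S ∂(clockSource Λ W).map fun ω => (chain (clockD Λ W) (clockR Λ W) ω n).1,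
      Proper W n S := by
  have := hΛ.isProbabilityMeasure_clockSource W
  exact map_chain (fun n => (hΛ.measurable_clock W n).fst) (fun n => (hΛ.measurable_clock W n).snd)
    (clockSource Λ W) (jumpLaw Λ W) (measurableSet_proper W) (proper_zero W _)
    (fun n S hS => hΛ.map_clockD_clockR hS.1) (fun n S hS => hΛ.ae_jumpLaw hS) n

/-- The law of the variables that drive the construction in which the hyperplane is drawn before
the cell is selected. -/
def noiseLaw (Λ : Measure (Hyp ℓ)) (W : Window ℓ) : Measure (ℕ → ℝ × ℝ × Hyp ℓ) :=
  Measure.infinitePi fun _ => (volume.restrict (Ico (0 : ℝ) 1)).prod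
    ((expMeasure 1).prod (normalized Λ W.carrier))

/-- The jumps of the construction in which the hyperplane is drawn before the cell is selected have
the law of the jumps produced by competing clocks. The maps `Ξ n` are measurable up to completion
only; they are replaced by measurable ones, which is possible because the law of the tessellation at
which `Ξ n` is evaluated is known from the competing clocks. -/
theorem IsHyperplaneMeasure.exists_newData {Λ : Measure (Hyp ℓ)} (hΛ : IsHyperplaneMeasure Λ)
    (W : Window ℓ) {Ξ : ℕ → Tess W → Hyp ℓ → Hyp ℓ} (hΞ : IsTransport Λ W Ξ) :
    ∃ N : (ℕ → ℝ × ℝ × Hyp ℓ) → ℕ → Datum ℓ, Measurable N ∧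
      (noiseLaw Λ W).map N = (clockSource Λ W).map (chainData (clockD Λ W) (clockR Λ W)) ∧
      ∀ᵐ ω ∂noiseLaw Λ W, ∀ n, N ω n = newDatum Λ W n (N ω)
        ((ω n).1, (ω n).2.1, Ξ n (tessOf W n (N ω)) (ω n).2.2) := by
  have := hΛ.isProbabilityMeasure_clockSource W
  have := hΛ.isProbabilityMeasure_window W
  have hunif : IsProbabilityMeasure (volume.restrict (Ico (0 : ℝ) 1)) := ⟨by simp⟩
  set U := volume.restrict (Ico (0 : ℝ) 1) with hU
  set ν := normalized Λ W.carrier with hν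
  set ρ := U.prod ((expMeasure 1).prod ν) with hρ
  have hnoise : noiseLaw Λ W = Measure.infinitePi fun _ : ℕ => ρ := rfl
  rw [hnoise]
  set μ := Measure.infinitePi fun _ : ℕ => ρ with hμ
  have hDm : ∀ n, Measurable (clockD Λ W n) := fun n => (hΛ.measurable_clock W n).fst
  have hRm : ∀ n, Measurable (clockR Λ W n) := fun n => (hΛ.measurable_clock W n).snd
  set Q : ℕ → Measure (ℕ → Datum ℓ) := fun n =>
    (clockSource Λ W).map fun ω => (chain (clockD Λ W) (clockR Λ W) ω n).1 with hQ
  have hQp : ∀ n, IsProbabilityMeasure (Q n) := fun n =>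
    Measure.isProbabilityMeasure_map (measurable_chain hDm hRm n).fst.aemeasurable
  have hT : ∀ n, MeasurePreserving (tessOf (ℓ := ℓ) W n) (Q n) ((Q n).map (tessOf W n)) :=
    fun n => ⟨measurable_tessOf W n, rfl⟩
  have hTp : ∀ n, IsProbabilityMeasure ((Q n).map (tessOf (ℓ := ℓ) W n)) := fun n =>
    Measure.isProbabilityMeasure_map (measurable_tessOf W n).aemeasurable
  have hae : ∀ n, AEMeasurable (fun p : Tess W × Hyp ℓ => Ξ n p.1 p.2)
      (((Q n).map (tessOf W n)).prod ν) := fun n => hΞ.measurable n _ (hTp n)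
  -- measurable versions with respect to the law of the tessellation after `n` jumps
  set Ξ' : ℕ → Tess W × Hyp ℓ → Hyp ℓ := fun n => (hae n).mk _ with hΞ'
  have hΞm : ∀ n, Measurable (Ξ' n) := fun n => (hae n).measurable_mk
  have heq : ∀ n, ∀ᵐ p ∂(Q n).prod ν, Ξ n (tessOf W n p.1) p.2 = Ξ' n (tessOf W n p.1, p.2) :=
    fun n => ((hT n).prod (MeasurePreserving.id ν)).quasiMeasurePreserving.ae (hae n).ae_eq_mk
  -- the construction with the measurable versions of the maps
  set D : (n : ℕ) → (ℕ → Datum ℓ) × (ℕ → ℝ × ℝ × Hyp ℓ) → Datum ℓ := fun n p =>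
    newDatum Λ W n p.1 ((p.2 0).1, (p.2 0).2.1, Ξ' n (tessOf W n p.1, (p.2 0).2.2)) with hD
  set R : (n : ℕ) → (ℕ → Datum ℓ) × (ℕ → ℝ × ℝ × Hyp ℓ) → ℕ → ℝ × ℝ × Hyp ℓ := fun _ p k =>
    p.2 (k + 1) with hR
  have hg : ∀ n, Measurable fun p : (ℕ → Datum ℓ) × ℝ × ℝ × Hyp ℓ =>
      newDatum Λ W n p.1 (p.2.1, p.2.2.1, Ξ' n (tessOf W n p.1, p.2.2.2)) := by
    intro n
    have h1 := (hΞm n).comp (((measurable_tessOf W n).comp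
      (show Measurable fun p : (ℕ → Datum ℓ) × ℝ × ℝ × Hyp ℓ => p.1 by fun_prop)).prodMk
      (show Measurable fun p : (ℕ → Datum ℓ) × ℝ × ℝ × Hyp ℓ => p.2.2.2 by fun_prop))
    have h2 := (hΛ.measurable_newDatum W n).comp
      ((show Measurable fun p : (ℕ → Datum ℓ) × ℝ × ℝ × Hyp ℓ => p.1 by fun_prop).prodMk
        ((show Measurable fun p : (ℕ → Datum ℓ) × ℝ × ℝ × Hyp ℓ => p.2.1 by fun_prop).prodMk
          ((show Measurable fun p : (ℕ → Datum ℓ) × ℝ × ℝ × Hyp ℓ => p.2.2.1 by fun_prop).prodMk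
            h1)))
    exact h2
  have hDm' : ∀ n, Measurable (D n) := by
    intro n
    have h1 := (hg n).comp (show Measurable fun p : (ℕ → Datum ℓ) × (ℕ → ℝ × ℝ × Hyp ℓ) =>
      (p.1, p.2 0) by fun_prop)
    exact h1
  have hRm' : ∀ n, Measurable (R n) := by
    intro n
    simp only [hR]
    fun_prop
  have hstep : ∀ n, ∀ᵐ S ∂Q n, μ.map (fun ω => (D n (S, ω), R n (S, ω)))
      = ((clockSource Λ W).map fun ω => clockD Λ W n (S, ω)).prod μ := by
    intro n
    filter_upwards [(hΛ.map_chain_clock W n).2, Measure.ae_ae_of_ae_prod (heq n)] with S hS hS'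
    have h1 : ν.map (fun g => Ξ' n (tessOf W n S, g)) = gamHat Λ (tessOf W n S) := by
      rw [← hΞ.map_eq n]
      refine Measure.map_congr ?_
      filter_upwards [hS'] with g hg using hg.symm
    have hm1 : Measurable fun g => Ξ' n (tessOf W n S, g) := (hΞm n).comp measurable_prodMk_left
    have hmS : Measurable (newDatum Λ W n S) := by
      have h2 := (hΛ.measurable_newDatum W n).comp (measurable_prodMk_left (x := S))
      exact h2
    set F : ℝ × ℝ × Hyp ℓ → Datum ℓ := fun x =>
      newDatum Λ W n S (x.1, x.2.1, Ξ' n (tessOf W n S, x.2.2)) with hF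
    have hFm : Measurable F := by
      have h2 := (hg n).comp (measurable_prodMk_left (x := S))
      exact h2
    have h3 : ρ.map F = jumpLaw Λ W n S := by
      have hm2 : Measurable (Prod.map (id : ℝ → ℝ) fun g => Ξ' n (tessOf W n S, g)) :=
        measurable_id.prodMap hm1
      have h4 : F = newDatum Λ W n S ∘
          Prod.map (id : ℝ → ℝ) (Prod.map (id : ℝ → ℝ) fun g => Ξ' n (tessOf W n S, g)) := rfl
      have hsf : SFinite (ν.map fun g => Ξ' n (tessOf W n S, g)) := inferInstance
      rw [h4, ← Measure.map_map hmS (measurable_id.prodMap hm2), hρ,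
        ← Measure.map_prod_map _ _ measurable_id hm2, ← Measure.map_prod_map _ _ measurable_id hm1,
        h1, Measure.map_id, Measure.map_id, hΛ.map_newDatum hS.1]
    have h5 : (fun ω => (D n (S, ω), R n (S, ω))) = Prod.map F id ∘
        fun ω : ℕ → ℝ × ℝ × Hyp ℓ => (ω 0, fun k => ω (k + 1)) := rfl
    rw [map_fst_eq (hDm n) (hRm n) (clockSource Λ W) (hΛ.map_clockD_clockR hS.1), h5,
      ← Measure.map_map (hFm.prodMap measurable_id) (by fun_prop), hμ, map_head_tail_infinitePi,
      ← Measure.map_prod_map _ _ hFm measurable_id, Measure.map_id, h3]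
  have hclock := fun n => (hΛ.map_chain_clock W n).1
  have hchain := map_chain_of_ae hDm hRm (clockSource Λ W) hDm' hRm' μ hclock hstep
  refine ⟨chainData D R, measurable_chainData hDm' hRm',
    (map_chainData_eq_of_ae hDm hRm (clockSource Λ W) hDm' hRm' μ hclock hstep).symm, ?_⟩
  rw [ae_all_iff]
  intro n
  have h1 : MeasurePreserving (fun p : (ℕ → Datum ℓ) × (ℕ → ℝ × ℝ × Hyp ℓ) => (p.1, (p.2 0).2.2))
      ((Q n).prod μ) ((Q n).prod ν) :=
    (MeasurePreserving.id (Q n)).prod ((measurePreserving_snd (μ := expMeasure 1) (ν := ν)).comp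
      ((measurePreserving_snd (μ := U) (ν := (expMeasure 1).prod ν)).comp
        (measurePreserving_eval_infinitePi (fun _ : ℕ => ρ) 0)))
  have h2 : MeasurePreserving (fun ω => chain D R ω n) μ ((Q n).prod μ) :=
    ⟨measurable_chain hDm' hRm' n, hchain n⟩
  have h3 := (h1.comp h2).quasiMeasurePreserving.ae (heq n)
  filter_upwards [h3] with ω hω
  have hsnd : ∀ m k, (chain D R ω m).2 k = ω (m + k) := by
    intro m
    induction m with
    | zero => intro k; simp [chain]
    | succ m ih =>
      intro k
      change (chain D R ω m).2 (k + 1) = _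
      rw [ih]
      congr 1
      ring
  have h4 : chainData D R ω n = newDatum Λ W n (chain D R ω n).1 (((chain D R ω n).2 0).1,
      ((chain D R ω n).2 0).2.1,
      Ξ' n (tessOf W n (chain D R ω n).1, ((chain D R ω n).2 0).2.2)) := rfl
  simp only [Function.comp_apply] at hω
  have htr : ∀ j < n, trunc n (chainData D R ω) j = chainData D R ω j := fun j hj =>
    trunc_apply hj _
  rw [h4, ← hω, hsnd, add_zero, chain_fst, newDatum_congr htr, tessOf_congr htr]

end NewDatum

end STIT

namespace STIT

/-! ### The labelled tessellations of the new construction -/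

variable {ℓ : ℕ}

theorem Labelled.step_of_eq_some {S : Labelled ℓ} {h : Hyp ℓ} {u : ℝ} {e : Word}
    (he : selectWord (S.hits h) u = some e) : S.step h u = S.split h e := by
  have hex : ∃ e, S.Selects h u e := ⟨e, selectWord_eq_some_iff.1 he⟩
  rw [Labelled.step, dif_pos hex]
  have h1 : selectWord (S.hits h) u = some hex.choose :=
    selectWord_eq_some_iff.2 hex.choose_spec
  rw [h1, Option.some_inj] at he
  rw [he]

theorem Labelled.step_of_eq_none {S : Labelled ℓ} {h : Hyp ℓ} {u : ℝ}
    (he : selectWord (S.hits h) u = none) : S.step h u = S := by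
  rw [Labelled.step, dif_neg]
  rintro ⟨e, hex⟩
  rw [selectWord_eq_some_iff.2 hex] at he
  exact Option.some_ne_none _ he

variable [Inhabited (Hyp ℓ)]

/-- The labelled tessellation `S` is described by the first `n` jumps of the history `d`. -/
structure Describes (W : Window ℓ) (d : ℕ → Datum ℓ) (n : ℕ) (S : Labelled ℓ) : Prop where
  leaves_eq : S.leaves = leaves d n
  cell_eq : ∀ e ∈ leaves d n, S.cell e = pathCell W.carrier (hypMap d n) e

theorem Describes.cells_eq {W : Window ℓ} {d : ℕ → Datum ℓ} {n : ℕ} {S : Labelled ℓ}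
    (h : Describes W d n S) :
    S.cells = pathCell W.carrier (hypMap d n) '' (leaves d n : Set Word) := by
  rw [Labelled.cells, h.leaves_eq]
  exact image_congr h.cell_eq

theorem Describes.ofCells_eq {W : Window ℓ} {d : ℕ → Datum ℓ} {n : ℕ} {S : Labelled ℓ}
    (h : Describes W d n S) : Tess.ofCells W S.cells = tessOf W n d := by
  rw [h.cells_eq]
  rfl

theorem Describes.hits_eq {W : Window ℓ} {d : ℕ → Datum ℓ} {n : ℕ} {S : Labelled ℓ}
    (h : Describes W d n S) (y : Hyp ℓ) :
    S.hits y = hitWords W.carrier (leaves d n) (hypMap d n) y := by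
  classical
  ext e
  rw [mem_hitWords_iff, Labelled.hits, Finset.mem_filter, h.leaves_eq]
  exact and_congr_right fun he => by rw [h.cell_eq e he]

theorem Describes.step {W : Window ℓ} {d : ℕ → Datum ℓ} {n : ℕ} {S : Labelled ℓ}
    (hS : Describes W d n S) {u : ℝ}
    (hd : (d n).2.1 = selectWord (hitWords W.carrier (leaves d n) (hypMap d n) (d n).2.2) u) :
    Describes W d (n + 1) (S.step (d n).2.2 u) := by
  rw [← hS.hits_eq] at hd
  cases ho : (d n).2.1 with
  | none =>
    rw [Labelled.step_of_eq_none (hd.symm.trans ho)]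
    exact ⟨by rw [hS.leaves_eq, leaves, ho]; rfl, by
      rw [leaves, hypMap, ho]
      exact hS.cell_eq⟩
  | some e =>
    have hsel := hd.symm.trans ho
    have he : e ∈ leaves d n := by
      have := (selectWord_eq_some_iff.1 hsel).1
      rw [hS.hits_eq] at this
      exact (mem_hitWords_iff.1 this).1
    rw [Labelled.step_of_eq_some hsel]
    have hl : leaves d (n + 1) = (leaves d n).erase e ∪ {e ++ [false], e ++ [true]} := by
      rw [leaves, ho]
      simp [splitLeaves, he]
    have hh : hypMap d (n + 1) = Function.update (hypMap d n) e (d n).2.2 := by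
      rw [hypMap, ho]
      simp [splitHyp, he]
    refine ⟨by rw [hl, ← hS.leaves_eq]; rfl, fun f hf => ?_⟩
    rw [hl, mem_split_iff] at hf
    rw [hh]
    have hE := isLeafSet_leaves d n
    simp only [Labelled.split]
    rcases hf with ⟨hfe, hf⟩ | ⟨b, rfl⟩
    · have hne : ∀ b, f ≠ e ++ [b] := by
        rintro b rfl
        exact hfe (hE.eq_of_prefix he hf (List.prefix_append _ _)).symm
      rw [if_neg (hne false), if_neg (hne true), hE.pathCell_update _ _ _ he hf, hS.cell_eq f hf]
    · rw [pathCell_update_snoc, ← hS.cell_eq e he]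
      cases b <;> simp

variable {Λ : Measure (Hyp ℓ)} {W : Window ℓ} {Ξ : ℕ → Tess W → Hyp ℓ → Hyp ℓ} {u v : ℕ → ℝ}
  {g : ℕ → Hyp ℓ} {d : ℕ → Datum ℓ}

theorem describes_labelledSeq
    (hd : ∀ n, d n = newDatum Λ W n d (u n, v n, Ξ n (tessOf W n d) (g n))) (n : ℕ) :
    Describes W d n (labelledSeq W Ξ u g n) := by
  induction n with
  | zero =>
    refine ⟨rfl, fun e he => ?_⟩
    rw [leaves, Finset.mem_singleton] at he
    rw [he, pathCell_nil]
    rfl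
  | succ n ih =>
    have h1 : Ξ n (tessOf W n d) (g n) = (d n).2.2 := by
      rw [hd n]
      rfl
    rw [labelledSeq, ih.ofCells_eq, h1]
    refine ih.step ?_
    conv_lhs => rw [hd n]
    rw [← h1]
    rfl

theorem tessSeq_eq_tessOf
    (hd : ∀ n, d n = newDatum Λ W n d (u n, v n, Ξ n (tessOf W n d) (g n))) (n : ℕ) :
    tessSeq W Ξ u g n = tessOf W n d :=
  (describes_labelledSeq hd n).ofCells_eq

theorem IsHyperplaneMeasure.toReal_zeta_tessOf (hΛ : IsHyperplaneMeasure Λ) {n : ℕ}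
    (hg : Good W n d) : (zeta Λ (tessOf W n d)).toReal = ∑ e ∈ leaves d n, rate Λ W n d e := by
  rw [tessOf, GoodLeaves.zeta_treeTess hg (isLeafSet_leaves d n),
    ENNReal.toReal_sum fun e _ => (hΛ.hit_lt_top (isCompact_pathCell _ _ _)).ne]
  rfl

/-- The time of the `n`-th jump of the history `d`. -/
def jumpOf (d : ℕ → Datum ℓ) (n : ℕ) : ℝ := ∑ j ∈ Finset.range n, (d j).1

theorem IsHyperplaneMeasure.jumpTime_eq_jumpOf (hΛ : IsHyperplaneMeasure Λ)
    (hd : ∀ n, d n = newDatum Λ W n d (u n, v n, Ξ n (tessOf W n d) (g n)))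
    (hg : ∀ n, Good W n d) (n : ℕ) : jumpTime Λ W Ξ u v g n = jumpOf d n := by
  refine Finset.sum_congr rfl fun j _ => ?_
  rw [tessSeq_eq_tessOf hd, hΛ.toReal_zeta_tessOf (hg j), hd j]
  conv_rhs => rw [newDatum]

/-- The path `t ↦ Y_{N(t)}`, with `N(t) = sup {n | S_n ≤ t}`, where `Y_n` is the tessellation after
the `n`-th jump of the history `d`, which takes place at time `S_n`. -/
def pathOf (W : Window ℓ) (d : ℕ → Datum ℓ) (t : ℝ≥0) : Tess W :=
  tessOf W (sSup {n : ℕ | jumpOf d n ≤ t}) d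

theorem IsHyperplaneMeasure.newPath_eq_pathOf (hΛ : IsHyperplaneMeasure Λ)
    (hd : ∀ n, d n = newDatum Λ W n d (u n, v n, Ξ n (tessOf W n d) (g n)))
    (hg : ∀ n, Good W n d) : newPath Λ W Ξ u v g = pathOf W d := by
  ext1 t
  simp only [newPath, pathOf, hΛ.jumpTime_eq_jumpOf hd hg]
  exact tessSeq_eq_tessOf hd _

end STIT

namespace STIT

/-! ### The hyperplanes of the STIT tessellation -/

/-- The words, listed in their order. -/
theorem exists_enumeration_word :
    ∃ (w : ℕ → Word) (idx : Word → ℕ), (∀ e, w (idx e) = e) ∧ (∀ n, idx (w n) = n) ∧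
      ∀ e e', wlt e e' ↔ idx e < idx e' := by
  classical
  set rk : Word → ℕ := fun e => {e' | wlt e' e}.ncard with hrk
  have hfin : ∀ e, {e' | wlt e' e}.Finite := by
    intro e
    refine (List.finite_length_le Bool e.length).subset fun e' he' => ?_
    rcases List.shortlex_def.1 (show List.Shortlex (· < ·) e' e from he') with h | h
    · exact h.le
    · exact h.1.le
  have hlt : ∀ e e', wlt e e' → rk e < rk e' := fun e e' h =>
    ncard_lt_ncard ⟨fun f hf => wlt_trans hf h, fun hsub => wlt_irrefl e (hsub h)⟩ (hfin e')
  have hinj : Function.Injective rk := by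
    intro e e' h
    rcases wlt_trichotomy e e' with h' | h' | h'
    · exact absurd h (hlt _ _ h').ne
    · exact h'
    · exact absurd h (hlt _ _ h').ne'
  have hiff : ∀ e e', wlt e e' ↔ rk e < rk e' := by
    refine fun e e' => ⟨hlt e e', fun h => ?_⟩
    rcases wlt_trichotomy e e' with h' | h' | h'
    · exact h'
    · exact absurd h (by rw [h']; exact lt_irrefl _)
    · exact absurd h (hlt _ _ h').asymm
  have hinf : (range rk).Infinite := infinite_range_of_injective hinj
  have : Infinite (range rk) := hinf.to_subtype
  set φ := Nat.orderEmbeddingOfSet (range rk) with hφ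
  have hφr : range φ = range rk := Nat.orderEmbeddingOfSet_range _
  have h1 : ∀ n, ∃ e, rk e = φ n := fun n => by
    have : φ n ∈ range rk := hφr ▸ mem_range_self n
    exact this
  choose w hw using h1
  have h2 : ∀ e, ∃ n, φ n = rk e := fun e => by
    have : rk e ∈ range φ := hφr ▸ mem_range_self e
    exact this
  choose idx hidx using h2
  refine ⟨w, idx, fun e => hinj ((hw _).trans (hidx e)), fun n => ?_, fun e e' => ?_⟩
  · exact φ.injective ((hidx _).trans (hw n))
  · rw [hiff, ← hidx, ← hidx, φ.lt_iff_lt]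

theorem wlt_of_prefix {p e : Word} (h : p <+: e) (hne : p ≠ e) : wlt p e :=
  List.Shortlex.of_length_lt (lt_of_le_of_ne h.length_le fun hl => hne (h.eq_of_length hl))

theorem wlt_take {e : Word} {i : ℕ} (hi : i < e.length) : wlt (e.take i) e :=
  List.Shortlex.of_length_lt (by rw [List.length_take]; omega)

section Refill

variable {ι X Y : Type*} [DecidableEq ι] [MeasurableSpace X] [MeasurableSpace Y]

/-- If a coordinate of a family of i.i.d. variables yields a variable and an independent copy of the
coordinate, then replacing the coordinate by the copy yields an independent copy of the family. -/
theorem map_update_snd_infinitePi (m : Measure X) [IsProbabilityMeasure m] (κ : Measure Y)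
    [IsProbabilityMeasure κ] {f : X → Y × X} (hf : Measurable f) (h : m.map f = κ.prod m) (e : ι) :
    (Measure.infinitePi fun _ : ι => m).map
        (fun q => ((f (q e)).1, Function.update q e (f (q e)).2))
      = κ.prod (Measure.infinitePi fun _ : ι => m) := by
  set μ := Measure.infinitePi fun _ : ι => m with hμ
  have hup := measurable_update_prod (X := X) e
  have hg : Measurable fun q : ι → X => ((f (q e)).1, Function.update q e (f (q e)).2) := by
    have h1 : Measurable fun q : ι → X => ((f (q e)).2, q) := by fun_prop
    have h2 := hup.comp h1
    exact (show Measurable fun q : ι → X => (f (q e)).1 by fun_prop).prodMk h2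
  have h3 : MeasurePreserving f m (κ.prod m) := ⟨hf, h⟩
  have h4 := (measurePreserving_prodAssoc κ m μ).comp (h3.prod (MeasurePreserving.id μ))
  have h5 : MeasurePreserving (fun p : X × (ι → X) => Function.update p.2 e p.1) (m.prod μ) μ :=
    ⟨hup, map_update_infinitePi m e⟩
  have h6 := ((MeasurePreserving.id κ).prod h5).comp h4
  conv_lhs => rw [hμ, ← map_update_infinitePi m e, ← hμ]
  rw [Measure.map_map hg hup, ← h6.map_eq]
  congr 1
  ext1 p
  simp only [Function.comp_apply, Function.update_self, Function.update_idem]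
  rfl

end Refill

variable {ℓ : ℕ}

/-- The sequence of hyperplanes of the STIT tessellation has the same law as a family obtained by
rejection sampling from independent sequences, one for each word. -/
theorem IsHyperplaneMeasure.exists_map_stitHyp_eq [Inhabited (Hyp ℓ)] {Λ : Measure (Hyp ℓ)}
    (hΛ : IsHyperplaneMeasure Λ) (W : Window ℓ) :
    ∃ (A : (ℕ → Hyp ℓ) → Word → Hyp ℓ) (B : (Word → ℕ → Hyp ℓ) → Word → Hyp ℓ),
      Measurable A ∧ Measurable B ∧
      (∀ᵐ g ∂Measure.infinitePi fun _ : ℕ => normalized Λ W.carrier,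
        stitHyp W.carrier g = A g) ∧
      (∀ q e, B q e = firstIn (hit (pathCell W.carrier (B q) e)) (q e)) ∧
      (Measure.infinitePi fun _ : ℕ => normalized Λ W.carrier).map A
        = (Measure.infinitePi fun _ : Word =>
          Measure.infinitePi fun _ : ℕ => normalized Λ W.carrier).map B := by
  have hνp := hΛ.isProbabilityMeasure_window W
  set ν := normalized Λ W.carrier with hν
  set μ₁ := Measure.infinitePi fun _ : ℕ => ν with hμ₁
  set μ₂ := Measure.infinitePi fun _ : Word => μ₁ with hμ₂
  obtain ⟨w, idx, hwi, hiw, hlt⟩ := exists_enumeration_word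
  set C : ℕ → (ℕ → Hyp ℓ) → Set (Space ℓ) := fun n S =>
    pathCell W.carrier (fun e => S (idx e)) (w n) with hC
  have hCcongr : ∀ n S S', (∀ j < n, S j = S' j) → C n S = C n S' := by
    intro n S S' h
    refine pathCell_congr _ fun i hi => h _ ?_
    rw [← hiw n]
    simpa only [hiw] using (hlt _ _).1 (wlt_take hi)
  have hCm : ∀ n, MeasurableSet {p : (ℕ → Hyp ℓ) × Hyp ℓ | p.2 ∈ hit (C n p.1)} := fun n =>
    (show Measurable fun p : (ℕ → Hyp ℓ) × Hyp ℓ => ((fun e => p.1 (idx e) : Word → Hyp ℓ), p.2) by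
      fun_prop) (measurableSet_mem_hit_pathCell W (w n))
  have hhit : ∀ n S, MeasurableSet (hit (C n S)) := fun n S => measurableSet_hit_pathCell W _ _
  -- two chains, indexed by the rank of the words: rejection from one sequence in the order of the
  -- words, and rejection from a sequence of its own for each word
  set D₁ : (n : ℕ) → (ℕ → Hyp ℓ) × (ℕ → Hyp ℓ) → Hyp ℓ := fun n p =>
    firstIn (hit (C n p.1)) p.2 with hD₁
  set R₁ : (n : ℕ) → (ℕ → Hyp ℓ) × (ℕ → Hyp ℓ) → ℕ → Hyp ℓ := fun n p =>
    afterIn (hit (C n p.1)) p.2 with hR₁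
  set D₂ : (n : ℕ) → (ℕ → Hyp ℓ) × (Word → ℕ → Hyp ℓ) → Hyp ℓ := fun n p =>
    firstIn (hit (C n p.1)) (p.2 (w n)) with hD₂
  set R₂ : (n : ℕ) → (ℕ → Hyp ℓ) × (Word → ℕ → Hyp ℓ) → Word → ℕ → Hyp ℓ := fun n p =>
    Function.update p.2 (w n) (afterIn (hit (C n p.1)) (p.2 (w n))) with hR₂
  have hm₁ : ∀ n, Measurable fun p => (D₁ n p, R₁ n p) := fun n =>
    measurable_firstIn_afterIn (A := fun S => hit (C n S)) (hCm n)
  have hm₂ : ∀ n, Measurable fun p : (ℕ → Hyp ℓ) × (Word → ℕ → Hyp ℓ) => (D₁ n (p.1, p.2 (w n)),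
      R₁ n (p.1, p.2 (w n))) := by
    intro n
    have h1 := (hm₁ n).comp (show Measurable fun p : (ℕ → Hyp ℓ) × (Word → ℕ → Hyp ℓ) =>
      (p.1, p.2 (w n)) by fun_prop)
    exact h1
  have hD₁m : ∀ n, Measurable (D₁ n) := fun n => (hm₁ n).fst
  have hR₁m : ∀ n, Measurable (R₁ n) := fun n => (hm₁ n).snd
  have hD₂m : ∀ n, Measurable (D₂ n) := fun n => (hm₂ n).fst
  have hR₂m : ∀ n, Measurable (R₂ n) := by
    intro n
    have h1 := (measurable_update_prod (X := ℕ → Hyp ℓ) (w n)).comp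
      ((hm₂ n).snd.prodMk measurable_snd)
    exact h1
  -- good histories: all cells determined by the history have interior points
  set 𝓖 : ℕ → (ℕ → Hyp ℓ) → Prop := fun n S => ∀ e : Word, (∀ p b, e = p ++ [b] → idx p < n) →
    (interior (pathCell W.carrier (fun e => S (idx e)) e)).Nonempty with h𝓖
  have h𝓖m : ∀ n, MeasurableSet {S | 𝓖 n S} := by
    intro n
    have : {S | 𝓖 n S} = ⋂ e : Word, ⋂ (_ : ∀ p b, e = p ++ [b] → idx p < n),
        {S : ℕ → Hyp ℓ | (interior (pathCell W.carrier (fun e => S (idx e)) e)).Nonempty} := by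
      ext S
      simp [h𝓖]
    rw [this]
    refine MeasurableSet.iInter fun e => MeasurableSet.iInter fun _ => ?_
    exact (show Measurable fun (S : ℕ → Hyp ℓ) (e : Word) => S (idx e) by fun_prop)
      (isOpen_setOf_interior_pathCell_nonempty W.carrier e).measurableSet
  have h𝓖0 : 𝓖 0 fun _ => default := by
    intro e he
    rcases List.eq_nil_or_concat e with rfl | ⟨p, b, h⟩
    · rw [pathCell_nil]
      exact W.isCell.2
    · exact absurd (he p b (by simpa using h)) (Nat.not_lt_zero _)
  have h𝓖C : ∀ n S, 𝓖 n S → (interior (C n S)).Nonempty := by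
    intro n S hS
    refine hS (w n) fun p b h => ?_
    rw [← hiw n]
    refine (hlt _ _).1 (wlt_of_prefix ?_ ?_)
    · rw [h]
      exact List.prefix_append _ _
    · rw [h]
      simp
  have hκ₁ : ∀ n S, 𝓖 n S → μ₁.map (fun q => (D₁ n (S, q), R₁ n (S, q)))
      = (normalized Λ (C n S)).prod μ₁ := by
    intro n S hS
    have h1 := map_firstIn_afterIn ν (hhit n S)
      (hΛ.normalized_window_ne_zero W (pathCell_subset _ _ _) (h𝓖C n S hS))
    rw [hΛ.condition_normalized W (isCompact_pathCell _ _ _) (pathCell_subset _ _ _)] at h1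
    exact h1
  have hκ₂ : ∀ n S, 𝓖 n S → μ₂.map (fun q => (D₂ n (S, q), R₂ n (S, q)))
      = (normalized Λ (C n S)).prod μ₂ := by
    intro n S hS
    have := hΛ.isProbabilityMeasure_normalized (isCompact_pathCell W (fun e => S (idx e)) (w n))
      (h𝓖C n S hS)
    have h1 := (hm₁ n).comp (measurable_prodMk_left (x := S))
    exact map_update_snd_infinitePi μ₁ (normalized Λ (C n S)) h1 (hκ₁ n S hS) (w n)
  have hstep : ∀ n S, 𝓖 n S → ∀ᵐ d ∂normalized Λ (C n S), 𝓖 (n + 1) (Function.update S n d) := by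
    intro n S hS
    filter_upwards [hΛ.ae_normalized (isCompact_pathCell W (fun e => S (idx e)) (w n))
      (convex_pathCell _ _ _) (h𝓖C n S hS)] with h hh e he
    have hup : (fun e => Function.update S n h (idx e))
        = Function.update (fun e => S (idx e)) (w n) h := by
      ext1 f
      by_cases hf : f = w n
      · rw [hf, hiw, Function.update_self, Function.update_self]
      · rw [Function.update_of_ne hf, Function.update_of_ne fun h' => hf (by rw [← h', hwi])]
    rw [hup]
    rcases List.eq_nil_or_concat e with rfl | ⟨p, b, hpb⟩
    · rw [pathCell_nil]
      exact W.isCell.2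
    · have hpb' : e = p ++ [b] := by simpa using hpb
      subst hpb'
      have hp := he p b rfl
      rcases Nat.lt_succ_iff_lt_or_eq.1 hp with hp | hp
      · rw [pathCell_update_of_not_prefix]
        · refine hS _ fun p' b' h' => ?_
          rw [← (List.append_inj' h' rfl).1]
          exact hp
        · intro hpre
          rcases List.prefix_concat_iff.1 hpre with h' | h'
          · exact h'
          · exfalso
            by_cases h'' : w n = p
            · rw [← h'', hiw] at hp
              exact lt_irrefl _ hp
            · have := (hlt _ _).1 (wlt_of_prefix h' h'')
              rw [hiw] at this
              omega
      · have hpw : p = w n := by rw [← hp, hwi]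
        rw [hpw, pathCell_update_snoc]
        exact nonempty_interior_inter_half hh b
  have hchain₁ := map_chain hD₁m hR₁m μ₁ _ h𝓖m h𝓖0 hκ₁ hstep
  have hlaw := map_chainData_eq hD₁m hR₁m μ₁ hD₂m hR₂m μ₂ _ h𝓖m h𝓖0 hκ₁ hκ₂ hstep
  have hc₁ := measurable_chainData hD₁m hR₁m
  have hc₂ := measurable_chainData hD₂m hR₂m
  have hre : Measurable fun (d : ℕ → Hyp ℓ) (e : Word) => d (idx e) := by fun_prop
  refine ⟨fun g e => chainData D₁ R₁ g (idx e), fun q e => chainData D₂ R₂ q (idx e),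
    hre.comp hc₁, hre.comp hc₂, ?_, ?_, ?_⟩
  · -- almost surely, every cell is hit by a later hyperplane
    have hex : ∀ᵐ g ∂μ₁, ∀ n, ∃ k, (chain D₁ R₁ g n).2 k ∈ hit (C n (chain D₁ R₁ g n).1) := by
      rw [ae_all_iff]
      intro n
      have h1 : MeasurePreserving (fun g => chain D₁ R₁ g n) μ₁
          ((μ₁.map fun g => (chain D₁ R₁ g n).1).prod μ₁) :=
        ⟨measurable_chain hD₁m hR₁m n, (hchain₁ n).1⟩
      refine h1.quasiMeasurePreserving.ae
        (p := fun p : (ℕ → Hyp ℓ) × (ℕ → Hyp ℓ) => ∃ k, p.2 k ∈ hit (C n p.1)) ?_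
      have hset : MeasurableSet {p : (ℕ → Hyp ℓ) × (ℕ → Hyp ℓ) | ∃ k, p.2 k ∈ hit (C n p.1)} := by
        have : {p : (ℕ → Hyp ℓ) × (ℕ → Hyp ℓ) | ∃ k, p.2 k ∈ hit (C n p.1)}
            = ⋃ k, {p | p.2 k ∈ hit (C n p.1)} := by
          ext p
          simp
        rw [this]
        exact MeasurableSet.iUnion fun k =>
          (show Measurable fun p : (ℕ → Hyp ℓ) × (ℕ → Hyp ℓ) => (p.1, p.2 k) by fun_prop) (hCm n)
      rw [Measure.ae_prod_iff_ae_ae hset]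
      filter_upwards [(hchain₁ n).2] with S hS
      exact ae_exists_mem_infinitePi ν (hhit n S)
        (hΛ.normalized_window_ne_zero W (pathCell_subset _ _ _) (h𝓖C n S hS))
    filter_upwards [hex] with g hg
    -- what the chain has left is the part of the sequence after the last index used, `s` being the
    -- first index not excluded by the condition in `kappa`
    have key : ∀ n, (∃ s, (chain D₁ R₁ g n).2 = (fun k => g (s + k)) ∧
        ∀ k, s ≤ k ↔ ∀ m < n, kappa W.carrier g (w m) < k) ∧
        ∀ m < n, stitHyp W.carrier g (w m) = chainData D₁ R₁ g m := by
      intro n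
      induction n with
      | zero => exact ⟨⟨0, by simp [chain], by simp⟩, by simp⟩
      | succ n ih =>
        obtain ⟨⟨s, hs, hsk⟩, ih⟩ := ih
        have hcell : stitCell W.carrier g (w n) = C n (chain D₁ R₁ g n).1 := by
          refine pathCell_congr _ fun i hi => ?_
          have h1 := (hlt _ _).1 (wlt_take hi)
          rw [hiw] at h1
          have h2 := ih _ h1
          rw [hwi] at h2
          rw [h2, chain_fst, trunc_apply h1]
        have hex' := hg n
        rw [hs, ← hcell] at hex'
        set A := hit (stitCell W.carrier g (w n)) with hA
        set j := sInf {k | g (s + k) ∈ A} with hj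
        have hjm : g (s + j) ∈ A := Nat.sInf_mem (s := {k | g (s + k) ∈ A}) hex'
        have hkap : kappa W.carrier g (w n) = s + j := by
          have h1 : {k | (∀ e', wlt e' (w n) → kappa W.carrier g e' < k) ∧
              g k ∈ hit (stitCell W.carrier g (w n))} = {k | s ≤ k ∧ g k ∈ A} := by
            ext k
            simp only [mem_ofPred_eq]
            refine and_congr_left fun _ => ?_
            rw [hsk k]
            constructor
            · intro h m hm
              exact h _ ((hlt _ _).2 (by rwa [hiw, hiw]))
            · intro h e' he'
              have h3 := (hlt _ _).1 he'
              rw [hiw] at h3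
              simpa only [hwi] using h _ h3
          rw [kappa_eq, h1]
          refine le_antisymm (Nat.sInf_le ⟨Nat.le_add_right _ _, hjm⟩) ?_
          have h2 : sInf {k | s ≤ k ∧ g k ∈ A} ∈ {k | s ≤ k ∧ g k ∈ A} :=
            Nat.sInf_mem ⟨s + j, Nat.le_add_right _ _, hjm⟩
          obtain ⟨t, ht⟩ := Nat.exists_eq_add_of_le h2.1
          rw [ht] at h2 ⊢
          exact Nat.add_le_add_left (Nat.sInf_le h2.2) s
        have hdata : chainData D₁ R₁ g n = g (s + j) := by
          change firstIn (hit (C n (chain D₁ R₁ g n).1)) (chain D₁ R₁ g n).2 = _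
          rw [← hcell, hs, ← hA, firstIn, if_pos hex']
        refine ⟨⟨s + j + 1, ?_, fun k => ?_⟩, fun m hm => ?_⟩
        · change afterIn (hit (C n (chain D₁ R₁ g n).1)) (chain D₁ R₁ g n).2 = _
          rw [← hcell, hs, ← hA, afterIn, if_pos hex']
          ext1 k
          exact congrArg g (by ring)
        · constructor
          · intro hk m hm
            rcases Nat.lt_succ_iff_lt_or_eq.1 hm with hm | rfl
            · exact (hsk k).1 (by omega) m hm
            · rw [hkap]
              omega
          · intro h
            have := h n (Nat.lt_succ_self n)
            rw [hkap] at this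
            omega
        · rcases Nat.lt_succ_iff_lt_or_eq.1 hm with hm | rfl
          · exact ih m hm
          · rw [hdata, stitHyp, hkap]
    ext1 e
    have := (key (idx e + 1)).2 (idx e) (Nat.lt_succ_self _)
    rwa [hwi] at this
  · intro q e
    -- the sequence of a word is untouched until its turn
    have hslot : ∀ n m, n ≤ m → (chain D₂ R₂ q n).2 (w m) = q (w m) := by
      intro n
      induction n with
      | zero => intro m _; rfl
      | succ n ih =>
        intro m hm
        change Function.update (chain D₂ R₂ q n).2 (w n) _ (w m) = _
        rw [Function.update_of_ne, ih m (by omega)]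
        intro h
        have := congrArg idx h
        rw [hiw, hiw] at this
        omega
    have h1 : chainData D₂ R₂ q (idx e)
        = firstIn (hit (C (idx e) (chain D₂ R₂ q (idx e)).1))
          ((chain D₂ R₂ q (idx e)).2 (w (idx e))) := rfl
    have h2 : C (idx e) (chain D₂ R₂ q (idx e)).1 = C (idx e) (chainData D₂ R₂ q) :=
      hCcongr _ _ _ fun j hj => by rw [chain_fst, trunc_apply hj]
    rw [h2, hslot _ _ le_rfl, hwi] at h1
    simp only [hC, hwi] at h1
    exact h1
  · have h1 := congrArg (Measure.map fun (d : ℕ → Hyp ℓ) (e : Word) => d (idx e)) hlaw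
    rw [Measure.map_map hre hc₁, Measure.map_map hre hc₂] at h1
    exact h1

end STIT

namespace STIT

/-! ### The tree of lifetimes -/

/-- The birth time of the word `e` in the binary tree with lifetimes `lt`. -/
def birth (lt : Word → ℝ) (e : Word) : ℝ := ∑ i ∈ Finset.range e.length, lt (e.take i)

/-- The time at which the word `e` is divided in the binary tree with lifetimes `lt`. -/
def death (lt : Word → ℝ) (e : Word) : ℝ := birth lt e + lt e

theorem birth_nil (lt : Word → ℝ) : birth lt [] = 0 := by simp [birth]

theorem birth_snoc (lt : Word → ℝ) (e : Word) (b : Bool) : birth lt (e ++ [b]) = death lt e := by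
  simp only [birth, death, List.length_append, List.length_singleton, Finset.sum_range_succ]
  congr 1
  · refine Finset.sum_congr rfl fun i hi => ?_
    rw [List.take_append_of_le_length (Finset.mem_range.1 hi).le]
  · simp

theorem death_le_birth {lt : Word → ℝ} (h0 : ∀ e, 0 ≤ lt e) {p e : Word} (h : p <+: e)
    (hne : p ≠ e) : death lt p ≤ birth lt e := by
  induction e using List.reverseRecOn with
  | nil => exact absurd (List.prefix_nil.1 h) hne
  | append_singleton e b ih =>
    rw [birth_snoc]
    rcases List.prefix_concat_iff.1 h with h' | h'
    · exact absurd h' hne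
    · by_cases hpe : p = e
      · rw [hpe]
      · exact (ih h' hpe).trans (le_add_of_nonneg_right (h0 e))

/-- The words alive after `n` divisions, in the order of the death times `δ`. -/
def aliveWords (δ : Word → ℝ) : ℕ → Finset Word
  | 0 => {[]}
  | n + 1 => splitLeaves (aliveWords δ n) (strictArgmin (aliveWords δ n) δ)

/-- The word that is divided next after `n` divisions. -/
def nextWord (δ : Word → ℝ) (n : ℕ) : Option Word := strictArgmin (aliveWords δ n) δ

/-- The time of the `n`-th division. It does not advance when two death times tie for the minimum.
-/
def divisionTime (δ : Word → ℝ) : ℕ → ℝ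
  | 0 => 0
  | n + 1 => match nextWord δ n with
    | some e => δ e
    | none => divisionTime δ n

theorem aliveWords_succ (δ : Word → ℝ) (n : ℕ) :
    aliveWords δ (n + 1) = splitLeaves (aliveWords δ n) (nextWord δ n) := rfl

theorem nextWord_eq_some_iff {δ : Word → ℝ} {n : ℕ} {e : Word} :
    nextWord δ n = some e ↔ e ∈ aliveWords δ n ∧ ∀ f ∈ aliveWords δ n, f ≠ e → δ e < δ f :=
  strictArgmin_eq_some_iff

theorem aliveWords_succ_of_some {δ : Word → ℝ} {n : ℕ} {e : Word} (h : nextWord δ n = some e) :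
    aliveWords δ (n + 1) = (aliveWords δ n).erase e ∪ {e ++ [false], e ++ [true]} := by
  rw [aliveWords_succ, h, splitLeaves, if_pos (nextWord_eq_some_iff.1 h).1]

theorem divisionTime_succ_of_some {δ : Word → ℝ} {n : ℕ} {e : Word} (h : nextWord δ n = some e) :
    divisionTime δ (n + 1) = δ e := by
  rw [divisionTime, h]

theorem divisionTime_succ_of_none {δ : Word → ℝ} {n : ℕ} (h : nextWord δ n = none) :
    divisionTime δ (n + 1) = divisionTime δ n := by
  rw [divisionTime, h]

theorem isLeafSet_aliveWords (δ : Word → ℝ) (n : ℕ) : IsLeafSet (aliveWords δ n) := by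
  induction n with
  | zero => exact .root
  | succ n ih => exact ih.splitLeaves _

section Alive

variable {lt : Word → ℝ}

/-- A word alive after `n` divisions was born no later than the `n`-th division and dies no earlier.
-/
theorem birth_le_divisionTime (h0 : ∀ e, 0 ≤ lt e) (n : ℕ) :
    ∀ e ∈ aliveWords (death lt) n, birth lt e ≤ divisionTime (death lt) n ∧
      divisionTime (death lt) n ≤ death lt e := by
  induction n with
  | zero =>
    intro e he
    rw [aliveWords, Finset.mem_singleton] at he
    rw [he, death, birth_nil, divisionTime, zero_add]
    exact ⟨le_rfl, h0 _⟩
  | succ n ih =>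
    intro f hf
    cases ho : nextWord (death lt) n with
    | none =>
      rw [aliveWords_succ, ho] at hf
      rw [divisionTime_succ_of_none ho]
      exact ih f hf
    | some e =>
      rw [aliveWords_succ_of_some ho, mem_split_iff] at hf
      rw [divisionTime_succ_of_some ho]
      have he := nextWord_eq_some_iff.1 ho
      rcases hf with ⟨hfe, hf⟩ | ⟨b, rfl⟩
      · exact ⟨(ih f hf).1.trans (ih e he.1).2, (he.2 f hf hfe).le⟩
      · have h1 := birth_snoc lt e b
        exact ⟨h1.le, h1.symm.le.trans (le_add_of_nonneg_right (h0 _))⟩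

/-- The words alive at time `t` are those alive after the last division before `t`. -/
theorem setOf_alive_eq (h0 : ∀ e, 0 ≤ lt e) (hsome : ∀ n, ∃ e, nextWord (death lt) n = some e)
    {n : ℕ} {t : ℝ} (h1 : divisionTime (death lt) n ≤ t)
    (h2 : t < divisionTime (death lt) (n + 1)) :
    {e | birth lt e ≤ t ∧ t < death lt e} = (aliveWords (death lt) n : Set Word) := by
  have hin : ∀ e ∈ aliveWords (death lt) n, birth lt e ≤ t ∧ t < death lt e := by
    intro e he
    refine ⟨(birth_le_divisionTime h0 n e he).1.trans h1, h2.trans_le ?_⟩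
    obtain ⟨f, hf⟩ := hsome n
    rw [divisionTime_succ_of_some hf]
    by_cases hef : e = f
    · rw [hef]
    · exact ((nextWord_eq_some_iff.1 hf).2 e he hef).le
  ext e
  refine ⟨fun he => ?_, hin e⟩
  obtain ⟨f, hf, hef⟩ := (isLeafSet_aliveWords (death lt) n).exists_comparable e
  by_cases heq : e = f
  · rw [heq]
    exact hf
  have hf' := hin f hf
  rcases hef with h | h
  · exact absurd (he.2.trans_le ((death_le_birth h0 h heq).trans hf'.1)) (lt_irrefl _)
  · exact absurd (hf'.2.trans_le ((death_le_birth h0 h (Ne.symm heq)).trans he.1)) (lt_irrefl _)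

end Alive

/-! ### The jumps of the STIT tessellation -/

variable {ℓ : ℕ}

/-- The rate at which the cell of the word `e` is divided, when the hyperplanes of all words are
given by `H`. -/
def cellRate (Λ : Measure (Hyp ℓ)) (W : Window ℓ) (H : Word → Hyp ℓ) (e : Word) : ℝ :=
  (Λ (hit (pathCell W.carrier H e))).toReal

/-- The lifetime of the cell of the word `e`. -/
def cellLife (Λ : Measure (Hyp ℓ)) (W : Window ℓ) (z : Word → ℝ) (H : Word → Hyp ℓ) (e : Word) :
    ℝ :=
  (cellRate Λ W H e)⁻¹ * z e

theorem cellLife_nonneg {Λ : Measure (Hyp ℓ)} {W : Window ℓ} {z : Word → ℝ} (hz : ∀ e, 0 ≤ z e)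
    (H : Word → Hyp ℓ) (e : Word) : 0 ≤ cellLife Λ W z H e :=
  mul_nonneg (inv_nonneg.2 ENNReal.toReal_nonneg) (hz e)

variable [Inhabited (Hyp ℓ)]

/-- The jumps of the process in which the cell of the word `e` lives for the time
`cellLife Λ W z H e` and is then divided by `H e`. -/
def stitData (Λ : Measure (Hyp ℓ)) (W : Window ℓ) (z : Word → ℝ) (H : Word → Hyp ℓ) (n : ℕ) :
    Datum ℓ :=
  (divisionTime (death (cellLife Λ W z H)) (n + 1) - divisionTime (death (cellLife Λ W z H)) n,
    nextWord (death (cellLife Λ W z H)) n,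
    match nextWord (death (cellLife Λ W z H)) n with
    | some e => H e
    | none => default)

section StitData

variable {Λ : Measure (Hyp ℓ)} {W : Window ℓ} {z : Word → ℝ} {H : Word → Hyp ℓ}

theorem leaves_stitData (n : ℕ) :
    leaves (stitData Λ W z H) n = aliveWords (death (cellLife Λ W z H)) n := by
  induction n with
  | zero => rfl
  | succ n ih => rw [leaves, ih, aliveWords_succ]; rfl

theorem jumpOf_stitData (n : ℕ) :
    jumpOf (stitData Λ W z H) n = divisionTime (death (cellLife Λ W z H)) n := by
  simp only [jumpOf, stitData]
  rw [Finset.sum_range_sub]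
  simp [divisionTime]

/-- The hyperplanes of all proper prefixes of the words alive after `n` divisions are recorded in
the history. -/
theorem hypMap_stitData (n : ℕ) : ∀ e ∈ leaves (stitData Λ W z H) n, ∀ i < e.length,
    hypMap (stitData Λ W z H) n (e.take i) = H (e.take i) := by
  induction n with
  | zero =>
    intro e he i hi
    rw [leaves, Finset.mem_singleton] at he
    rw [he] at hi
    exact absurd hi (Nat.not_lt_zero _)
  | succ n ih =>
    intro f hf i hi
    have hE := isLeafSet_leaves (stitData Λ W z H) n
    cases ho : nextWord (death (cellLife Λ W z H)) n with
    | none =>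
      have ho' : (stitData Λ W z H n).2.1 = none := ho
      rw [leaves, ho'] at hf
      rw [hypMap, ho']
      exact ih f hf i hi
    | some e =>
      have ho' : (stitData Λ W z H n).2.1 = some e := ho
      have hy : (stitData Λ W z H n).2.2 = H e := by simp only [stitData, ho]
      have he : e ∈ leaves (stitData Λ W z H) n := by
        rw [leaves_stitData]
        exact (nextWord_eq_some_iff.1 ho).1
      rw [leaves, ho', splitLeaves, if_pos he, mem_split_iff] at hf
      rw [hypMap, ho', hy, splitHyp, if_pos he]
      by_cases hfe : f.take i = e
      · rw [hfe, Function.update_self]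
      rw [Function.update_of_ne hfe]
      rcases hf with ⟨-, hf⟩ | ⟨b, rfl⟩
      · exact ih f hf i hi
      · rw [List.length_append, List.length_singleton] at hi
        rcases Nat.lt_succ_iff_lt_or_eq.1 hi with hi | hi
        · rw [List.take_append_of_le_length hi.le]
          exact ih e he i hi
        · rw [hi] at hfe
          exact absurd (by simp) hfe

theorem pathCell_hypMap_stitData {n : ℕ} {e : Word} (he : e ∈ leaves (stitData Λ W z H) n) :
    pathCell W.carrier (hypMap (stitData Λ W z H) n) e = pathCell W.carrier H e :=
  pathCell_congr _ (hypMap_stitData n e he)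

theorem rate_stitData {n : ℕ} {e : Word} (he : e ∈ leaves (stitData Λ W z H) n) :
    rate Λ W n (stitData Λ W z H) e = cellRate Λ W H e := by
  rw [rate, pathCell_hypMap_stitData he, cellRate]

theorem rate_congr {n : ℕ} {S S' : ℕ → Datum ℓ} (h : ∀ j < n, S j = S' j) :
    rate Λ W n S = rate Λ W n S' := by
  unfold rate
  rw [hypMap_congr h]

theorem strictArgmin_sub_const (L : Finset Word) (ρ δ : Word → ℝ) (c : ℝ)
    (h : ∀ e ∈ L, ρ e = δ e - c) : strictArgmin L ρ = strictArgmin L δ := by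
  ext e
  rw [strictArgmin_eq_some_iff, strictArgmin_eq_some_iff]
  refine and_congr_right fun he => forall₂_congr fun f hf => ?_
  rw [h e he, h f hf, sub_lt_sub_iff_right]

/-- The competing clocks produce the jumps of the process in which the lifetimes are given by the
clocks, and the hyperplanes are drawn from the supplies by rejection sampling. -/
theorem chainData_eq_stitData (ω : Word → ℝ × Supply ℓ)
    (hgood : ∀ n, Good W n (chainData (clockD Λ W) (clockR Λ W) ω))
    (hΛ : IsHyperplaneMeasure Λ)
    (hH : ∀ e, H e = firstIn (hit (pathCell W.carrier H e)) (ω e).2.1) :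
    chainData (clockD Λ W) (clockR Λ W) ω = stitData Λ W (fun e => (ω e).1) H := by
  set d := chainData (clockD Λ W) (clockR Λ W) ω with hd
  set s := stitData Λ W (fun e => (ω e).1) H with hs
  set lt := cellLife Λ W (fun e => (ω e).1) H with hlt
  set T := divisionTime (death lt) with hT
  -- the remaining times of the clocks, and the clocks that have not been started
  have key : ∀ n, (∀ j < n, d j = s j) ∧
      (∀ e ∈ leaves s n, (chain (clockD Λ W) (clockR Λ W) ω n).2 e
        = ((ω e).1 - cellRate Λ W H e * (T n - birth lt e), (ω e).2)) ∧
      ∀ f, (∃ e ∈ leaves s n, e <+: f ∧ e ≠ f) →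
        (chain (clockD Λ W) (clockR Λ W) ω n).2 f = ω f := by
    intro n
    induction n with
    | zero =>
      refine ⟨fun j hj => absurd hj (Nat.not_lt_zero j), fun e he => ?_, fun f _ => rfl⟩
      rw [leaves, Finset.mem_singleton] at he
      rw [he, birth_nil, hT, divisionTime, sub_zero, mul_zero, sub_zero]
      rfl
    | succ n ih =>
      obtain ⟨ih1, ih2, ih3⟩ := ih
      set c := chain (clockD Λ W) (clockR Λ W) ω n with hc
      have hcs : ∀ j < n, c.1 j = s j := fun j hj => by
        rw [hc, chain_fst, trunc_apply hj]
        exact ih1 j hj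
      have hE := isLeafSet_leaves s n
      have hleaf : leaves s n = aliveWords (death lt) n := leaves_stitData n
      have hdn : d n = clockD Λ W n c := rfl
      have hRn : (chain (clockD Λ W) (clockR Λ W) ω (n + 1)).2 = clockR Λ W n c := rfl
      have hrate : ∀ e ∈ leaves s n, rate Λ W n s e = cellRate Λ W H e := fun e he =>
        rate_stitData he
      have hpos : ∀ e ∈ leaves s n, 0 < cellRate Λ W H e := by
        intro e he
        rw [← hrate e he]
        refine hΛ.rate_pos ?_ he
        have := hgood n
        rwa [good_congr ih1] at this
      have hcell : ∀ e ∈ leaves s n, pathCell W.carrier (hypMap s n) e = pathCell W.carrier H e :=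
        fun e he => pathCell_hypMap_stitData he
      have hρ : ∀ e ∈ leaves s n, (rate Λ W n s e)⁻¹ * (c.2 e).1 = death lt e - T n := by
        intro e he
        have := hpos e he
        rw [hrate e he, ih2 e he, death]
        simp only [hlt, cellLife]
        field_simp
        ring
      have hargmin : strictArgmin (leaves s n) (fun e => (rate Λ W n s e)⁻¹ * (c.2 e).1)
          = nextWord (death lt) n := by
        rw [strictArgmin_sub_const _ _ _ _ hρ, hleaf]
        rfl
      rw [clockD, leaves_congr hcs, rate_congr hcs, hypMap_congr hcs, clockDatum, hargmin] at hdn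
      rw [clockR, leaves_congr hcs, rate_congr hcs, hypMap_congr hcs, clockRenew, hargmin] at hRn
      cases ho : nextWord (death lt) n with
      | none =>
        rw [ho] at hdn hRn
        simp only at hdn hRn
        have hTn : T (n + 1) = T n := divisionTime_succ_of_none ho
        have hln : leaves s (n + 1) = leaves s n := by
          rw [leaves]
          have : (s n).2.1 = none := ho
          rw [this]
          rfl
        refine ⟨fun j hj => ?_, ?_, ?_⟩
        · rcases Nat.lt_succ_iff_lt_or_eq.1 hj with hj | rfl
          · exact ih1 j hj
          · rw [hdn, hs]
            simp only [stitData, ← hlt, ho, ← hT, hTn, sub_self]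
        · rw [hRn, hln, hTn]
          exact ih2
        · rw [hRn, hln]
          exact ih3
      | some e =>
        rw [ho] at hdn hRn
        simp only at hdn hRn
        have he : e ∈ leaves s n := by
          rw [hleaf]
          exact (nextWord_eq_some_iff.1 ho).1
        have hTn : T (n + 1) = death lt e := divisionTime_succ_of_some ho
        have hln : leaves s (n + 1) = (leaves s n).erase e ∪ {e ++ [false], e ++ [true]} := by
          rw [leaves]
          have : (s n).2.1 = some e := ho
          rw [this, splitLeaves, if_pos he]
        have hsub : ∀ f ∈ leaves s (n + 1), ∀ f', f <+: f' → f ≠ f' →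
            ∃ e' ∈ leaves s n, e' <+: f' ∧ e' ≠ f' := by
          intro f hf f' hff' hne
          rw [hln, mem_split_iff] at hf
          rcases hf with ⟨-, hf⟩ | ⟨b, rfl⟩
          · exact ⟨f, hf, hff', hne⟩
          · refine ⟨e, he, (List.prefix_append e [b]).trans hff', ?_⟩
            rintro rfl
            have := hff'.length_le
            simp at this
        have hfresh : ∀ f, (∃ e' ∈ leaves s n, e' <+: f ∧ e' ≠ f) →
            (chain (clockD Λ W) (clockR Λ W) ω (n + 1)).2 f = ω f := by
          rintro f ⟨e', he', hp, hne⟩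
          have hf : f ∉ leaves s n := fun hf => hne (hE.eq_of_prefix he' hf hp)
          rw [hRn, Function.update_of_ne fun h => hf (by rw [h]; exact he), runClocks,
            if_neg fun h => hf (Finset.mem_of_mem_erase h)]
          exact ih3 f ⟨e', he', hp, hne⟩
        refine ⟨fun j hj => ?_, fun f hf => ?_, fun f hf => ?_⟩
        · rcases Nat.lt_succ_iff_lt_or_eq.1 hj with hj | rfl
          · exact ih1 j hj
          · rw [hdn, hs]
            simp only [stitData, ← hlt, ho, ← hT, hTn]
            rw [hρ e he, ih2 e he, hcell e he]
            simp only [consume]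
            rw [← hH e]
        · rw [hln, mem_split_iff] at hf
          rcases hf with ⟨hfe, hf⟩ | ⟨b, rfl⟩
          · rw [hRn, Function.update_of_ne hfe, runClocks,
              if_pos (Finset.mem_erase.2 ⟨hfe, hf⟩), hρ e he, ih2 f hf, hrate f hf, hTn]
            refine Prod.ext ?_ rfl
            simp only
            ring
          · rw [hfresh (e ++ [b]) ⟨e, he, List.prefix_append _ _, by simp⟩, hTn, birth_snoc,
              sub_self, mul_zero, sub_zero]
        · obtain ⟨e', he', hp, hne⟩ := hf
          exact hfresh f (hsub e' he' f hp hne)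
  ext1 n
  exact (key (n + 1)).1 n (Nat.lt_succ_self n)

end StitData

theorem IsHyperplaneMeasure.measurable_stitData {Λ : Measure (Hyp ℓ)} (hΛ : IsHyperplaneMeasure Λ)
    (W : Window ℓ) :
    Measurable fun p : (Word → ℝ) × (Word → Hyp ℓ) => stitData Λ W p.1 p.2 := by
  have hlt : ∀ e, Measurable fun p : (Word → ℝ) × (Word → Hyp ℓ) => cellLife Λ W p.1 p.2 e := by
    intro e
    have h1 := ((hΛ.measurable_hit_pathCell W e).comp
      (show Measurable fun p : (Word → ℝ) × (Word → Hyp ℓ) => p.2 by fun_prop)).ennreal_toReal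
    exact h1.inv.mul (by fun_prop)
  have hδ : ∀ e, Measurable fun p : (Word → ℝ) × (Word → Hyp ℓ) =>
      death (cellLife Λ W p.1 p.2) e := fun e =>
    (Finset.measurable_sum _ fun i _ => hlt _).add (hlt e)
  have hnext : ∀ n, Measurable (fun p : (Word → ℝ) × (Word → Hyp ℓ) =>
      aliveWords (death (cellLife Λ W p.1 p.2)) n) →
      Measurable fun p : (Word → ℝ) × (Word → Hyp ℓ) =>
        nextWord (death (cellLife Λ W p.1 p.2)) n := fun n hn =>
    measurable_of_countable_cases hn
      (F := fun E (p : (Word → ℝ) × (Word → Hyp ℓ)) => strictArgmin E (death (cellLife Λ W p.1 p.2)))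
      fun E => measurable_strictArgmin E hδ
  have halive : ∀ n, Measurable fun p : (Word → ℝ) × (Word → Hyp ℓ) =>
      aliveWords (death (cellLife Λ W p.1 p.2)) n := by
    intro n
    induction n with
    | zero => exact measurable_const
    | succ n ih =>
      have h1 : Measurable fun q : Finset Word × Option Word => splitLeaves q.1 q.2 :=
        measurable_from_prod_countable_right fun _ => Measurable.of_discrete
      have h2 := h1.comp (ih.prodMk (hnext n ih))
      exact h2
  have htime : ∀ n, Measurable fun p : (Word → ℝ) × (Word → Hyp ℓ) =>
      divisionTime (death (cellLife Λ W p.1 p.2)) n := by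
    intro n
    induction n with
    | zero => exact measurable_const
    | succ n ih =>
      refine measurable_of_countable_cases (hnext n (halive n))
        (F := fun o (p : (Word → ℝ) × (Word → Hyp ℓ)) => match o with
          | some e => death (cellLife Λ W p.1 p.2) e
          | none => divisionTime (death (cellLife Λ W p.1 p.2)) n) fun o => ?_
      cases o with
      | none => exact ih
      | some e => exact hδ e
  refine measurable_pi_iff.2 fun n => ?_
  refine ((htime (n + 1)).sub (htime n)).prodMk ((hnext n (halive n)).prodMk ?_)
  refine measurable_of_countable_cases (hnext n (halive n))
    (F := fun o (p : (Word → ℝ) × (Word → Hyp ℓ)) => match o with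
      | some e => p.2 e
      | none => default) fun o => ?_
  cases o with
  | none => exact measurable_const
  | some e => exact (measurable_pi_apply e).comp measurable_snd

end STIT

namespace STIT

/-! ### Divergence of the jump times -/

theorem lintegral_exp_neg_mul_expMeasure_one {c : ℝ} (hc : 0 ≤ c) :
    ∫⁻ x, ENNReal.ofReal (Real.exp (-(c * x))) ∂expMeasure 1 = ENNReal.ofReal (1 + c)⁻¹ := by
  have h1 : ∫⁻ x in Ioi (0 : ℝ), ENNReal.ofReal (Real.exp (-x)) = 1 := by
    have := lintegral_expMeasure_one (fun _ => 1) measurable_const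
    simpa using this.symm
  have h2 := lintegral_Ioi_comp_mul_left (c := 1 + c) (by linarith)
    (fun x => ENNReal.ofReal (Real.exp (-x))) (by fun_prop)
  rw [h1, mul_one] at h2
  rw [lintegral_expMeasure_one _ (by fun_prop), ← h2]
  refine lintegral_congr fun x => ?_
  rw [← ENNReal.ofReal_mul (Real.exp_pos _).le, ← Real.exp_add]
  congr 2
  ring

/-- By independence the expectation is the telescoping product of the factors
`1 / (1 + 1 / (j + k + 1)) = (j + k + 1) / (j + k + 2)`. The shift `k` makes induction on the first
term possible. -/
theorem lintegral_exp_neg_harmonic (n k : ℕ) :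
    ∫⁻ v, ENNReal.ofReal (Real.exp (-∑ j ∈ Finset.range n, v j / ((j : ℝ) + k + 1)))
      ∂Measure.infinitePi (fun _ : ℕ => expMeasure 1)
      = ENNReal.ofReal (((k : ℝ) + 1) / (n + k + 1)) := by
  induction n generalizing k with
  | zero =>
    have : ((k : ℝ) + 1) / (k + 1) = 1 := div_self (by positivity)
    simp [this]
  | succ n ih =>
    have h1 : ∀ v : ℕ → ℝ, ENNReal.ofReal (Real.exp
        (-∑ j ∈ Finset.range (n + 1), v j / ((j : ℝ) + k + 1)))
        = (fun p : ℝ × (ℕ → ℝ) => ENNReal.ofReal (Real.exp (-(((k : ℝ) + 1)⁻¹ * p.1))) *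
          ENNReal.ofReal (Real.exp (-∑ j ∈ Finset.range n, p.2 j / ((j : ℝ) + (k + 1 : ℕ) + 1))))
          (v 0, fun j => v (j + 1)) := by
      intro v
      simp only
      rw [← ENNReal.ofReal_mul (Real.exp_pos _).le, ← Real.exp_add, Finset.sum_range_succ']
      congr 2
      have h2 : ∀ j ∈ Finset.range n, v (j + 1) / (((j + 1 : ℕ) : ℝ) + k + 1)
          = v (j + 1) / ((j : ℝ) + (k + 1 : ℕ) + 1) := by
        intro j _
        push_cast
        congr 1
        ring
      rw [Finset.sum_congr rfl h2]
      push_cast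
      rw [div_eq_inv_mul (v 0)]
      ring
    have hm1 : Measurable fun x : ℝ => ENNReal.ofReal (Real.exp (-(((k : ℝ) + 1)⁻¹ * x))) := by
      fun_prop
    have hm2 : Measurable fun v : ℕ → ℝ => ENNReal.ofReal (Real.exp
        (-∑ j ∈ Finset.range n, v j / ((j : ℝ) + (k + 1 : ℕ) + 1))) := by
      fun_prop
    simp only [h1]
    rw [← lintegral_map (f := fun p : ℝ × (ℕ → ℝ) =>
      ENNReal.ofReal (Real.exp (-(((k : ℝ) + 1)⁻¹ * p.1))) *
        ENNReal.ofReal (Real.exp (-∑ j ∈ Finset.range n, p.2 j / ((j : ℝ) + (k + 1 : ℕ) + 1))))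
      (g := fun v : ℕ → ℝ => (v 0, fun j => v (j + 1)))
      ((hm1.comp measurable_fst).mul (hm2.comp measurable_snd)) (by fun_prop),
      map_head_tail_infinitePi, lintegral_prod_mul hm1.aemeasurable hm2.aemeasurable, ih,
      lintegral_exp_neg_mul_expMeasure_one (by positivity),
      ← ENNReal.ofReal_mul (by positivity)]
    congr 1
    push_cast
    field_simp
    ring

/-- The sums increase, and the expectation of the exponential of their negatives is `1 / (n + 1)`,
which excludes a finite limit. -/
theorem ae_tendsto_harmonic_expMeasure :
    ∀ᵐ v ∂Measure.infinitePi (fun _ : ℕ => expMeasure 1), (∀ j, 0 ≤ v j) ∧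
      Tendsto (fun n => ∑ j ∈ Finset.range n, v j / ((j : ℝ) + 1)) atTop atTop := by
  set μ := Measure.infinitePi (fun _ : ℕ => expMeasure 1) with hμ
  have hpos : ∀ᵐ v ∂μ, ∀ j, 0 ≤ v j := by
    rw [ae_all_iff]
    exact fun j => (measurePreserving_eval_infinitePi (fun _ : ℕ => expMeasure 1)
      j).quasiMeasurePreserving.ae expMeasure_one_ae_nonneg
  set X : ℕ → (ℕ → ℝ) → ℝ≥0∞ := fun n v =>
    ENNReal.ofReal (Real.exp (-∑ j ∈ Finset.range n, v j / ((j : ℝ) + 1))) with hX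
  have hXm : ∀ n, Measurable (X n) := fun n => by
    simp only [hX]
    fun_prop
  have hXint : ∀ n, ∫⁻ v, X n v ∂μ = ENNReal.ofReal (1 / ((n : ℝ) + 1)) := by
    intro n
    have := lintegral_exp_neg_harmonic n 0
    simpa using this
  have hzero : ∀ᵐ v ∂μ, ⨅ n, X n v = 0 := by
    have h1 : ∫⁻ v, ⨅ n, X n v ∂μ = 0 := by
      refine le_antisymm ?_ zero_le
      have h2 : Tendsto (fun n : ℕ => ENNReal.ofReal (1 / ((n : ℝ) + 1))) atTop (𝓝 0) := by
        have := (ENNReal.continuous_ofReal.tendsto 0).comp tendsto_one_div_add_atTop_nhds_zero_nat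
        simpa [Function.comp_def] using this
      refine ge_of_tendsto h2 (Eventually.of_forall fun n => ?_)
      rw [← hXint n]
      exact lintegral_mono fun v => iInf_le _ n
    exact (lintegral_eq_zero_iff (Measurable.iInf hXm)).1 h1
  filter_upwards [hpos, hzero] with v hv hz
  refine ⟨hv, ?_⟩
  have hmono : Monotone fun n => ∑ j ∈ Finset.range n, v j / ((j : ℝ) + 1) := by
    refine monotone_nat_of_le_succ fun n => ?_
    rw [Finset.sum_range_succ]
    exact le_add_of_nonneg_right (div_nonneg (hv n) (by positivity))
  rcases tendsto_atTop_of_monotone hmono with h | ⟨l, hl⟩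
  · exact h
  · exfalso
    have h1 : ENNReal.ofReal (Real.exp (-l)) ≤ ⨅ n, X n v := by
      refine le_iInf fun n => ENNReal.ofReal_le_ofReal (Real.exp_le_exp.2 (neg_le_neg ?_))
      exact hmono.ge_of_tendsto hl n
    rw [hz] at h1
    have h2 : 0 < ENNReal.ofReal (Real.exp (-l)) := ENNReal.ofReal_pos.2 (Real.exp_pos _)
    exact absurd h1 (not_le.2 h2)

/-! ### The driving random variables -/

variable {ℓ : ℕ}

theorem ae_of_hasLaw {Ω X : Type*} [MeasurableSpace Ω] [MeasurableSpace X] {P : Measure Ω}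
    {μ : Measure X} {f : Ω → X} (hf : HasLaw f μ P) {p : X → Prop} (h : ∀ᵐ x ∂μ, p x) :
    ∀ᵐ ω ∂P, p (f ω) := by
  rw [← hf.map_eq] at h
  exact ae_of_ae_map hf.aemeasurable h

/-- Three independent i.i.d. sequences are one i.i.d. sequence of triples with independent
components. -/
theorem hasLaw_noiseLaw {Λ : Measure (Hyp ℓ)} (hΛ : IsHyperplaneMeasure Λ)
    (W : Window ℓ) {Ω : Type*} [MeasurableSpace Ω] (P : Measure Ω) [IsProbabilityMeasure P]
    {U V : ℕ → Ω → ℝ} {G : ℕ → Ω → Hyp ℓ}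
    (hU : HasLaw (fun ω n => U n ω)
      (Measure.infinitePi fun _ : ℕ => volume.restrict (Ico (0 : ℝ) 1)) P)
    (hV : HasLaw (fun ω n => V n ω) (Measure.infinitePi fun _ : ℕ => expMeasure 1) P)
    (hG : HasLaw (fun ω n => G n ω) (Measure.infinitePi fun _ : ℕ => normalized Λ W.carrier) P)
    (hUVG : IndepFun (fun ω n => U n ω) (fun ω => ((fun n => V n ω), (fun n => G n ω))) P)
    (hVG : IndepFun (fun ω n => V n ω) (fun ω n => G n ω) P) :
    HasLaw (fun ω n => (U n ω, V n ω, G n ω)) (noiseLaw Λ W) P := by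
  have hνp := hΛ.isProbabilityMeasure_window W
  have hunif : IsProbabilityMeasure (volume.restrict (Ico (0 : ℝ) 1)) := ⟨by simp⟩
  have h1 := hUVG.hasLaw_prod hU (hVG.hasLaw_prod hV hG)
  set zip : (ℕ → ℝ) × (ℕ → ℝ) × (ℕ → Hyp ℓ) → ℕ → ℝ × ℝ × Hyp ℓ := fun p n =>
    (p.1 n, p.2.1 n, p.2.2 n) with hzip
  have hzm : Measurable zip := by
    simp only [hzip]
    fun_prop
  refine ⟨hzm.comp_aemeasurable h1.aemeasurable, ?_⟩
  have h2 : MeasurePreserving (fun ω : ℕ → ℝ × ℝ × Hyp ℓ => (fun n => (ω n).1, fun n => (ω n).2))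
      (noiseLaw Λ W) _ := ⟨by fun_prop, map_unzip_infinitePi _ _⟩
  have h3 : MeasurePreserving (fun ω : ℕ → ℝ × Hyp ℓ => (fun n => (ω n).1, fun n => (ω n).2))
      (Measure.infinitePi fun _ : ℕ => (expMeasure 1).prod (normalized Λ W.carrier)) _ :=
    ⟨by fun_prop, map_unzip_infinitePi _ _⟩
  have h4 := ((MeasurePreserving.id (Measure.infinitePi fun _ : ℕ =>
    volume.restrict (Ico (0 : ℝ) 1))).prod h3).comp h2
  have h5 : (fun ω n => (U n ω, V n ω, G n ω))
      = zip ∘ fun ω => ((fun n => U n ω), (fun n => V n ω), fun n => G n ω) := rfl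
  rw [h5, ← AEMeasurable.map_map_of_aemeasurable hzm.aemeasurable h1.aemeasurable, h1.map_eq,
    ← h4.map_eq, Measure.map_map hzm h4.measurable]
  exact Measure.map_id

/-! ### Paths of regular histories -/

theorem measurable_sSup_nat {α : Type*} [MeasurableSpace α] {p : ℕ → α → Prop}
    (hp : ∀ k, MeasurableSet {x | p k x}) : Measurable fun x => sSup {k | p k x} := by
  refine measurable_to_countable' fun k => ?_
  have hset : (fun x => sSup {k | p k x}) ⁻¹' {k}
      = ({x | p k x} ∩ ⋂ j, ⋂ (_ : k < j), {x | p j x}ᶜ) ∪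
        ({_x | k = 0} ∩ ⋂ m, ({x | p m x} ∩ ⋂ j, ⋂ (_ : m < j), {x | p j x}ᶜ)ᶜ) := by
    ext x
    simp only [mem_preimage, mem_singleton_iff, mem_union, mem_inter_iff, mem_ofPred_eq,
      mem_iInter, mem_compl_iff, not_and]
    have hmax : ∀ m, p m x → (∀ j, m < j → ¬ p j x) → sSup {k | p k x} = m := by
      intro m h1 h2
      refine IsGreatest.csSup_eq ⟨h1, fun j hj => ?_⟩
      by_contra hlt
      exact h2 j (not_le.1 hlt) hj
    constructor
    · rintro rfl
      by_cases hb : ∃ m, p m x ∧ ∀ j, m < j → ¬ p j x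
      · obtain ⟨m, h1, h2⟩ := hb
        rw [hmax m h1 h2]
        exact Or.inl ⟨h1, h2⟩
      · refine Or.inr ⟨?_, fun m h1 h2 => hb ⟨m, h1, h2⟩⟩
        by_cases hbdd : BddAbove {k | p k x}
        · by_cases hne : {k | p k x}.Nonempty
          · exact absurd ⟨_, Nat.sSup_mem hne hbdd, fun j hj h =>
              absurd (le_csSup hbdd h) (not_le.2 hj)⟩ hb
          · rw [not_nonempty_iff_eq_empty.1 hne, csSup_empty]
            rfl
        · exact Nat.sSup_of_not_bddAbove hbdd
    · rintro (⟨h1, h2⟩ | ⟨rfl, h⟩)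
      · exact hmax k h1 h2
      · by_cases hbdd : BddAbove {k | p k x}
        · by_cases hne : {k | p k x}.Nonempty
          · exact absurd (fun j hj h' => absurd (le_csSup hbdd h') (not_le.2 hj))
              (h _ (Nat.sSup_mem hne hbdd))
          · rw [not_nonempty_iff_eq_empty.1 hne, csSup_empty]
            rfl
        · exact Nat.sSup_of_not_bddAbove hbdd
  have hlast : ∀ m, MeasurableSet ({x | p m x} ∩ ⋂ j, ⋂ (_ : m < j), {x | p j x}ᶜ) := fun m =>
    (hp m).inter (MeasurableSet.iInter fun j => MeasurableSet.iInter fun _ => (hp j).compl)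
  rw [hset]
  exact (hlast k).union ((MeasurableSet.const _).inter
    (MeasurableSet.iInter fun m => (hlast m).compl))

theorem measurable_jumpOf (n : ℕ) : Measurable fun d : ℕ → Datum ℓ => jumpOf d n := by
  unfold jumpOf
  fun_prop

variable [Inhabited (Hyp ℓ)]

theorem measurable_pathOf (W : Window ℓ) : Measurable (pathOf (ℓ := ℓ) W) := by
  refine measurable_pi_iff.2 fun t => ?_
  exact measurable_of_countable_cases
    (measurable_sSup_nat fun n => measurableSet_le (measurable_jumpOf n) measurable_const)
    (F := fun n d => tessOf W n d) fun n => measurable_tessOf W n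

/-- In every step a cell is divided, all cells that appear have interior points, and there are
finitely many steps in finite time. -/
def Regular (W : Window ℓ) (d : ℕ → Datum ℓ) : Prop :=
  (∀ n, Proper W n d) ∧ Tendsto (jumpOf d) atTop atTop

theorem measurableSet_regular (W : Window ℓ) : MeasurableSet {d : ℕ → Datum ℓ | Regular W d} := by
  have h1 : {d : ℕ → Datum ℓ | Regular W d}
      = (⋂ n, {d | Proper W n d}) ∩ {d | Tendsto (fun n => jumpOf d n) atTop atTop} := by
    ext d
    simp [Regular]
  rw [h1]
  exact (MeasurableSet.iInter fun n => measurableSet_proper W n).inter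
    (measurableSet_tendsto _ measurable_jumpOf)

theorem proper_congr {W : Window ℓ} {n : ℕ} {d d' : ℕ → Datum ℓ} (h : ∀ j < n, d j = d' j) :
    Proper W n d ↔ Proper W n d' := by
  refine and_congr (good_congr h) (forall₂_congr fun j hj => ?_)
  rw [leaves_congr fun i hi => h i (by omega), h j hj]

variable {Λ : Measure (Hyp ℓ)} {W : Window ℓ}

/-- The law of the jumps of the tessellation process. -/
def jumpsLaw (Λ : Measure (Hyp ℓ)) (W : Window ℓ) : Measure (ℕ → Datum ℓ) :=
  (clockSource Λ W).map (chainData (clockD Λ W) (clockR Λ W))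

theorem IsHyperplaneMeasure.measurable_chainData_clock (hΛ : IsHyperplaneMeasure Λ)
    (W : Window ℓ) : Measurable (chainData (clockD Λ W) (clockR Λ W)) :=
  measurable_chainData (fun n => (hΛ.measurable_clock W n).fst)
    fun n => (hΛ.measurable_clock W n).snd

theorem IsHyperplaneMeasure.ae_proper (hΛ : IsHyperplaneMeasure Λ) (W : Window ℓ) :
    ∀ᵐ ω ∂clockSource Λ W, ∀ n, Proper W n (chainData (clockD Λ W) (clockR Λ W) ω) := by
  rw [ae_all_iff]
  intro n
  have h1 := ae_of_ae_map (measurable_chain (fun n => (hΛ.measurable_clock W n).fst)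
    (fun n => (hΛ.measurable_clock W n).snd) n).fst.aemeasurable (hΛ.map_chain_clock W n).2
  filter_upwards [h1] with ω hω
  rw [chain_fst] at hω
  exact (proper_congr fun j hj => trunc_apply hj _).1 hω

theorem IsHyperplaneMeasure.ae_jumpsLaw_proper (hΛ : IsHyperplaneMeasure Λ) (W : Window ℓ) :
    ∀ᵐ d ∂jumpsLaw Λ W, ∀ n, Proper W n d := by
  rw [jumpsLaw, ae_map_iff (hΛ.measurable_chainData_clock W).aemeasurable]
  · exact hΛ.ae_proper W
  · have : {d : ℕ → Datum ℓ | ∀ n, Proper W n d} = ⋂ n, {d | Proper W n d} := by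
      ext d
      simp
    change MeasurableSet {d : ℕ → Datum ℓ | ∀ n, Proper W n d}
    rw [this]
    exact MeasurableSet.iInter fun n => measurableSet_proper W n

/-- After `n` jumps there are at most `n + 1` cells, so that the rates grow at most linearly. -/
theorem IsHyperplaneMeasure.tendsto_jumpOf (hΛ : IsHyperplaneMeasure Λ) {d : ℕ → Datum ℓ}
    {v : ℕ → ℝ} (hd : ∀ n, (d n).1 = (∑ e ∈ leaves d n, rate Λ W n d e)⁻¹ * v n)
    (hg : ∀ n, Good W n d) (hv : ∀ n, 0 ≤ v n)
    (hlim : Tendsto (fun n => ∑ j ∈ Finset.range n, v j / ((j : ℝ) + 1)) atTop atTop) :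
    Tendsto (jumpOf d) atTop atTop := by
  set r := (Λ (hit W.carrier)).toReal with hr
  have hr0 : 0 < r :=
    ENNReal.toReal_pos (hΛ.hit_pos W.isCell.2).ne' (hΛ.hit_lt_top W.isCompact).ne
  have hrate : ∀ n e, rate Λ W n d e ≤ r := fun n e =>
    ENNReal.toReal_mono (hΛ.hit_lt_top W.isCompact).ne
      (measure_mono (hit_mono (pathCell_subset _ _ _)))
  refine tendsto_atTop_mono (fun n => ?_) (hlim.const_mul_atTop (inv_pos.2 hr0))
  rw [Finset.mul_sum, jumpOf]
  refine Finset.sum_le_sum fun j _ => ?_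
  have h1 : ∑ e ∈ leaves d j, rate Λ W j d e ≤ r * ((j : ℝ) + 1) := by
    refine (Finset.sum_le_card_nsmul _ _ r fun e _ => hrate j e).trans ?_
    rw [nsmul_eq_mul, mul_comm]
    refine mul_le_mul_of_nonneg_left ?_ hr0.le
    exact_mod_cast card_leaves_le d j
  have h2 : 0 < ∑ e ∈ leaves d j, rate Λ W j d e :=
    Finset.sum_pos (fun e he => hΛ.rate_pos (hg j) he) (isLeafSet_leaves d j).nonempty
  rw [hd j, div_eq_inv_mul, ← mul_assoc, ← mul_inv]
  exact mul_le_mul_of_nonneg_right (inv_anti₀ h2 h1) (hv j)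

/-- The cells of the STIT tessellation that are alive at a given time are those that are present
after the last division before this time. -/
theorem stitCells_eq {z : Word → ℝ} {g : ℕ → Hyp ℓ} (hz : ∀ e, 0 ≤ z e)
    (hreg : Regular W (stitData Λ W z (stitHyp W.carrier g))) (t : ℝ≥0) :
    ∃ n, n = sSup {n : ℕ | jumpOf (stitData Λ W z (stitHyp W.carrier g)) n ≤ t} ∧
      stitCells Λ W.carrier z g t
        = pathCell W.carrier (hypMap (stitData Λ W z (stitHyp W.carrier g)) n) ''
          (leaves (stitData Λ W z (stitHyp W.carrier g)) n : Set Word) := by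
  set s := stitData Λ W z (stitHyp W.carrier g) with hs
  set lt := cellLife Λ W z (stitHyp W.carrier g) with hlt
  refine ⟨_, rfl, ?_⟩
  set n := sSup {n : ℕ | jumpOf s n ≤ t} with hn
  have hbdd : BddAbove {n : ℕ | jumpOf s n ≤ t} := by
    obtain ⟨N, hN⟩ := eventually_atTop.1 (hreg.2.eventually_gt_atTop (t : ℝ))
    refine ⟨N, fun m hm => ?_⟩
    by_contra hlt
    exact absurd (hN m (not_le.1 hlt).le) (not_lt.2 hm)
  have hmem : jumpOf s n ≤ t := by
    have h0 : (0 : ℕ) ∈ {n : ℕ | jumpOf s n ≤ t} := by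
      change jumpOf s 0 ≤ t
      rw [jumpOf, Finset.sum_range_zero]
      exact t.2
    exact Nat.sSup_mem ⟨0, h0⟩ hbdd
  have hnot : (t : ℝ) < jumpOf s (n + 1) := by
    by_contra hle
    exact absurd (le_csSup hbdd (show n + 1 ∈ {n : ℕ | jumpOf s n ≤ t} from not_lt.1 hle))
      (by rw [← hn]; omega)
  rw [hs, jumpOf_stitData] at hmem hnot
  have hsome : ∀ m, ∃ e, nextWord (death lt) m = some e := by
    intro m
    obtain ⟨e, -, he⟩ := (hreg.1 (m + 1)).2 m (Nat.lt_succ_self m)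
    exact ⟨e, he⟩
  have hset := setOf_alive_eq (cellLife_nonneg hz _) hsome hmem hnot
  have h1 : stitCells Λ W.carrier z g t = pathCell W.carrier (stitHyp W.carrier g) ''
      {e | birth lt e ≤ t ∧ (t : ℝ) < death lt e} := rfl
  rw [h1, hset, ← leaves_stitData]
  exact image_congr fun e he => (pathCell_hypMap_stitData he).symm

theorem isTessellation_stitCells {z : Word → ℝ} {g : ℕ → Hyp ℓ} (hz : ∀ e, 0 ≤ z e)
    (hreg : Regular W (stitData Λ W z (stitHyp W.carrier g))) (t : ℝ≥0) :
    IsTessellation W.carrier (stitCells Λ W.carrier z g t) := by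
  obtain ⟨n, -, h⟩ := stitCells_eq hz hreg t
  rw [h]
  exact ((isLeafSet_leaves _ n).isTessellation_iff W _).2 (hreg.1 n).1

theorem stitPath_eq_pathOf {z : Word → ℝ} {g : ℕ → Hyp ℓ} (hz : ∀ e, 0 ≤ z e)
    (hreg : Regular W (stitData Λ W z (stitHyp W.carrier g))) :
    stitPath Λ W z g = pathOf W (stitData Λ W z (stitHyp W.carrier g)) := by
  ext1 t
  obtain ⟨n, hn, h⟩ := stitCells_eq hz hreg t
  rw [stitPath, h, pathOf, ← hn]
  rfl

/-- The jumps of the STIT tessellation have the law of the jumps produced by competing clocks. -/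
theorem IsHyperplaneMeasure.exists_map_stitData_eq (hΛ : IsHyperplaneMeasure Λ) (W : Window ℓ) :
    ∃ S : (Word → ℝ) × (ℕ → Hyp ℓ) → ℕ → Datum ℓ, Measurable S ∧
      (∀ᵐ p ∂(Measure.infinitePi fun _ : Word => expMeasure 1).prod
        (Measure.infinitePi fun _ : ℕ => normalized Λ W.carrier),
        stitData Λ W p.1 (stitHyp W.carrier p.2) = S p) ∧
      ((Measure.infinitePi fun _ : Word => expMeasure 1).prod
        (Measure.infinitePi fun _ : ℕ => normalized Λ W.carrier)).map S = jumpsLaw Λ W := by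
  have hνp := hΛ.isProbabilityMeasure_window W
  obtain ⟨A, B, hA, hB, hAe, hBe, hAB⟩ := hΛ.exists_map_stitHyp_eq W
  set Z := Measure.infinitePi fun _ : Word => expMeasure 1 with hZ
  set μ₁ := Measure.infinitePi fun _ : ℕ => normalized Λ W.carrier with hμ₁
  set μ₂ := Measure.infinitePi fun _ : Word => μ₁ with hμ₂
  have hsm := hΛ.measurable_stitData W
  have hSm : Measurable fun p : (Word → ℝ) × (ℕ → Hyp ℓ) => stitData Λ W p.1 (A p.2) := by
    have h1 := hsm.comp ((measurable_id (α := Word → ℝ)).prodMap hA)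
    exact h1
  refine ⟨fun p => stitData Λ W p.1 (A p.2), hSm, ?_, ?_⟩
  · filter_upwards [Measure.quasiMeasurePreserving_snd.ae hAe] with p hp
    rw [hp]
  have h1 : MeasurePreserving (fun q : Word → (ℕ → Hyp ℓ) × (ℕ → ℝ) => fun e => (q e).1)
      (Measure.infinitePi fun _ : Word => supplyLaw Λ W) μ₂ := by
    have h2 : MeasurePreserving (fun q : Word → (ℕ → Hyp ℓ) × (ℕ → ℝ) =>
        (fun e => (q e).1, fun e => (q e).2)) (Measure.infinitePi fun _ : Word => supplyLaw Λ W)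
        (μ₂.prod (Measure.infinitePi fun _ : Word =>
          Measure.infinitePi fun _ : ℕ => expMeasure 1)) :=
      ⟨by fun_prop, map_unzip_infinitePi _ _⟩
    have h3 := (measurePreserving_fst (μ := μ₂) (ν := Measure.infinitePi fun _ : Word =>
      Measure.infinitePi fun _ : ℕ => expMeasure 1)).comp h2
    exact h3
  have hsupp := hΛ.isProbabilityMeasure_supplyLaw W
  have h4 : MeasurePreserving (fun ω : Word → ℝ × Supply ℓ => (fun e => (ω e).1, fun e => (ω e).2))
      (clockSource Λ W) (Z.prod (Measure.infinitePi fun _ : Word => supplyLaw Λ W)) :=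
    ⟨by fun_prop, map_unzip_infinitePi _ _⟩
  have h5 := ((MeasurePreserving.id Z).prod h1).comp h4
  have hBp : MeasurePreserving B μ₂ (μ₂.map B) := ⟨hB, rfl⟩
  have hAp : MeasurePreserving A μ₁ (μ₂.map B) := ⟨hA, hAB⟩
  have hprob : IsProbabilityMeasure (μ₂.map B) := Measure.isProbabilityMeasure_map hB.aemeasurable
  have h6 := ((MeasurePreserving.id Z).prod hBp).comp h5
  have h7 := (MeasurePreserving.id Z).prod hAp
  have h8 : (fun p : (Word → ℝ) × (ℕ → Hyp ℓ) => stitData Λ W p.1 (A p.2))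
      = (fun p : (Word → ℝ) × (Word → Hyp ℓ) => stitData Λ W p.1 p.2) ∘ Prod.map id A := rfl
  rw [h8, ← Measure.map_map hsm h7.measurable, h7.map_eq, ← h6.map_eq,
    Measure.map_map hsm h6.measurable, jumpsLaw]
  refine Measure.map_congr ?_
  filter_upwards [hΛ.ae_proper W] with ω hω
  exact (chainData_eq_stitData ω (fun n => (hω n).1) hΛ (H := B fun e => (ω e).2.1)
    fun e => hBe _ e).symm

end STIT

end

theorem mainTheorem1 {ℓ : ℕ} (Λ : Measure (STIT.Hyp ℓ)) (hΛ : STIT.IsHyperplaneMeasure Λ)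
    (W : STIT.Window ℓ)
    -- the random variables of the new construction and the maps `Ξ`
    {Ω : Type*} [MeasurableSpace Ω] (P : Measure Ω) [IsProbabilityMeasure P]
    (U V : ℕ → Ω → ℝ) (G : ℕ → Ω → STIT.Hyp ℓ)
    (hU : ∀ n, HasLaw (U n) (volume.restrict (Set.Ico (0 : ℝ) 1)) P)
    (hV : ∀ n, HasLaw (V n) (expMeasure 1) P)
    (hG : ∀ n, HasLaw (G n) (STIT.normalized Λ W.carrier) P)
    (hUi : iIndepFun U P) (hVi : iIndepFun V P) (hGi : iIndepFun G P)
    (hUVG : IndepFun (fun ω n => U n ω) (fun ω => ((fun n => V n ω), (fun n => G n ω))) P)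
    (hVG : IndepFun (fun ω n => V n ω) (fun ω n => G n ω) P)
    (Ξ : ℕ → STIT.Tess W → STIT.Hyp ℓ → STIT.Hyp ℓ) (hΞ : STIT.IsTransport Λ W Ξ)
    -- the random variables of the STIT tessellation
    {Ω' : Type*} [MeasurableSpace Ω'] (P' : Measure Ω') [IsProbabilityMeasure P']
    (Z : STIT.Word → Ω' → ℝ) (G' : ℕ → Ω' → STIT.Hyp ℓ)
    (hZ : ∀ e, HasLaw (Z e) (expMeasure 1) P')
    (hG' : ∀ n, HasLaw (G' n) (STIT.normalized Λ W.carrier) P')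
    (hZi : iIndepFun Z P') (hGi' : iIndepFun G' P')
    (hZG : IndepFun (fun ω e => Z e ω) (fun ω n => G' n ω) P') :
    -- both constructions are almost surely well defined for all times
    (∀ᵐ ω ∂P,
      (∀ n, STIT.IsTessellation W.carrier
        (STIT.labelledSeq W Ξ (fun n => U n ω) (fun n => G n ω) n).cells) ∧
      Tendsto (STIT.jumpTime Λ W Ξ (fun n => U n ω) (fun n => V n ω) (fun n => G n ω)) atTop atTop) ∧
    (∀ᵐ ω ∂P', ∀ t : ℝ≥0, STIT.IsTessellation W.carrier
      (STIT.stitCells Λ W.carrier (fun e => Z e ω) (fun n => G' n ω) t)) ∧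
    -- and they have the same law, as random functions of time
    IdentDistrib
      (fun ω => STIT.newPath Λ W Ξ (fun n => U n ω) (fun n => V n ω) (fun n => G n ω))
      (fun ω => STIT.stitPath Λ W (fun e => Z e ω) (fun n => G' n ω)) P P' := by
  -- there is a hyperplane, since `Λ` does not vanish
  have hne : Nonempty (STIT.Hyp ℓ) := by
    by_contra h
    rw [not_nonempty_iff] at h
    exact hΛ.ne_zero Λ.eq_zero_of_isEmpty
  obtain ⟨h₀⟩ := hne
  have : Inhabited (STIT.Hyp ℓ) := ⟨h₀⟩
  have := hΛ.isProbabilityMeasure_window W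
  -- the joint laws of the driving random variables
  have hUlaw := hUi.hasLaw_infinitePi hU (aemeasurable_pi_iff.2 fun n => (hU n).aemeasurable)
  have hVlaw := hVi.hasLaw_infinitePi hV (aemeasurable_pi_iff.2 fun n => (hV n).aemeasurable)
  have hGlaw := hGi.hasLaw_infinitePi hG (aemeasurable_pi_iff.2 fun n => (hG n).aemeasurable)
  have hZlaw := hZi.hasLaw_infinitePi hZ (aemeasurable_pi_iff.2 fun n => (hZ n).aemeasurable)
  have hGlaw' := hGi'.hasLaw_infinitePi hG' (aemeasurable_pi_iff.2 fun n => (hG' n).aemeasurable)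
  have hnoise := STIT.hasLaw_noiseLaw hΛ W P hUlaw hVlaw hGlaw hUVG hVG
  have hZG' := hZG.hasLaw_prod hZlaw hGlaw'
  -- the jumps of both processes have the same law
  obtain ⟨N, hNm, hNlaw, hNae⟩ := hΛ.exists_newData W hΞ
  obtain ⟨S, hSm, hSae, hSlaw⟩ := hΛ.exists_map_stitData_eq W
  have hN : HasLaw (fun ω => N fun n => (U n ω, V n ω, G n ω)) (STIT.jumpsLaw Λ W) P :=
    ⟨hNm.comp_aemeasurable hnoise.aemeasurable, by
      rw [← Function.comp_def N, ← AEMeasurable.map_map_of_aemeasurable hNm.aemeasurable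
        hnoise.aemeasurable, hnoise.map_eq, hNlaw]
      rfl⟩
  have hS : HasLaw (fun ω => S ((fun e => Z e ω), fun n => G' n ω)) (STIT.jumpsLaw Λ W) P' :=
    ⟨hSm.comp_aemeasurable hZG'.aemeasurable, by
      rw [← Function.comp_def S, ← AEMeasurable.map_map_of_aemeasurable hSm.aemeasurable
        hZG'.aemeasurable, hZG'.map_eq, hSlaw]⟩
  have hNae' := STIT.ae_of_hasLaw hnoise hNae
  have hSae' := STIT.ae_of_hasLaw hZG' hSae
  have hVae := STIT.ae_of_hasLaw hVlaw STIT.ae_tendsto_harmonic_expMeasure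
  have hproper := STIT.ae_of_hasLaw hN (hΛ.ae_jumpsLaw_proper W)
  have hreg : ∀ᵐ ω ∂P, STIT.Regular W (N fun n => (U n ω, V n ω, G n ω)) := by
    filter_upwards [hNae', hVae, hproper] with ω h1 h2 h3
    refine ⟨h3, hΛ.tendsto_jumpOf (v := fun n => V n ω) (fun n => ?_) (fun n => (h3 n).1) h2.1 h2.2⟩
    exact congrArg Prod.fst (h1 n)
  have hreg' : ∀ᵐ ω ∂P', STIT.Regular W (S ((fun e => Z e ω), fun n => G' n ω)) :=
    (hN.identDistrib hS).ae_snd (STIT.measurableSet_regular W) hreg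
  have hZpos : ∀ᵐ ω ∂P', ∀ e, 0 ≤ Z e ω := by
    rw [ae_all_iff]
    exact fun e => STIT.ae_of_hasLaw (hZ e) STIT.expMeasure_one_ae_nonneg
  refine ⟨?_, ?_, ?_⟩
  · filter_upwards [hNae', hreg] with ω h1 h2
    refine ⟨fun n => ?_, ?_⟩
    · rw [(STIT.describes_labelledSeq h1 n).cells_eq]
      exact ((STIT.isLeafSet_leaves _ n).isTessellation_iff W _).2 (h2.1 n).1
    · rw [funext (hΛ.jumpTime_eq_jumpOf h1 fun n => (h2.1 n).1)]
      exact h2.2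
  · filter_upwards [hSae', hreg', hZpos] with ω h1 h2 h3
    rw [← h1] at h2
    exact STIT.isTessellation_stitCells h3 h2
  · have h1 : (fun ω => STIT.newPath Λ W Ξ (fun n => U n ω) (fun n => V n ω) (fun n => G n ω))
        =ᵐ[P] fun ω => STIT.pathOf W (N fun n => (U n ω, V n ω, G n ω)) := by
      filter_upwards [hNae', hreg] with ω h1 h2
      exact hΛ.newPath_eq_pathOf h1 fun n => (h2.1 n).1
    have h2 : (fun ω => STIT.stitPath Λ W (fun e => Z e ω) (fun n => G' n ω))
        =ᵐ[P'] fun ω => STIT.pathOf W (S ((fun e => Z e ω), fun n => G' n ω)) := by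
      filter_upwards [hSae', hreg', hZpos] with ω h1 h2 h3
      rw [← h1] at h2 ⊢
      exact STIT.stitPath_eq_pathOf h3 h2
    have h3 := (hN.identDistrib hS).comp (STIT.measurable_pathOf W)
    exact ⟨h3.aemeasurable_fst.congr h1.symm, h3.aemeasurable_snd.congr h2.symm, by
      rw [Measure.map_congr h1, Measure.map_congr h2]
      exact h3.map_eq⟩
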